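/- **Equivalent characterizations of infinitesimal Hilbertianity.** Let $(M,d,\mathfrak m)$ be a complete separable metric space equipped with a non-negative Radon (i.e. locally finite Borel) measure. *Definitions.* A test plan is a Borel probability measure $\pi$ on $C([0,1],M)$ such that $(e_t)_\#\pi\le C\,\mathfrak m$ for all $t\in[0,1]$ and some constant $C$ ($e_t(\gamma)=\gamma_t$) and $\iint_0^1|\dot\gamma_t|^2\,dt\,d\pi(\gamma)<\infty$, where $|\dot\gamma_t|$ is the metric speed and the inner integral is $+\infty$ if $\gamma$ is not absolutely continuous. The Sobolev class $S^2(M)$ is the set of $f\in L^0(\mathfrak m)$ for which there is a non-negative $G\in L^2(\mathfrak m)$ with $\int|f(\gamma_1)-f(\gamma_0)|\,d\pi(\gamma)\le\iint_0^1G(\gamma_t)|\dot\gamma_t|\,dt\,d\pi(\gamma)$ for every test plan $\pi$; $|Df|$ is the $\mathfrak m$-a.e. minimal such $G$. The space $W^{1,2}(M)=L^2\cap S^2(M)$ has the norm given by $\|f\|^2_{W^{1,2}}=\|f\|^2_{L^2}+\||Df|\|^2_{L^2}$, and $(M,d,\mathfrak m)$ is *infinitesimally Hilbertian* if $W^{1,2}(M)$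 is a Hilbert space. An $L^\infty(\mathfrak m)$-module is a Banach space $V$ with a bilinear multiplication $L^\infty(\mathfrak m)\times V\to V$ such that $(fg)v=f(gv)$, $1v=v$, $\|fv\|\le\|f\|_{L^\infty}\|v\|$, with two further properties: (locality) if $\chi_{A_n}v=0$ for all $n\in\mathbb N$ then $\chi_{\cup_nA_n}v=0$; (gluing) if $\chi_{A_i\cap A_j}v_i=\chi_{A_i\cap A_j}v_j$ for all $i,j$ and $\varlimsup_n\|\sum_{i\le n}\chi_{A_i}v_i\|<\infty$, then there is $v\in V$ with $\chi_{A_i}v=\chi_{A_i}v_i$ for all $i$ and $\|v\|\le\varliminf_n\|\sum_{i\le n}\chi_{A_i}v_i\|$. It is a *Hilbert module* if, as a Banach space, it is a Hilbert space. The cotangent module $L^2(T^*M)$ is the completion of the space of families $(f_i,A_i)_{i\in\mathbb N}$, with $(A_i)$ a Borel partition of $M$, $f_i\in S^2(M)$ and $\sum_i\int_{A_i}|Df_i|^2\,d\mathfrak m<\infty$, modulo the relation $(f_i,A_i)\sim(g_j,B_j)$ iff $|D(f_i-g_j)|=0$ a.e. on $A_i\cap B_j$ for all $i,j$, with the norm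 $\big(\sum_i\int_{A_i}|Df_i|^2\,d\mathfrak m\big)^{1/2}$; its pointwise norm $|\cdot|_*$ is the continuous extension of $|(f_i,A_i)|_*=|Df_i|$ on $A_i$, its multiplication is the continuous extension of the obvious multiplication by simple functions, and $df:=[(f,M)]$ for $f\in S^2(M)$. The tangent module $L^2(TM)$ is the dual module: the bounded linear maps $X:L^2(T^*M)\to L^1(\mathfrak m)$, $\omega\mapsto\omega(X)$, with $(h\omega)(X)=h\,\omega(X)$ for $h\in L^\infty(\mathfrak m)$; its norm is the operator norm, its multiplication is given by $\omega(hX)=h\,\omega(X)$, and the pointwise norm is $|X|=\operatorname{ess\,sup}\{|\omega(X)|:|\omega|_*\le1\ \mathfrak m\text{-a.e.}\}$. A gradient of $g\in S^2(M)$ is an $X\in L^2(TM)$ with $dg(X)=|X|^2=|dg|_*^2$ $\mathfrak m$-a.e. The space is *infinitesimally strictly convex* if every $g\in S^2(M)$ has exactly one gradient, then denoted by $\nabla g$. *Statement.* The following are equivalent: 1. $(M,d,\mathfrak m)$ is infinitesimally Hilbertian. 2. $(M,d,\mathfrak m)$ is infinitesimally strictly convex and $df(\nabla g)=dg(\nabla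 f)$ $\mathfrak m$-a.e. for all $f,g\in S^2(M)$. 3. $L^2(T^*M)$ and $L^2(TM)$ are Hilbert modules. 4. $(M,d,\mathfrak m)$ is infinitesimally strictly convex and $\nabla(f+g)=\nabla f+\nabla g$ for all $f,g\in S^2(M)$. 5. $(M,d,\mathfrak m)$ is infinitesimally strictly convex and $\nabla(fg)=f\nabla g+g\nabla f$ for all $f,g\in S^2(M)\cap L^\infty(\mathfrak m)$. -/

import Mathlib

open MeasureTheory Filter Topology
open scoped ENNReal NNReal unitInterval

namespace MMS

noncomputable section

/-! ## Curves, test plans and the Sobolev class -/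

section Curves

variable {M : Type*} [MetricSpace M]

/-- The space of continuous curves `C([0,1], M)`, with the topology of uniform convergence, carries
its Borel σ-algebra. -/
instance curveMeasurableSpace : MeasurableSpace C(I, M) := borel _

instance curveBorelSpace : BorelSpace C(I, M) := ⟨rfl⟩

/-- `γ` is absolutely continuous: `d(γ_t, γ_s) ≤ ∫_s^t f` for some `f ∈ L¹(0,1)` and all `s ≤ t`. -/
def IsACCurve (γ : C(I, M)) : Prop :=
  ∃ f : ℝ → ℝ, IntegrableOn f (Set.Icc 0 1) ∧
    ∀ s t : I, s ≤ t → dist (γ t) (γ s) ≤ ∫ r in (s : ℝ)..(t : ℝ), f r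

/-- The metric speed `|γ'_t|`. For an absolutely continuous curve the upper limit is, for
a.e. `t`, a limit, and gives the a.e. least `f ∈ L¹(0,1)` that is admissible in `IsACCurve`. -/
def metricSpeed (γ : C(I, M)) (t : I) : ℝ≥0∞ :=
  limsup (fun s : I => edist (γ s) (γ t) / edist s t) (𝓝[≠] t)

open Classical in
/-- `∫₀¹ |γ'_t|² dt`, with value `∞` on curves that are not absolutely continuous. -/
def kineticEnergy (γ : C(I, M)) : ℝ≥0∞ :=
  if IsACCurve γ then ∫⁻ t : I, metricSpeed γ t ^ 2 else ∞

/-- Test plans: probability measures `π` on `C([0,1], M)` with `(e_t)_# π ≤ C m` for all `t`, for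
some constant `C`, and with finite kinetic energy. -/
structure IsTestPlan [MeasurableSpace M] (m : Measure M) (π : Measure C(I, M)) : Prop where
  isProbabilityMeasure : IsProbabilityMeasure π
  bounded_compression : ∃ C : ℝ≥0, ∀ t : I, π.map (fun γ : C(I, M) => γ t) ≤ C • m
  finite_energy : ∫⁻ γ, kineticEnergy γ ∂π < ∞

/-- The nonnegative function `G ∈ L²(m)` is a weak upper gradient of `f ∈ L⁰(m)`:
`∫ |f(γ_1) - f(γ_0)| dπ(γ) ≤ ∫ ∫₀¹ G(γ_t) |γ'_t| dt dπ(γ)` for every test plan `π`. -/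
def IsWeakUpperGradient [MeasurableSpace M] {m : Measure M} (f : M →ₘ[m] ℝ) (G : Lp ℝ 2 m) :
    Prop :=
  0 ≤ G ∧ ∀ π : Measure C(I, M), IsTestPlan m π →
    ∫⁻ γ, ENNReal.ofReal |f (γ 1) - f (γ 0)| ∂π ≤
      ∫⁻ γ, (∫⁻ t : I, ENNReal.ofReal (G (γ t)) * metricSpeed γ t) ∂π

end Curves

section LpOrder

variable {M : Type*} [MeasurableSpace M] {m : Measure M}

lemma smul_le_smul_Lp {c : ℝ} (hc : 0 ≤ c) {F G : Lp ℝ 2 m} (h : F ≤ G) : c • F ≤ c • G := by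
  rw [← Lp.coeFn_le] at h ⊢
  filter_upwards [h, Lp.coeFn_smul c F, Lp.coeFn_smul c G] with x h1 h2 h3
  rw [h2, h3]
  exact mul_le_mul_of_nonneg_left h1 hc

/-- A nonempty set of nonnegative elements of `L²(m)` has an essential infimum. -/
lemma exists_isGLB_of_nonneg {S : Set (Lp ℝ 2 m)} (hS : S.Nonempty) (h0 : ∀ G ∈ S, 0 ≤ G) :
    ∃ H, IsGLB S H := by
  have mono : ∀ {H K : Lp ℝ 2 m}, 0 ≤ H → H ≤ K → ‖H‖ ^ 2 + ‖K - H‖ ^ 2 ≤ ‖K‖ ^ 2 := by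
    intro H K hH hHK
    have hin : 0 ≤ inner ℝ H (K - H) := by
      rw [L2.inner_def]
      refine integral_nonneg_of_ae ?_
      filter_upwards [(Lp.coeFn_nonneg H).2 hH, (Lp.coeFn_nonneg (K - H)).2 (sub_nonneg.2 hHK)]
        with x h1 h2
      exact mul_nonneg h2 h1
    have := norm_add_sq_real H (K - H)
    rw [add_sub_cancel] at this
    linarith
  obtain ⟨G₀, hG₀⟩ := hS
  let L : Set (Lp ℝ 2 m) := {H | 0 ≤ H ∧ ∀ G ∈ S, H ≤ G}
  have hLbd : ∀ H ∈ L, ‖H‖ ^ 2 ≤ ‖G₀‖ ^ 2 := fun H hH => by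
    have := mono hH.1 (hH.2 _ hG₀)
    nlinarith [sq_nonneg ‖G₀ - H‖]
  let N : Set ℝ := (fun H : Lp ℝ 2 m => ‖H‖ ^ 2) '' L
  have hNne : N.Nonempty := ⟨_, 0, ⟨le_rfl, h0⟩, rfl⟩
  have hNbd : BddAbove N := ⟨‖G₀‖ ^ 2, by rintro _ ⟨H, hH, rfl⟩; exact hLbd H hH⟩
  have hsup : ∀ n : ℕ, ∃ H ∈ L, sSup N - 1 / (n + 1) < ‖H‖ ^ 2 := fun n => by
    obtain ⟨_, ⟨H, hH, rfl⟩, hlt⟩ := exists_lt_of_lt_csSup hNne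
      (show sSup N - 1 / ((n : ℝ) + 1) < sSup N by
        have : (0 : ℝ) < 1 / ((n : ℝ) + 1) := by positivity
        linarith)
    exact ⟨H, hH, hlt⟩
  choose H hHL hHlt using hsup
  let K : ℕ → Lp ℝ 2 m := fun n => partialSups H n
  have hKL : ∀ n, K n ∈ L := fun n => by
    refine ⟨(hHL 0).1.trans (le_partialSups_of_le H (Nat.zero_le n)), fun G hG => ?_⟩
    exact partialSups_le H n G fun i _ => (hHL i).2 G hG
  have hKN : ∀ n, ‖K n‖ ^ 2 ≤ sSup N := fun n => le_csSup hNbd ⟨_, hKL n, rfl⟩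
  have hKlt : ∀ n : ℕ, sSup N - 1 / (n + 1) < ‖K n‖ ^ 2 := fun n => by
    have := mono (hHL n).1 (le_partialSups H n)
    have h2 := hHlt n
    have h3 : (0 : ℝ) ≤ ‖K n - H n‖ ^ 2 := sq_nonneg _
    change ‖H n‖ ^ 2 + ‖K n - H n‖ ^ 2 ≤ ‖K n‖ ^ 2 at this
    linarith
  have hKmono : Monotone K := (partialSups H).monotone
  have hdist : ∀ n k, n ≤ k → ‖K k - K n‖ ^ 2 ≤ 1 / ((n : ℝ) + 1) := fun n k hnk => by
    have := mono (hKL n).1 (hKmono hnk)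
    linarith [hKN k, hKlt n]
  have hcauchy : CauchySeq K := by
    refine cauchySeq_of_le_tendsto_0' (fun n : ℕ => Real.sqrt (1 / ((n : ℝ) + 1)))
      (fun n k hnk => ?_) ?_
    · rw [dist_comm, dist_eq_norm]
      exact Real.le_sqrt_of_sq_le (hdist n k hnk)
    · have := (Real.continuous_sqrt.tendsto 0).comp
        (tendsto_one_div_add_atTop_nhds_zero_nat (𝕜 := ℝ))
      simpa [Function.comp_def] using this
  obtain ⟨H', hH'⟩ := cauchySeq_tendsto_of_complete hcauchy
  have hH'L : H' ∈ L :=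
    ⟨ge_of_tendsto' hH' fun n => (hKL n).1, fun G hG => le_of_tendsto' hH' fun n => (hKL n).2 G hG⟩
  have hH'N : sSup N ≤ ‖H'‖ ^ 2 := by
    have h1 : Tendsto (fun n => ‖K n‖ ^ 2) atTop (𝓝 (‖H'‖ ^ 2)) := (hH'.norm).pow 2
    have h2 : Tendsto (fun n : ℕ => sSup N - 1 / ((n : ℝ) + 1)) atTop (𝓝 (sSup N - 0)) :=
      tendsto_const_nhds.sub tendsto_one_div_add_atTop_nhds_zero_nat
    rw [sub_zero] at h2
    exact le_of_tendsto_of_tendsto' h2 h1 fun n => (hKlt n).le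
  refine ⟨H', fun G hG => hH'L.2 G hG, fun J hJ => ?_⟩
  have hJL : H' ⊔ J ∈ L := ⟨hH'L.1.trans le_sup_left, fun G hG => sup_le (hH'L.2 G hG) (hJ hG)⟩
  have h1 := mono hH'L.1 (le_sup_left : H' ≤ H' ⊔ J)
  have h2 : ‖H' ⊔ J‖ ^ 2 ≤ sSup N := le_csSup hNbd ⟨_, hJL, rfl⟩
  have h3 : ‖H' ⊔ J - H'‖ ^ 2 = 0 := le_antisymm (by linarith) (sq_nonneg _)
  have h4 : H' ⊔ J = H' := by
    rw [← sub_eq_zero, ← norm_eq_zero]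
    exact pow_eq_zero_iff (two_ne_zero) |>.1 h3
  exact h4 ▸ le_sup_right

end LpOrder

section Sobolev

variable {M : Type*} [MetricSpace M] [SecondCountableTopology M] [MeasurableSpace M]
  [BorelSpace M] {m : Measure M}

lemma IsTestPlan.ae_eval {π : Measure C(I, M)} (hπ : IsTestPlan m π) {p : M → Prop}
    (hp : ∀ᵐ x ∂m, p x) (t : I) : ∀ᵐ γ ∂π, p (γ t) := by
  obtain ⟨C, hC⟩ := hπ.bounded_compression
  have hmeas : Measurable (fun γ : C(I, M) => γ t) :=
    (continuous_eval_const t).measurable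
  have hac : π.map (fun γ : C(I, M) => γ t) ≪ m :=
    (Measure.absolutelyContinuous_of_le (hC t)).trans
      (Measure.smul_absolutelyContinuous)
  exact ae_of_ae_map hmeas.aemeasurable (hac.ae_le hp)

lemma IsTestPlan.ae_ae_eval {π : Measure C(I, M)} (hπ : IsTestPlan m π) {p : M → Prop}
    (hp : ∀ᵐ x ∂m, p x) : ∀ᵐ γ ∂π, ∀ᵐ t : I, p (γ t) := by
  have := hπ.isProbabilityMeasure
  have hp' : ∀ᵐ x ∂m, x ∉ toMeasurable m {x | ¬ p x} := by
    rw [ae_iff]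
    simpa [measure_toMeasurable] using ae_iff.1 hp
  have hev : Measurable (fun q : C(I, M) × I => q.1 q.2) :=
    (continuous_eval : Continuous fun q : C(I, M) × I => q.1 q.2).measurable
  have key : ∀ᵐ γ ∂π, ∀ᵐ t : I, γ t ∉ toMeasurable m {x | ¬ p x} := by
    rw [Measure.ae_ae_comm]
    · exact Eventually.of_forall fun t => hπ.ae_eval hp' t
    · exact hev (measurableSet_toMeasurable m {x | ¬ p x}).compl
  filter_upwards [key] with γ hγ
  filter_upwards [hγ] with t ht
  by_contra hn
  exact ht (subset_toMeasurable m {x | ¬ p x} hn)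

/-- Estimate used for linear combinations and products: if the increments of `h` are bounded by
`a` times those of `f` plus `b` times those of `g`, then `a F + b G` is a weak upper gradient. -/
lemma IsWeakUpperGradient.comb {f g h : M →ₘ[m] ℝ} {F G : Lp ℝ 2 m}
    (hF : IsWeakUpperGradient f F) (hG : IsWeakUpperGradient g G) {a b : ℝ} (ha : 0 ≤ a)
    (hb : 0 ≤ b)
    (hh : ∀ π, IsTestPlan m π → ∀ᵐ γ ∂π,
      |h (γ 1) - h (γ 0)| ≤ a * |f (γ 1) - f (γ 0)| + b * |g (γ 1) - g (γ 0)|) :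
    IsWeakUpperGradient h (a • F + b • G) := by
  refine ⟨add_nonneg (by simpa using smul_le_smul_Lp ha hF.1) (by simpa using smul_le_smul_Lp hb hG.1), fun π hπ => ?_⟩
  have hFp := (Lp.coeFn_nonneg F).2 hF.1
  have hGp := (Lp.coeFn_nonneg G).2 hG.1
  have hcoe : ∀ᵐ x ∂m, (a • F + b • G : Lp ℝ 2 m) x = a * F x + b * G x := by
    filter_upwards [Lp.coeFn_add (a • F) (b • G), Lp.coeFn_smul a F, Lp.coeFn_smul b G]
      with x h1 h2 h3
    rw [h1, Pi.add_apply, h2, h3]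
    rfl
  have hmeas : ∀ u : M →ₘ[m] ℝ, Measurable fun γ : C(I, M) => ENNReal.ofReal |u (γ 1) - u (γ 0)| :=
    fun u => by
      have h1 : Measurable u := u.measurable
      have e1 : Measurable fun γ : C(I, M) => γ 1 :=
        (continuous_eval_const (1 : I)).measurable
      have e0 : Measurable fun γ : C(I, M) => γ 0 :=
        (continuous_eval_const (0 : I)).measurable
      have := (h1.comp e1).sub (h1.comp e0)
      exact (continuous_abs.measurable.comp this).ennreal_ofReal
  calc ∫⁻ γ, ENNReal.ofReal |h (γ 1) - h (γ 0)| ∂π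
      ≤ ∫⁻ γ, (ENNReal.ofReal a * ENNReal.ofReal |f (γ 1) - f (γ 0)| +
          ENNReal.ofReal b * ENNReal.ofReal |g (γ 1) - g (γ 0)|) ∂π := by
        refine lintegral_mono_ae ?_
        filter_upwards [hh π hπ] with γ hγ
        rw [← ENNReal.ofReal_mul ha, ← ENNReal.ofReal_mul hb,
          ← ENNReal.ofReal_add (by positivity) (by positivity)]
        exact ENNReal.ofReal_le_ofReal hγ
    _ = ENNReal.ofReal a * ∫⁻ γ, ENNReal.ofReal |f (γ 1) - f (γ 0)| ∂π +
          ENNReal.ofReal b * ∫⁻ γ, ENNReal.ofReal |g (γ 1) - g (γ 0)| ∂π := by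
        rw [lintegral_add_left ((hmeas f).const_mul _), lintegral_const_mul _ (hmeas f),
          lintegral_const_mul _ (hmeas g)]
    _ ≤ ENNReal.ofReal a * (∫⁻ γ, (∫⁻ t : I, ENNReal.ofReal (F (γ t)) * metricSpeed γ t) ∂π) +
          ENNReal.ofReal b * (∫⁻ γ, (∫⁻ t : I, ENNReal.ofReal (G (γ t)) * metricSpeed γ t) ∂π) := by
        exact add_le_add (mul_le_mul' le_rfl (hF.2 π hπ)) (mul_le_mul' le_rfl (hG.2 π hπ))
    _ ≤ ∫⁻ γ, (ENNReal.ofReal a * (∫⁻ t : I, ENNReal.ofReal (F (γ t)) * metricSpeed γ t) +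
          ENNReal.ofReal b * (∫⁻ t : I, ENNReal.ofReal (G (γ t)) * metricSpeed γ t)) ∂π := by
        refine le_trans (add_le_add (lintegral_const_mul_le _ _) (lintegral_const_mul_le _ _)) ?_
        exact le_lintegral_add _ _
    _ ≤ ∫⁻ γ, (∫⁻ t : I, ENNReal.ofReal ((a • F + b • G : Lp ℝ 2 m) (γ t)) *
          metricSpeed γ t) ∂π := by
        refine lintegral_mono_ae ?_
        filter_upwards [hπ.ae_ae_eval hcoe, hπ.ae_ae_eval hFp, hπ.ae_ae_eval hGp]
          with γ h1 h2 h3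
        refine le_trans (add_le_add (lintegral_const_mul_le _ _) (lintegral_const_mul_le _ _)) ?_
        refine le_trans (le_lintegral_add _ _) (lintegral_mono_ae ?_)
        filter_upwards [h1, h2, h3] with t h1 h2 h3
        simp only [Pi.zero_apply] at h2 h3
        rw [h1, ENNReal.ofReal_add (by positivity) (by positivity), ENNReal.ofReal_mul ha,
          ENNReal.ofReal_mul hb, add_mul, mul_assoc, mul_assoc]

variable (m) in
/-- The Sobolev class `S²(M)`: the functions in `L⁰(m)` with a weak upper gradient in `L²(m)`. -/
def sobolevClass : Submodule ℝ (M →ₘ[m] ℝ) where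
  carrier := {f | ∃ G : Lp ℝ 2 m, IsWeakUpperGradient f G}
  zero_mem' := by
    refine ⟨0, le_rfl, fun π hπ => ?_⟩
    have h0 : ∀ᵐ x ∂m, (0 : M →ₘ[m] ℝ) x = 0 := AEEqFun.coeFn_zero
    refine le_of_eq_of_le ?_ bot_le
    rw [ENNReal.bot_eq_zero, lintegral_eq_zero_iff' ?_]
    · filter_upwards [hπ.ae_eval h0 1, hπ.ae_eval h0 0] with γ h1 h2
      simp [h1, h2]
    · refine AEMeasurable.congr (f := fun _ => 0) aemeasurable_const ?_
      filter_upwards [hπ.ae_eval h0 1, hπ.ae_eval h0 0] with γ h1 h2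
      simp [h1, h2]
  add_mem' := by
    rintro f g ⟨F, hF⟩ ⟨G, hG⟩
    refine ⟨_, hF.comb hG zero_le_one zero_le_one fun π hπ => ?_⟩
    have h0 : ∀ᵐ x ∂m, (f + g) x = f x + g x := AEEqFun.coeFn_add f g
    filter_upwards [hπ.ae_eval h0 1, hπ.ae_eval h0 0] with γ h1 h2
    rw [h1, h2, one_mul, one_mul]
    calc |f (γ 1) + g (γ 1) - (f (γ 0) + g (γ 0))|
        = |(f (γ 1) - f (γ 0)) + (g (γ 1) - g (γ 0))| := by ring_nf
      _ ≤ _ := abs_add_le _ _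
  smul_mem' := by
    rintro c f ⟨F, hF⟩
    refine ⟨_, hF.comb hF (abs_nonneg c) le_rfl fun π hπ => ?_⟩
    have h0 : ∀ᵐ x ∂m, (c • f) x = c * f x := AEEqFun.coeFn_smul c f
    filter_upwards [hπ.ae_eval h0 1, hπ.ae_eval h0 0] with γ h1 h2
    rw [h1, h2, zero_mul, add_zero, ← mul_sub, abs_mul]

/-- `S² ∩ L^∞(M)` is closed under multiplication. -/
lemma sobolevClass_mul_mem (f g : Lp ℝ ∞ m) (hf : (f : M →ₘ[m] ℝ) ∈ sobolevClass m)
    (hg : (g : M →ₘ[m] ℝ) ∈ sobolevClass m) :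
    ((f • g : Lp ℝ ∞ m) : M →ₘ[m] ℝ) ∈ sobolevClass m := by
  obtain ⟨F, hF⟩ := hf
  obtain ⟨G, hG⟩ := hg
  refine ⟨_, hF.comb hG (norm_nonneg g) (norm_nonneg f) fun π hπ => ?_⟩
  have hbd : ∀ u : Lp ℝ ∞ m, ∀ᵐ x ∂m, |u x| ≤ ‖u‖ := fun u => by
    have := ae_le_eLpNormEssSup (f := u) (μ := m)
    filter_upwards [this] with x hx
    rw [Lp.norm_def, eLpNorm_exponent_top, ← Real.norm_eq_abs, ← toReal_enorm]
    refine ENNReal.toReal_mono ?_ hx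
    rw [← eLpNorm_exponent_top]
    exact Lp.eLpNorm_ne_top u
  have h0 : ∀ᵐ x ∂m, (f • g : Lp ℝ ∞ m) x = f x * g x := Lp.coeFn_lpSMul f g
  filter_upwards [hπ.ae_eval h0 1, hπ.ae_eval h0 0, hπ.ae_eval (hbd f) 0, hπ.ae_eval (hbd g) 1]
    with γ h1 h2 h3 h4
  rw [h1, h2]
  calc |f (γ 1) * g (γ 1) - f (γ 0) * g (γ 0)|
      = |g (γ 1) * (f (γ 1) - f (γ 0)) + f (γ 0) * (g (γ 1) - g (γ 0))| := by ring_nf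
    _ ≤ |g (γ 1)| * |f (γ 1) - f (γ 0)| + |f (γ 0)| * |g (γ 1) - g (γ 0)| := by
        rw [← abs_mul, ← abs_mul]; exact abs_add_le _ _
    _ ≤ _ := by gcongr

lemma exists_isGLB_weakUpperGradient (f : sobolevClass m) :
    ∃ H, IsGLB {G : Lp ℝ 2 m | IsWeakUpperGradient (f : M →ₘ[m] ℝ) G} H :=
  exists_isGLB_of_nonneg f.2 fun _ hG => hG.1

/-- The minimal weak upper gradient `|Df| ∈ L²(m)` of `f ∈ S²(M)`: the `m`-a.e. infimum of the
weak upper gradients of `f`, in the order of `m`-a.e. inequality on `L²(m)`. -/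
def weakGrad (f : sobolevClass m) : Lp ℝ 2 m := (exists_isGLB_weakUpperGradient f).choose

lemma weakGrad_isGLB (f : sobolevClass m) :
    IsGLB {G : Lp ℝ 2 m | IsWeakUpperGradient (f : M →ₘ[m] ℝ) G} (weakGrad f) :=
  (exists_isGLB_weakUpperGradient f).choose_spec

/-- `|Df|` is the minimal weak upper gradient in the usual sense. -/
lemma weakGrad_eq_of_isLeast (f : sobolevClass m) {G : Lp ℝ 2 m}
    (hG : IsLeast {G : Lp ℝ 2 m | IsWeakUpperGradient (f : M →ₘ[m] ℝ) G} G) : weakGrad f = G :=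
  (weakGrad_isGLB f).unique hG.isGLB

lemma weakGrad_nonneg (f : sobolevClass m) : 0 ≤ weakGrad f :=
  (weakGrad_isGLB f).2 fun _ hG => hG.1

lemma weakGrad_add_le (f g : sobolevClass m) : weakGrad (f + g) ≤ weakGrad f + weakGrad g := by
  have key : ∀ F G : Lp ℝ 2 m, IsWeakUpperGradient (f : M →ₘ[m] ℝ) F →
      IsWeakUpperGradient (g : M →ₘ[m] ℝ) G → weakGrad (f + g) ≤ F + G := fun F G hF hG => by
    refine (weakGrad_isGLB (f + g)).1 ?_
    have := hF.comb hG (h := ((f + g : sobolevClass m) : M →ₘ[m] ℝ)) zero_le_one zero_le_one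
      fun π hπ => ?_
    · simpa using this
    · have h0 : ∀ᵐ x ∂m, ((f + g : sobolevClass m) : M →ₘ[m] ℝ) x =
          (f : M →ₘ[m] ℝ) x + (g : M →ₘ[m] ℝ) x := AEEqFun.coeFn_add f.1 g.1
      filter_upwards [hπ.ae_eval h0 1, hπ.ae_eval h0 0] with γ h1 h2
      rw [h1, h2, one_mul, one_mul, add_sub_add_comm]
      exact abs_add_le _ _
  have h1 : ∀ G : Lp ℝ 2 m, IsWeakUpperGradient (g : M →ₘ[m] ℝ) G →
      weakGrad (f + g) - G ≤ weakGrad f := fun G hG =>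
    (weakGrad_isGLB f).2 fun F hF => sub_le_iff_le_add.2 (key F G hF hG)
  have h2 : weakGrad (f + g) - weakGrad f ≤ weakGrad g :=
    (weakGrad_isGLB g).2 fun G hG => sub_le_comm.1 (h1 G hG)
  rwa [sub_le_iff_le_add'] at h2

lemma weakGrad_smul_le (c : ℝ) (f : sobolevClass m) : weakGrad (c • f) ≤ |c| • weakGrad f := by
  have key : ∀ F : Lp ℝ 2 m, IsWeakUpperGradient (f : M →ₘ[m] ℝ) F →
      weakGrad (c • f) ≤ |c| • F := fun F hF => by
    refine (weakGrad_isGLB (c • f)).1 ?_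
    have := hF.comb hF (h := ((c • f : sobolevClass m) : M →ₘ[m] ℝ)) (abs_nonneg c) le_rfl
      fun π hπ => ?_
    · simpa using this
    · have h0 : ∀ᵐ x ∂m, ((c • f : sobolevClass m) : M →ₘ[m] ℝ) x = c * (f : M →ₘ[m] ℝ) x :=
        AEEqFun.coeFn_smul c f.1
      filter_upwards [hπ.ae_eval h0 1, hπ.ae_eval h0 0] with γ h1 h2
      rw [h1, h2, zero_mul, add_zero, ← mul_sub, abs_mul]
  rcases eq_or_ne c 0 with rfl | hc
  · obtain ⟨F, hF⟩ := f.2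
    simpa using key F hF
  · have hc' : 0 < |c| := abs_pos.2 hc
    have : |c|⁻¹ • weakGrad (c • f) ≤ weakGrad f := (weakGrad_isGLB f).2 fun F hF => by
      have := smul_le_smul_Lp (inv_nonneg.2 hc'.le) (key F hF)
      rwa [smul_smul, inv_mul_cancel₀ hc'.ne', one_smul] at this
    have := smul_le_smul_Lp hc'.le this
    rwa [smul_smul, mul_inv_cancel₀ hc'.ne', one_smul] at this

lemma weakGrad_smul (c : ℝ) (f : sobolevClass m) : weakGrad (c • f) = |c| • weakGrad f := by
  refine le_antisymm (weakGrad_smul_le c f) ?_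
  rcases eq_or_ne c 0 with rfl | hc
  · simpa using weakGrad_nonneg _
  · have h := weakGrad_smul_le c⁻¹ (c • f)
    rw [smul_smul, inv_mul_cancel₀ hc, one_smul, abs_inv] at h
    have := smul_le_smul_Lp (abs_nonneg c) h
    rwa [smul_smul, mul_inv_cancel₀ (abs_ne_zero.2 hc), one_smul] at this

lemma weakGrad_zero : weakGrad (0 : sobolevClass m) = 0 := by
  simpa using weakGrad_smul 0 (0 : sobolevClass m)

end Sobolev

/-! ## The Sobolev space `W^{1,2}` -/

section W12

variable {M : Type*} [MetricSpace M] [SecondCountableTopology M] [MeasurableSpace M]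
  [BorelSpace M] (m : Measure M)

/-- `W^{1,2}(M) = L² ∩ S²(M)` as a vector space. -/
def w12Submodule : Submodule ℝ (Lp ℝ 2 m) where
  carrier := {f | (f : M →ₘ[m] ℝ) ∈ sobolevClass m}
  zero_mem' := (sobolevClass m).zero_mem
  add_mem' := fun hf hg => (sobolevClass m).add_mem hf hg
  smul_mem' := fun c _ hf => (sobolevClass m).smul_mem c hf

/-- The Sobolev space `W^{1,2}(M)`; its norm is
`‖f‖²_{W^{1,2}} = ‖f‖²_{L²} + ‖ |Df| ‖²_{L²}`. -/
def W12 : Type _ := ↥(w12Submodule m)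

instance : AddCommGroup (W12 m) := inferInstanceAs (AddCommGroup ↥(w12Submodule m))

instance : Module ℝ (W12 m) := inferInstanceAs (Module ℝ ↥(w12Submodule m))

variable {m}

/-- The inclusion `W^{1,2}(M) → L²(m)`. -/
def W12.toL2 : W12 m →ₗ[ℝ] Lp ℝ 2 m := (w12Submodule m).subtype

/-- The inclusion `W^{1,2}(M) → S²(M)`. -/
def W12.toSobolevClass : W12 m →ₗ[ℝ] sobolevClass m where
  toFun f := ⟨(f.1 : M →ₘ[m] ℝ), f.2⟩
  map_add' _ _ := rfl
  map_smul' _ _ := rfl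

instance : Norm (W12 m) := ⟨fun f => √(‖f.toL2‖ ^ 2 + ‖weakGrad f.toSobolevClass‖ ^ 2)⟩

lemma W12.norm_def (f : W12 m) :
    ‖f‖ = √(‖f.toL2‖ ^ 2 + ‖weakGrad f.toSobolevClass‖ ^ 2) := rfl

lemma norm_weakGrad_add_le (f g : sobolevClass m) :
    ‖weakGrad (f + g)‖ ≤ ‖weakGrad f‖ + ‖weakGrad g‖ := by
  refine le_trans ?_ (norm_add_le _ _)
  refine norm_le_norm_of_abs_le_abs ?_
  rw [abs_of_nonneg (weakGrad_nonneg _),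
    abs_of_nonneg (add_nonneg (weakGrad_nonneg _) (weakGrad_nonneg _))]
  exact weakGrad_add_le f g

lemma norm_weakGrad_smul (c : ℝ) (f : sobolevClass m) :
    ‖weakGrad (c • f)‖ = |c| * ‖weakGrad f‖ := by
  rw [weakGrad_smul, norm_smul, Real.norm_eq_abs, abs_abs]

lemma W12.core : NormedSpace.Core ℝ (W12 m) where
  norm_nonneg f := Real.sqrt_nonneg _
  norm_smul c f := by
    rw [W12.norm_def, W12.norm_def, map_smul, map_smul, norm_weakGrad_smul, norm_smul,
      Real.norm_eq_abs, mul_pow, mul_pow, ← mul_add, Real.sqrt_mul (sq_nonneg _),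
      Real.sqrt_sq (abs_nonneg c)]
  norm_triangle f g := by
    rw [W12.norm_def, W12.norm_def, W12.norm_def, map_add, map_add]
    have h1 := norm_add_le f.toL2 g.toL2
    have h2 := norm_weakGrad_add_le f.toSobolevClass g.toSobolevClass
    have n1 := norm_nonneg (f.toL2 + g.toL2)
    have n2 := norm_nonneg (weakGrad (f.toSobolevClass + g.toSobolevClass))
    set a := ‖f.toL2‖
    set b := ‖g.toL2‖
    set c := ‖weakGrad f.toSobolevClass‖
    set d := ‖weakGrad g.toSobolevClass‖
    have ha : 0 ≤ a := norm_nonneg _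
    have hb : 0 ≤ b := norm_nonneg _
    have hc : 0 ≤ c := norm_nonneg _
    have hd : 0 ≤ d := norm_nonneg _
    refine Real.sqrt_le_iff.2 ⟨by positivity, ?_⟩
    have e1 := Real.sq_sqrt (show 0 ≤ a ^ 2 + c ^ 2 by positivity)
    have e2 := Real.sq_sqrt (show 0 ≤ b ^ 2 + d ^ 2 by positivity)
    have e3 : a * b + c * d ≤ √(a ^ 2 + c ^ 2) * √(b ^ 2 + d ^ 2) := by
      rw [← Real.sqrt_mul (by positivity)]
      refine Real.le_sqrt_of_sq_le ?_
      nlinarith [sq_nonneg (a * d - b * c)]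
    have e4 := pow_le_pow_left₀ n1 h1 2
    have e5 := pow_le_pow_left₀ n2 h2 2
    nlinarith
  norm_eq_zero_iff f := by
    constructor
    · intro h
      rw [W12.norm_def, Real.sqrt_eq_zero (by positivity)] at h
      have h1 : ‖f.toL2‖ ^ 2 = 0 := by
        nlinarith [sq_nonneg ‖f.toL2‖, sq_nonneg ‖weakGrad f.toSobolevClass‖]
      have h2 : f.toL2 = 0 := by simpa using h1
      exact Subtype.ext h2
    · rintro rfl
      rw [W12.norm_def, map_zero, map_zero, weakGrad_zero]
      simp

instance : NormedAddCommGroup (W12 m) := NormedAddCommGroup.ofCore W12.core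

instance : NormedSpace ℝ (W12 m) := NormedSpace.ofCore W12.core

end W12

/-! ## `L^∞(m)`-modules, Hilbert modules and dual modules -/

section Modules

variable {M : Type*} [MeasurableSpace M] (m : Measure M)

/-- The class in `L^∞(m)` of the characteristic function of a measurable set. -/
def chi {A : Set M} (hA : MeasurableSet A) : Lp ℝ ∞ m :=
  MemLp.toLp (A.indicator fun _ => (1 : ℝ))
    (memLp_top_of_bound ((measurable_const.indicator hA).aestronglyMeasurable) 1
      (Eventually.of_forall fun x => by
        by_cases hx : x ∈ A <;> simp [hx]))

lemma coeFn_chi {A : Set M} (hA : MeasurableSet A) :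
    chi m hA =ᵐ[m] A.indicator fun _ => (1 : ℝ) := MemLp.coeFn_toLp _

/-- A normed space with a multiplication by functions in `L^∞(m)`; on Banach spaces this is the
notion of `L^∞(m)`-premodule. The product `f • g` of `f g : Lp ℝ ∞ m` is the pointwise one, and
`chi m MeasurableSet.univ` is the constant function `1`. -/
class LinftyPremodule (V : Type*) [NormedAddCommGroup V] [NormedSpace ℝ V] where
  /-- The bilinear multiplication `L^∞(m) × V → V`. -/
  mul : Lp ℝ ∞ m →ₗ[ℝ] V →ₗ[ℝ] V
  mul_mul : ∀ (f g : Lp ℝ ∞ m) (v : V), mul (f • g : Lp ℝ ∞ m) v = mul f (mul g v)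
  one_mul : ∀ v : V, mul (chi m MeasurableSet.univ) v = v
  norm_mul_le : ∀ (f : Lp ℝ ∞ m) (v : V), ‖mul f v‖ ≤ ‖f‖ * ‖v‖

/-- `L^∞(m)`-modules: Banach spaces with a multiplication by `L^∞(m)`-functions that have the
locality and the gluing property. -/
structure IsLinftyModule (V : Type*) [NormedAddCommGroup V] [NormedSpace ℝ V]
    [LinftyPremodule m V] : Prop where
  complete : CompleteSpace V
  locality : ∀ (v : V) (A : ℕ → Set M) (hA : ∀ n, MeasurableSet (A n)),
    (∀ n, LinftyPremodule.mul (chi m (hA n)) v = 0) →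
      LinftyPremodule.mul (chi m (MeasurableSet.iUnion hA)) v = 0
  gluing : ∀ (v : ℕ → V) (A : ℕ → Set M) (hA : ∀ n, MeasurableSet (A n)),
    (∀ i j, LinftyPremodule.mul (chi m ((hA i).inter (hA j))) (v i) =
      LinftyPremodule.mul (chi m ((hA i).inter (hA j))) (v j)) →
    BddAbove (Set.range fun n : ℕ =>
      ‖∑ i ∈ Finset.range n, LinftyPremodule.mul (chi m (hA i)) (v i)‖) →
    ∃ w : V, (∀ i, LinftyPremodule.mul (chi m (hA i)) w = LinftyPremodule.mul (chi m (hA i)) (v i)) ∧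
      ‖w‖ ≤ liminf (fun n : ℕ =>
        ‖∑ i ∈ Finset.range n, LinftyPremodule.mul (chi m (hA i)) (v i)‖) atTop

/-- A normed space is a Hilbert space if it is complete and its norm comes from a scalar
product. -/
def IsHilbertSpace (V : Type*) [NormedAddCommGroup V] [inst : NormedSpace ℝ V] : Prop :=
  CompleteSpace V ∧ ∃ i : InnerProductSpace ℝ V, i.toNormedSpace = inst

/-- Hilbert modules: `L^∞(m)`-modules that are Hilbert spaces. -/
def IsHilbertModule (V : Type*) [NormedAddCommGroup V] [NormedSpace ℝ V]
    [LinftyPremodule m V] : Prop :=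
  IsLinftyModule m V ∧ IsHilbertSpace V

/-- The bounded linear maps `T : V → L¹(m)` such that `T(f v) = f T(v)` for all `f ∈ L^∞(m)`. -/
def dualSubmodule (V : Type*) [NormedAddCommGroup V] [NormedSpace ℝ V] [LinftyPremodule m V] :
    Submodule ℝ (V →L[ℝ] Lp ℝ 1 m) where
  carrier := {T | ∀ (f : Lp ℝ ∞ m) (v : V),
    T (LinftyPremodule.mul f v) = (f • T v : Lp ℝ 1 m)}
  zero_mem' := fun f v => by
    rw [zero_apply, zero_apply]
    exact (Lp.smul_zero ℝ 1 f).symm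
  add_mem' := fun {S T} hS hT f v => by
    rw [add_apply, hS, hT, add_apply]
    exact (Lp.add_smul f (S v) (T v)).symm
  smul_mem' := fun c T hT f v => by
    rw [smul_apply, hT, smul_apply]
    exact Lp.smul_comm c f (T v)

/-- The dual module `V* = Hom(V, L¹(m))`, with the operator norm. -/
def DualModule (V : Type*) [NormedAddCommGroup V] [NormedSpace ℝ V] [LinftyPremodule m V] :
    Type _ := ↥(dualSubmodule m V)

instance (V : Type*) [NormedAddCommGroup V] [NormedSpace ℝ V] [LinftyPremodule m V] :
    NormedAddCommGroup (DualModule m V) :=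
  inferInstanceAs (NormedAddCommGroup ↥(dualSubmodule m V))

instance (V : Type*) [NormedAddCommGroup V] [NormedSpace ℝ V] [LinftyPremodule m V] :
    NormedSpace ℝ (DualModule m V) :=
  inferInstanceAs (NormedSpace ℝ ↥(dualSubmodule m V))

instance (V : Type*) [NormedAddCommGroup V] [NormedSpace ℝ V] [LinftyPremodule m V] :
    CoeFun (DualModule m V) (fun _ => V → Lp ℝ 1 m) := ⟨fun T => T.1⟩

variable {m}

/-- Multiplication by `f ∈ L^∞(m)` on `L¹(m)`, as a bounded operator. -/
def mulL1 (f : Lp ℝ ∞ m) : Lp ℝ 1 m →L[ℝ] Lp ℝ 1 m :=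
  LinearMap.mkContinuous
    { toFun := fun u => (f • u : Lp ℝ 1 m)
      map_add' := fun u v => Lp.add_smul f u v
      map_smul' := fun c u => (Lp.smul_comm c f u).symm } ‖f‖ fun u => Lp.norm_smul_le f u

lemma mulL1_apply (f : Lp ℝ ∞ m) (u : Lp ℝ 1 m) : mulL1 f u = (f • u : Lp ℝ 1 m) := rfl

lemma smul_smul_L1 (f g : Lp ℝ ∞ m) (u : Lp ℝ 1 m) :
    ((f • g : Lp ℝ ∞ m) • u : Lp ℝ 1 m) = (f • (g • u : Lp ℝ 1 m) : Lp ℝ 1 m) := by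
  refine Lp.ext ?_
  filter_upwards [Lp.coeFn_lpSMul (r := 1) (f • g : Lp ℝ ∞ m) u,
    Lp.coeFn_lpSMul (r := 1) f (g • u : Lp ℝ 1 m), Lp.coeFn_lpSMul (r := 1) g u,
    Lp.coeFn_lpSMul (r := ∞) f g] with x h1 h2 h3 h4
  simp only [Pi.smul_apply', smul_eq_mul] at h1 h2 h3 h4
  rw [h1, h2, h3, h4, mul_assoc]

lemma smul_comm_L1 (f g : Lp ℝ ∞ m) (u : Lp ℝ 1 m) :
    (f • (g • u : Lp ℝ 1 m) : Lp ℝ 1 m) = (g • (f • u : Lp ℝ 1 m) : Lp ℝ 1 m) := by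
  refine Lp.ext ?_
  filter_upwards [Lp.coeFn_lpSMul (r := 1) f (g • u : Lp ℝ 1 m), Lp.coeFn_lpSMul (r := 1) g u,
    Lp.coeFn_lpSMul (r := 1) g (f • u : Lp ℝ 1 m), Lp.coeFn_lpSMul (r := 1) f u]
    with x h1 h2 h3 h4
  simp only [Pi.smul_apply', smul_eq_mul] at h1 h2 h3 h4
  rw [h1, h2, h3, h4, mul_left_comm]

lemma chi_univ_smul_L1 (u : Lp ℝ 1 m) :
    ((chi m MeasurableSet.univ : Lp ℝ ∞ m) • u : Lp ℝ 1 m) = u := by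
  refine Lp.ext ?_
  filter_upwards [Lp.coeFn_lpSMul (r := 1) (chi m MeasurableSet.univ) u,
    coeFn_chi m MeasurableSet.univ] with x h1 h2
  simp only [Pi.smul_apply', smul_eq_mul] at h1
  rw [h1, h2]
  simp

/-- The dual of an `L^∞(m)`-module carries the multiplication `(f T)(v) = f T(v)`. -/
instance dualModulePremodule (V : Type*) [NormedAddCommGroup V] [NormedSpace ℝ V]
    [LinftyPremodule m V] : LinftyPremodule m (DualModule m V) where
  mul := LinearMap.mk₂ ℝ
    (fun f T => (⟨(mulL1 f).comp T.1, fun g v => by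
      rw [ContinuousLinearMap.comp_apply, T.2 g v, mulL1_apply, ContinuousLinearMap.comp_apply,
        mulL1_apply, smul_comm_L1]⟩ : ↥(dualSubmodule m V)))
    (fun f g T => Subtype.ext <| ContinuousLinearMap.ext fun v => Lp.smul_add f g (T.1 v))
    (fun c f T => Subtype.ext <| ContinuousLinearMap.ext fun v => Lp.smul_assoc c f (T.1 v))
    (fun f S T => Subtype.ext <| ContinuousLinearMap.ext fun v => map_add (mulL1 f) (S.1 v) (T.1 v))
    (fun c f T => Subtype.ext <| ContinuousLinearMap.ext fun v => map_smul (mulL1 f) c (T.1 v))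
  mul_mul f g T := Subtype.ext <| ContinuousLinearMap.ext fun v => smul_smul_L1 f g (T.1 v)
  one_mul T := Subtype.ext <| ContinuousLinearMap.ext fun v => chi_univ_smul_L1 (T.1 v)
  norm_mul_le f T := by
    refine ContinuousLinearMap.opNorm_le_bound _ (by positivity) fun v => ?_
    refine (Lp.norm_smul_le f (T.1 v)).trans ?_
    rw [mul_assoc]
    exact mul_le_mul_of_nonneg_left (T.1.le_opNorm v) (norm_nonneg f)

lemma DualModule.mul_apply {V : Type*} [NormedAddCommGroup V] [NormedSpace ℝ V]
    [LinftyPremodule m V] (f : Lp ℝ ∞ m) (T : DualModule m V) (v : V) :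
    LinftyPremodule.mul f T v = (f • T v : Lp ℝ 1 m) := rfl

end Modules

/-! ## The cotangent module -/

section Countable

variable {M S T U : Type*} [MeasurableSpace M]

/-- `φ : M → S` takes countably many values, each of them on a measurable set. Such a map encodes
a countable measurable partition `(A_i)` of `M` with elements `s_i : S` attached to its pieces:
`φ = s_i` on `A_i`. -/
structure IsCountablyValued (φ : M → S) : Prop where
  countable_range : (Set.range φ).Countable
  measurableSet_fiber : ∀ s : S, MeasurableSet (φ ⁻¹' {s})

lemma IsCountablyValued.const (s : S) : IsCountablyValued (fun _ : M => s) where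
  countable_range := (Set.countable_singleton s).mono (by rintro _ ⟨x, rfl⟩; rfl)
  measurableSet_fiber := fun t => by
    by_cases h : s = t
    · have : (fun _ : M => s) ⁻¹' {t} = Set.univ := by ext; simp [h]
      rw [this]; exact MeasurableSet.univ
    · have : (fun _ : M => s) ⁻¹' {t} = ∅ := by ext; simp [h]
      rw [this]; exact MeasurableSet.empty

lemma IsCountablyValued.comp₂ {φ : M → S} {ψ : M → T} (hφ : IsCountablyValued φ)
    (hψ : IsCountablyValued ψ) (op : S → T → U) :
    IsCountablyValued fun x => op (φ x) (ψ x) where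
  countable_range := by
    refine ((hφ.countable_range.prod hψ.countable_range).image fun p => op p.1 p.2).mono ?_
    rintro _ ⟨x, rfl⟩
    exact ⟨(φ x, ψ x), ⟨⟨x, rfl⟩, ⟨x, rfl⟩⟩, rfl⟩
  measurableSet_fiber := fun u => by
    have : (fun x => op (φ x) (ψ x)) ⁻¹' {u} =
        ⋃ p ∈ (Set.range φ ×ˢ Set.range ψ) ∩ {p | op p.1 p.2 = u},
          (φ ⁻¹' {p.1} ∩ ψ ⁻¹' {p.2}) := by
      ext x
      simp only [Set.mem_preimage, Set.mem_singleton_iff, Set.mem_iUnion, Set.mem_inter_iff,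
        Set.mem_prod, Set.mem_ofPred_eq, exists_prop, Prod.exists]
      constructor
      · intro h
        exact ⟨φ x, ψ x, ⟨⟨⟨x, rfl⟩, ⟨x, rfl⟩⟩, h⟩, rfl, rfl⟩
      · rintro ⟨a, b, ⟨-, h⟩, rfl, rfl⟩
        exact h
    rw [this]
    refine MeasurableSet.biUnion
      ((hφ.countable_range.prod hψ.countable_range).mono Set.inter_subset_left) fun p _ => ?_
    exact (hφ.measurableSet_fiber _).inter (hψ.measurableSet_fiber _)

lemma IsCountablyValued.measurable_diag {φ : M → S} (hφ : IsCountablyValued φ) {F : S → M → ℝ}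
    (hF : ∀ s, Measurable (F s)) : Measurable fun x => F (φ x) x := by
  intro B hB
  have : (fun x => F (φ x) x) ⁻¹' B = ⋃ s ∈ Set.range φ, (φ ⁻¹' {s} ∩ F s ⁻¹' B) := by
    ext x
    simp only [Set.mem_preimage, Set.mem_iUnion, Set.mem_inter_iff, Set.mem_singleton_iff,
      exists_prop]
    constructor
    · intro h
      exact ⟨φ x, ⟨x, rfl⟩, rfl, h⟩
    · rintro ⟨s, -, rfl, h⟩
      exact h
  rw [this]
  exact MeasurableSet.biUnion hφ.countable_range fun s _ =>
    (hφ.measurableSet_fiber s).inter (hF s hB)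

lemma IsCountablyValued.ae_of_forall {m : Measure M} {φ : M → S} (hφ : IsCountablyValued φ)
    {p : S → M → Prop} (hp : ∀ s, ∀ᵐ x ∂m, p s x) : ∀ᵐ x ∂m, p (φ x) x := by
  have : ∀ᵐ x ∂m, ∀ s ∈ Set.range φ, p s x :=
    (ae_ball_iff hφ.countable_range).2 fun s _ => hp s
  filter_upwards [this] with x hx
  exact hx _ ⟨x, rfl⟩

end Countable

section Cotangent

variable {M : Type*} [MetricSpace M] [SecondCountableTopology M] [MeasurableSpace M]
  [BorelSpace M] (m : Measure M)

lemma measurable_weakGrad_diag {m : Measure M} {φ : M → sobolevClass m}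
    (hφ : IsCountablyValued φ) : Measurable fun x => weakGrad (φ x) x :=
  hφ.measurable_diag fun f => (Lp.stronglyMeasurable (weakGrad f)).measurable

lemma ae_weakGrad_add_le {m : Measure M} {φ ψ : M → sobolevClass m}
    (hφ : IsCountablyValued φ) (hψ : IsCountablyValued ψ) :
    ∀ᵐ x ∂m, weakGrad (φ x + ψ x) x ≤ weakGrad (φ x) x + weakGrad (ψ x) x := by
  refine (hφ.comp₂ hψ Prod.mk).ae_of_forall
    (p := fun s x => weakGrad (s.1 + s.2) x ≤ weakGrad s.1 x + weakGrad s.2 x) fun s => ?_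
  filter_upwards [(Lp.coeFn_le _ _).2 (weakGrad_add_le s.1 s.2),
    Lp.coeFn_add (weakGrad s.1) (weakGrad s.2)] with x h1 h2
  rwa [h2] at h1

lemma ae_weakGrad_smul {m : Measure M} {a : M → ℝ} {φ : M → sobolevClass m}
    (ha : IsCountablyValued a) (hφ : IsCountablyValued φ) :
    ∀ᵐ x ∂m, weakGrad (a x • φ x) x = |a x| * weakGrad (φ x) x := by
  refine (ha.comp₂ hφ Prod.mk).ae_of_forall
    (p := fun s x => weakGrad (s.1 • s.2) x = |s.1| * weakGrad s.2 x) fun s => ?_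
  filter_upwards [Lp.coeFn_smul |s.1| (weakGrad s.2)] with x h1
  rw [weakGrad_smul, h1]
  rfl

lemma ae_weakGrad_nonneg {m : Measure M} {φ : M → sobolevClass m} (hφ : IsCountablyValued φ) :
    ∀ᵐ x ∂m, 0 ≤ weakGrad (φ x) x :=
  hφ.ae_of_forall (p := fun s x => 0 ≤ weakGrad s x) fun s =>
    (Lp.coeFn_nonneg _).2 (weakGrad_nonneg s)

/-- The pre-cotangent module: countable measurable partitions `(A_i)` of `M` together with
functions `f_i ∈ S²(M)` such that `∑_i ∫_{A_i} |Df_i|² dm < ∞`. The family is encoded by the map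
`φ : M → S²(M)` with `φ = f_i` on `A_i`; sums and multiples are then taken pointwise, that is,
with respect to the common refinement of the partitions. -/
def preCotangentSubmodule : Submodule ℝ (M → sobolevClass m) where
  carrier := {φ | IsCountablyValued φ ∧ MemLp (fun x => weakGrad (φ x) x) 2 m}
  zero_mem' := by
    refine ⟨IsCountablyValued.const 0, ?_⟩
    have : MemLp (weakGrad (0 : sobolevClass m)) 2 m := Lp.memLp _
    exact this
  add_mem' := by
    rintro φ ψ ⟨hφ, hφ2⟩ ⟨hψ, hψ2⟩
    have h := hφ.comp₂ hψ (· + ·)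
    refine ⟨h, (hφ2.add hψ2).mono (measurable_weakGrad_diag h).aestronglyMeasurable ?_⟩
    filter_upwards [ae_weakGrad_add_le hφ hψ, ae_weakGrad_nonneg h] with x h1 h2
    rw [Real.norm_eq_abs, Real.norm_eq_abs]
    exact abs_le_abs_of_nonneg h2 h1
  smul_mem' := by
    rintro c φ ⟨hφ, hφ2⟩
    have h := (IsCountablyValued.const (M := M) c).comp₂ hφ (· • ·)
    refine ⟨h, (hφ2.const_smul c).mono (measurable_weakGrad_diag h).aestronglyMeasurable ?_⟩
    filter_upwards [ae_weakGrad_smul (IsCountablyValued.const c) hφ] with x h1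
    change ‖weakGrad (c • φ x) x‖ ≤ ‖c * weakGrad (φ x) x‖
    rw [h1, norm_mul, norm_mul, Real.norm_eq_abs, Real.norm_eq_abs, Real.norm_eq_abs, abs_abs]

/-- The pre-cotangent module, with the seminorm `‖φ‖² = ∑_i ∫_{A_i} |Df_i|² dm`. Two elements are
at distance zero iff they are equivalent: `|D(f_i - g_j)| = 0` a.e. on `A_i ∩ B_j` for all `i, j`. -/
def PreCotangent : Type _ := ↥(preCotangentSubmodule m)

instance : AddCommGroup (PreCotangent m) :=
  inferInstanceAs (AddCommGroup ↥(preCotangentSubmodule m))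

instance : Module ℝ (PreCotangent m) := inferInstanceAs (Module ℝ ↥(preCotangentSubmodule m))

variable {m}

/-- The pointwise norm on the pre-cotangent module, equal to `|Df_i|` on `A_i`. -/
def PreCotangent.ptNorm (φ : PreCotangent m) : Lp ℝ 2 m := φ.2.2.toLp

lemma PreCotangent.coeFn_ptNorm (φ : PreCotangent m) :
    φ.ptNorm =ᵐ[m] fun x => weakGrad (φ.1 x) x := MemLp.coeFn_toLp _

lemma PreCotangent.ptNorm_nonneg (φ : PreCotangent m) : 0 ≤ φ.ptNorm := by
  rw [← Lp.coeFn_nonneg]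
  filter_upwards [φ.coeFn_ptNorm, ae_weakGrad_nonneg φ.2.1] with x h1 h2
  rw [h1]; exact h2

lemma PreCotangent.ptNorm_add_le (φ ψ : PreCotangent m) :
    (φ + ψ).ptNorm ≤ φ.ptNorm + ψ.ptNorm := by
  rw [← Lp.coeFn_le]
  filter_upwards [φ.coeFn_ptNorm, ψ.coeFn_ptNorm, (φ + ψ).coeFn_ptNorm,
    ae_weakGrad_add_le φ.2.1 ψ.2.1, Lp.coeFn_add φ.ptNorm ψ.ptNorm] with x h1 h2 h3 h4 h5
  rw [h5, Pi.add_apply, h1, h2, h3]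
  exact h4

lemma PreCotangent.ptNorm_smul (c : ℝ) (φ : PreCotangent m) :
    (c • φ).ptNorm = |c| • φ.ptNorm := by
  refine Lp.ext ?_
  filter_upwards [φ.coeFn_ptNorm, (c • φ).coeFn_ptNorm,
    ae_weakGrad_smul (IsCountablyValued.const c) φ.2.1, Lp.coeFn_smul |c| φ.ptNorm]
    with x h1 h2 h3 h4
  rw [h4, Pi.smul_apply, h1, h2]
  exact h3

instance : Norm (PreCotangent m) := ⟨fun φ => ‖φ.ptNorm‖⟩

lemma PreCotangent.norm_def (φ : PreCotangent m) : ‖φ‖ = ‖φ.ptNorm‖ := rfl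

lemma PreCotangent.core : SeminormedSpace.Core ℝ (PreCotangent m) where
  norm_nonneg φ := norm_nonneg φ.ptNorm
  norm_smul c φ := by
    rw [PreCotangent.norm_def, PreCotangent.ptNorm_smul, norm_smul, norm_abs_eq_norm]
    rfl
  norm_triangle φ ψ := by
    have h : ‖(φ + ψ).ptNorm‖ ≤ ‖φ.ptNorm + ψ.ptNorm‖ := by
      refine norm_le_norm_of_abs_le_abs ?_
      rw [abs_of_nonneg (φ + ψ).ptNorm_nonneg,
        abs_of_nonneg (add_nonneg φ.ptNorm_nonneg ψ.ptNorm_nonneg)]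
      exact PreCotangent.ptNorm_add_le φ ψ
    exact h.trans (norm_add_le φ.ptNorm ψ.ptNorm)

instance : SeminormedAddCommGroup (PreCotangent m) :=
  SeminormedAddCommGroup.ofCore PreCotangent.core

instance : NormedSpace ℝ (PreCotangent m) where
  norm_smul_le c φ := (PreCotangent.core.norm_smul c φ).le

variable (m) in
/-- The cotangent module `L²(T*M)`: the completion of the pre-cotangent module (elements at
distance zero are identified). -/
abbrev Cotangent : Type _ := UniformSpace.Completion (PreCotangent m)

/-- The trivial partition `{M}` with the function `f ∈ S²(M)`. -/
def PreCotangent.ofSobolev (f : sobolevClass m) : PreCotangent m :=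
  ⟨fun _ => f, IsCountablyValued.const f, Lp.memLp (weakGrad f)⟩

/-- The differential `df ∈ L²(T*M)` of `f ∈ S²(M)`: the class of the trivial partition `{M}`
with the function `f`. -/
def differential (f : sobolevClass m) : Cotangent m :=
  (PreCotangent.ofSobolev f : UniformSpace.Completion (PreCotangent m))

lemma PreCotangent.lipschitz_ptNorm :
    LipschitzWith 1 (PreCotangent.ptNorm : PreCotangent m → Lp ℝ 2 m) := by
  refine LipschitzWith.of_dist_le_mul fun φ ψ => ?_
  rw [NNReal.coe_one, one_mul, dist_eq_norm, dist_eq_norm, PreCotangent.norm_def]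
  refine norm_le_norm_of_abs_le_abs ?_
  rw [abs_of_nonneg (φ - ψ).ptNorm_nonneg, abs_le']
  have h1 := PreCotangent.ptNorm_add_le (φ - ψ) ψ
  have h2 := PreCotangent.ptNorm_add_le ((-1 : ℝ) • (φ - ψ)) φ
  rw [PreCotangent.ptNorm_smul, abs_neg, abs_one, one_smul] at h2
  rw [sub_add_cancel] at h1
  rw [neg_smul, one_smul, neg_sub, sub_add_cancel] at h2
  exact ⟨sub_le_iff_le_add.2 h1, by rw [neg_sub]; exact sub_le_iff_le_add.2 h2⟩

/-- The pointwise norm `|ω|_* ∈ L²(m)` of `ω ∈ L²(T*M)`: the continuous extension of the pointwise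
norm of the pre-cotangent module. -/
def cotangentNorm : Cotangent m → Lp ℝ 2 m :=
  UniformSpace.Completion.extension PreCotangent.ptNorm

lemma cotangentNorm_coe (φ : PreCotangent m) : cotangentNorm (φ : Cotangent m) = φ.ptNorm :=
  UniformSpace.Completion.extension_coe PreCotangent.lipschitz_ptNorm.uniformContinuous φ

lemma cotangentNorm_differential (f : sobolevClass m) :
    cotangentNorm (differential f) = weakGrad f := by
  rw [differential, cotangentNorm_coe]
  exact Lp.ext (PreCotangent.coeFn_ptNorm _)

lemma norm_cotangentNorm (ω : Cotangent m) : ‖cotangentNorm ω‖ = ‖ω‖ := by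
  refine UniformSpace.Completion.induction_on ω ?_ fun φ => ?_
  · exact isClosed_eq (UniformSpace.Completion.continuous_extension.norm) continuous_norm
  · rw [cotangentNorm_coe, UniformSpace.Completion.norm_coe, PreCotangent.norm_def]

/-! ### Multiplication of 1-forms by functions in `L^∞(m)` -/

variable (m) in
/-- The measurable, countably valued, essentially bounded functions. -/
structure IsAdmissible (a : M → ℝ) : Prop where
  countablyValued : IsCountablyValued a
  bounded : ∃ C, 0 ≤ C ∧ ∀ᵐ x ∂m, |a x| ≤ C

/-- The product of a 1-form in the pre-cotangent module with an admissible function: on the common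
refinement of the two partitions, the functions `f_i` are multiplied by the values of `a`. -/
def PreCotangent.mul {a : M → ℝ} (ha : IsAdmissible m a) (φ : PreCotangent m) : PreCotangent m :=
  ⟨fun x => a x • φ.1 x, ha.countablyValued.comp₂ φ.2.1 (· • ·), by
    obtain ⟨C, hC, hb⟩ := ha.bounded
    have h := ha.countablyValued.comp₂ φ.2.1 (· • ·)
    refine (φ.2.2.const_smul C).mono (measurable_weakGrad_diag h).aestronglyMeasurable ?_
    filter_upwards [ae_weakGrad_smul ha.countablyValued φ.2.1, hb] with x h1 h2
    rw [h1, norm_mul, Pi.smul_apply, norm_smul, Real.norm_eq_abs, abs_abs, Real.norm_eq_abs,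
      Real.norm_eq_abs, abs_of_nonneg hC]
    gcongr⟩

lemma PreCotangent.norm_mul_sub_le {a b : M → ℝ} (ha : IsAdmissible m a) (hb : IsAdmissible m b)
    {C : ℝ} (hab : ∀ᵐ x ∂m, |a x - b x| ≤ C) (φ : PreCotangent m) :
    ‖φ.mul ha - φ.mul hb‖ ≤ C * ‖φ‖ := by
  by_cases hC : 0 ≤ C
  · have hsub := ha.countablyValued.comp₂ hb.countablyValued (fun s t => s - t)
    have key : (φ.mul ha - φ.mul hb).ptNorm ≤ C • φ.ptNorm := by
      rw [← Lp.coeFn_le]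
      filter_upwards [(φ.mul ha - φ.mul hb).coeFn_ptNorm, φ.coeFn_ptNorm,
        ae_weakGrad_smul hsub φ.2.1, hab, Lp.coeFn_smul C φ.ptNorm,
        ae_weakGrad_nonneg φ.2.1] with x h1 h2 h3 h4 h5 h6
      rw [h1, h5, Pi.smul_apply, h2, smul_eq_mul]
      have : (φ.mul ha - φ.mul hb).1 x = (a x - b x) • φ.1 x := (sub_smul _ _ _).symm
      rw [this, h3]
      exact mul_le_mul_of_nonneg_right h4 h6
    have hn : ‖(φ.mul ha - φ.mul hb).ptNorm‖ ≤ ‖C • φ.ptNorm‖ := by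
      refine norm_le_norm_of_abs_le_abs ?_
      rw [abs_of_nonneg (PreCotangent.ptNorm_nonneg _)]
      exact key.trans (le_abs_self _)
    rwa [norm_smul, Real.norm_eq_abs, abs_of_nonneg hC] at hn
  · have hm : ae m = ⊥ := by
      by_contra hne
      have : NeBot (ae m) := ⟨hne⟩
      obtain ⟨x, hx⟩ := hab.exists
      exact hC ((abs_nonneg _).trans hx)
    have hz : ∀ ψ : PreCotangent m, ‖ψ‖ = 0 := fun ψ => by
      rw [PreCotangent.norm_def, norm_eq_zero]
      refine Lp.ext ?_
      rw [EventuallyEq, hm]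
      exact eventually_bot
    rw [hz, hz, mul_zero]

lemma IsAdmissible.zero : IsAdmissible m (fun _ => 0) :=
  ⟨IsCountablyValued.const 0, 0, le_rfl, by simp⟩

lemma PreCotangent.norm_mul_le {a : M → ℝ} (ha : IsAdmissible m a) {C : ℝ}
    (hab : ∀ᵐ x ∂m, |a x| ≤ C) (φ : PreCotangent m) : ‖φ.mul ha‖ ≤ C * ‖φ‖ := by
  have h := φ.norm_mul_sub_le ha (IsAdmissible.zero (m := m)) (C := C) (by simpa using hab)
  have h0 : φ.mul (IsAdmissible.zero (m := m)) = 0 := Subtype.ext (funext fun x => zero_smul _ _)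
  rwa [h0, sub_zero] at h

lemma Linfty.ae_abs_le (h : Lp ℝ ∞ m) : ∀ᵐ x ∂m, |h x| ≤ ‖h‖ := by
  filter_upwards [ae_le_eLpNormEssSup (f := h) (μ := m)] with x hx
  rw [Lp.norm_def, eLpNorm_exponent_top, ← Real.norm_eq_abs, ← toReal_enorm]
  refine ENNReal.toReal_mono ?_ hx
  rw [← eLpNorm_exponent_top]
  exact Lp.eLpNorm_ne_top h

/-- Countably valued approximations of a function in `L^∞(m)`. -/
def approx (h : Lp ℝ ∞ m) (n : ℕ) (x : M) : ℝ := (⌊h x * (n + 1)⌋ : ℝ) / (n + 1)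

lemma abs_sub_approx_le (h : Lp ℝ ∞ m) (n : ℕ) (x : M) :
    |h x - approx h n x| ≤ 1 / (n + 1) := by
  have hn : (0 : ℝ) < n + 1 := by positivity
  have e : h x - approx h n x = Int.fract (h x * (n + 1)) / (n + 1) := by
    rw [approx, Int.fract]
    field_simp
  rw [e, abs_div, abs_of_pos hn, abs_of_nonneg (Int.fract_nonneg _)]
  gcongr
  exact (Int.fract_lt_one _).le

lemma isAdmissible_approx (h : Lp ℝ ∞ m) (n : ℕ) : IsAdmissible m (approx h n) where
  countablyValued :=
    { countable_range := by
        refine (Set.countable_range fun k : ℤ => (k : ℝ) / (n + 1)).mono ?_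
        rintro _ ⟨x, rfl⟩
        exact ⟨⌊h x * (n + 1)⌋, rfl⟩
      measurableSet_fiber := fun s => by
        have h1 : Measurable h := (Lp.stronglyMeasurable h).measurable
        have h2 : Measurable fun x => ((⌊h x * (n + 1)⌋ : ℤ) : ℝ) / (n + 1) :=
          ((measurable_from_top (f := fun k : ℤ => (k : ℝ))).comp
            (Int.measurable_floor.comp (h1.mul_const _))).div_const _
        exact h2 (measurableSet_singleton s) }
  bounded := by
    refine ⟨‖h‖ + 1 / (n + 1), by positivity, ?_⟩
    filter_upwards [Linfty.ae_abs_le h] with x hx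
    have := abs_sub_approx_le h n x
    rw [abs_sub_comm] at this
    calc |approx h n x| = |h x + (approx h n x - h x)| := by ring_nf
      _ ≤ |h x| + |approx h n x - h x| := abs_add_le _ _
      _ ≤ _ := by gcongr

/-- The sequence of approximate products `h_n φ`. -/
def mulSeq (h : Lp ℝ ∞ m) (φ : PreCotangent m) (n : ℕ) : Cotangent m :=
  (φ.mul (isAdmissible_approx h n) : Cotangent m)

lemma mulSeq_dist {a : M → ℝ} (ha : IsAdmissible m a) (h : Lp ℝ ∞ m) {C : ℝ}
    (hC : ∀ᵐ x ∂m, |h x - a x| ≤ C) (φ : PreCotangent m) (n : ℕ) :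
    ‖mulSeq h φ n - (φ.mul ha : Cotangent m)‖ ≤ (C + 1 / (n + 1)) * ‖φ‖ := by
  rw [mulSeq, ← UniformSpace.Completion.coe_sub, UniformSpace.Completion.norm_coe]
  refine PreCotangent.norm_mul_sub_le _ _ ?_ φ
  filter_upwards [hC] with x hx
  have := abs_sub_approx_le h n x
  rw [abs_sub_comm] at this
  calc |approx h n x - a x| = |(h x - a x) + (approx h n x - h x)| := by ring_nf
    _ ≤ _ := (abs_add_le _ _).trans (add_le_add hx this)

lemma exists_mulSeq_tendsto (h : Lp ℝ ∞ m) (φ : PreCotangent m) :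
    ∃ ω, Tendsto (mulSeq h φ) atTop (𝓝 ω) := by
  refine cauchySeq_tendsto_of_complete
    (cauchySeq_of_le_tendsto_0' (fun n : ℕ => 2 * (1 / ((n : ℝ) + 1)) * ‖φ‖)
      (fun n k hnk => ?_) ?_)
  · rw [dist_comm, dist_eq_norm]
    refine (mulSeq_dist (isAdmissible_approx h n) h
      (Eventually.of_forall (abs_sub_approx_le h n)) φ k).trans ?_
    rw [two_mul]
    gcongr
  · have := (tendsto_one_div_add_atTop_nhds_zero_nat (𝕜 := ℝ)).const_mul 2 |>.mul_const ‖φ‖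
    simpa using this

/-- The product `h φ ∈ L²(T*M)` of `h ∈ L^∞(m)` with an element `φ` of the pre-cotangent module:
the limit of the products `h_n φ` for countably valued `h_n` converging uniformly to `h`. -/
def preMul (h : Lp ℝ ∞ m) (φ : PreCotangent m) : Cotangent m :=
  (exists_mulSeq_tendsto h φ).choose

lemma tendsto_preMul (h : Lp ℝ ∞ m) (φ : PreCotangent m) :
    Tendsto (mulSeq h φ) atTop (𝓝 (preMul h φ)) := (exists_mulSeq_tendsto h φ).choose_spec

lemma norm_preMul_sub_le {a : M → ℝ} (ha : IsAdmissible m a) (h : Lp ℝ ∞ m) {C : ℝ}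
    (hC : ∀ᵐ x ∂m, |h x - a x| ≤ C) (φ : PreCotangent m) :
    ‖preMul h φ - (φ.mul ha : Cotangent m)‖ ≤ C * ‖φ‖ := by
  have h1 : Tendsto (fun n => ‖mulSeq h φ n - (φ.mul ha : Cotangent m)‖) atTop
      (𝓝 ‖preMul h φ - (φ.mul ha : Cotangent m)‖) := ((tendsto_preMul h φ).sub_const _).norm
  have h2 : Tendsto (fun n : ℕ => (C + 1 / ((n : ℝ) + 1)) * ‖φ‖) atTop (𝓝 ((C + 0) * ‖φ‖)) :=
    (tendsto_const_nhds.add tendsto_one_div_add_atTop_nhds_zero_nat).mul_const _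
  rw [add_zero] at h2
  exact le_of_tendsto_of_tendsto' h1 h2 (mulSeq_dist ha h hC φ)

/-- `preMul h φ` is characterized by approximation. -/
lemma eq_preMul {h : Lp ℝ ∞ m} {φ : PreCotangent m} {ω : Cotangent m} (K : ℝ)
    (hω : ∀ n : ℕ, ∃ (a : M → ℝ) (ha : IsAdmissible m a),
      (∀ᵐ x ∂m, |h x - a x| ≤ K * (1 / ((n : ℝ) + 1))) ∧
      ‖ω - (φ.mul ha : Cotangent m)‖ ≤ K * (1 / ((n : ℝ) + 1))) : ω = preMul h φ := by
  have hle : ∀ n : ℕ, ‖ω - preMul h φ‖ ≤ (K * (1 / ((n : ℝ) + 1))) * (1 + ‖φ‖) := fun n => by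
    obtain ⟨a, ha, h1, h2⟩ := hω n
    have h3 := norm_preMul_sub_le ha h h1 φ
    rw [norm_sub_rev] at h3
    calc ‖ω - preMul h φ‖ = ‖(ω - (φ.mul ha : Cotangent m)) +
          ((φ.mul ha : Cotangent m) - preMul h φ)‖ := by rw [sub_add_sub_cancel]
      _ ≤ _ := norm_add_le _ _
      _ ≤ K * (1 / ((n : ℝ) + 1)) + K * (1 / ((n : ℝ) + 1)) * ‖φ‖ := add_le_add h2 h3
      _ = _ := by ring
  have ht : Tendsto (fun n : ℕ => (K * (1 / ((n : ℝ) + 1))) * (1 + ‖φ‖)) atTop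
      (𝓝 (K * 0 * (1 + ‖φ‖))) :=
    (tendsto_one_div_add_atTop_nhds_zero_nat.const_mul K).mul_const _
  rw [mul_zero, zero_mul] at ht
  have := ge_of_tendsto' ht hle
  exact sub_eq_zero.1 (norm_le_zero_iff.1 this)

lemma norm_preMul_le (h : Lp ℝ ∞ m) (φ : PreCotangent m) : ‖preMul h φ‖ ≤ ‖h‖ * ‖φ‖ := by
  have := norm_preMul_sub_le (IsAdmissible.zero (m := m)) h (C := ‖h‖)
    (by simpa using Linfty.ae_abs_le h) φ
  have h0 : φ.mul (IsAdmissible.zero (m := m)) = 0 := Subtype.ext (funext fun x => zero_smul _ _)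
  rwa [h0, UniformSpace.Completion.coe_zero, sub_zero] at this

/-- Multiplication by `h ∈ L^∞(m)` as a linear map from the pre-cotangent module. -/
def preMulLinear (h : Lp ℝ ∞ m) : PreCotangent m →L[ℝ] Cotangent m :=
  LinearMap.mkContinuous
    { toFun := preMul h
      map_add' := fun φ ψ => by
        refine tendsto_nhds_unique (tendsto_preMul h (φ + ψ))
          (((tendsto_preMul h φ).add (tendsto_preMul h ψ)).congr fun n => ?_)
        rw [mulSeq, mulSeq, mulSeq, ← UniformSpace.Completion.coe_add]
        congr 1
        exact Subtype.ext (funext fun x => (smul_add _ _ _).symm)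
      map_smul' := fun c φ => by
        refine tendsto_nhds_unique (tendsto_preMul h (c • φ))
          (((tendsto_preMul h φ).const_smul c).congr fun n => ?_)
        rw [mulSeq, mulSeq, ← UniformSpace.Completion.coe_smul]
        congr 1
        exact Subtype.ext (funext fun x => smul_comm c (approx h n x) (φ.1 x)) } ‖h‖ (norm_preMul_le h)

/-- Multiplication by `h ∈ L^∞(m)` as a bounded operator on `L²(T*M)`. -/
def cotangentMul (h : Lp ℝ ∞ m) : Cotangent m →L[ℝ] Cotangent m :=
  (preMulLinear h).extend UniformSpace.Completion.toComplL

lemma cotangentMul_coe (h : Lp ℝ ∞ m) (φ : PreCotangent m) :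
    cotangentMul h (φ : Cotangent m) = preMul h φ :=
  ContinuousLinearMap.extend_eq (preMulLinear h) (e := UniformSpace.Completion.toComplL)
    UniformSpace.Completion.denseRange_coe
    (UniformSpace.Completion.isUniformInducing_coe _) φ

lemma norm_cotangentMul_le (h : Lp ℝ ∞ m) (ω : Cotangent m) :
    ‖cotangentMul h ω‖ ≤ ‖h‖ * ‖ω‖ := by
  refine UniformSpace.Completion.induction_on ω ?_ fun φ => ?_
  · exact isClosed_le (cotangentMul h).continuous.norm (continuous_const.mul continuous_norm)
  · rw [cotangentMul_coe, UniformSpace.Completion.norm_coe]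
    exact norm_preMul_le h φ

lemma IsAdmissible.add {a b : M → ℝ} (ha : IsAdmissible m a) (hb : IsAdmissible m b) :
    IsAdmissible m fun x => a x + b x := by
  obtain ⟨C, hC, h1⟩ := ha.bounded
  obtain ⟨D, hD, h2⟩ := hb.bounded
  refine ⟨ha.1.comp₂ hb.1 (· + ·), C + D, by positivity, ?_⟩
  filter_upwards [h1, h2] with x h1 h2
  exact (abs_add_le _ _).trans (add_le_add h1 h2)

lemma IsAdmissible.mul {a b : M → ℝ} (ha : IsAdmissible m a) (hb : IsAdmissible m b) :
    IsAdmissible m fun x => a x * b x := by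
  obtain ⟨C, hC, h1⟩ := ha.bounded
  obtain ⟨D, hD, h2⟩ := hb.bounded
  refine ⟨ha.1.comp₂ hb.1 (· * ·), C * D, by positivity, ?_⟩
  filter_upwards [h1, h2] with x h1 h2
  rw [abs_mul]
  gcongr

lemma IsAdmissible.const (c : ℝ) : IsAdmissible m fun _ => c :=
  ⟨IsCountablyValued.const c, |c|, abs_nonneg c, by simp⟩

lemma preMul_add_left (h k : Lp ℝ ∞ m) (φ : PreCotangent m) :
    preMul (h + k) φ = preMul h φ + preMul k φ := by
  refine (eq_preMul (2 * (1 + ‖φ‖)) fun n => ⟨_, (isAdmissible_approx h n).add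
    (isAdmissible_approx k n), ?_, ?_⟩).symm
  · filter_upwards [Lp.coeFn_add h k] with x hx
    rw [hx, Pi.add_apply, add_sub_add_comm]
    have hn : (0 : ℝ) ≤ 1 / ((n : ℝ) + 1) := by positivity
    refine (abs_add_le _ _).trans
      ((add_le_add (abs_sub_approx_le h n x) (abs_sub_approx_le k n x)).trans ?_)
    nlinarith [mul_nonneg (norm_nonneg φ) hn]
  · have e : (φ.mul ((isAdmissible_approx h n).add (isAdmissible_approx k n)) : Cotangent m) =
        (φ.mul (isAdmissible_approx h n) : Cotangent m) +
          (φ.mul (isAdmissible_approx k n) : Cotangent m) := by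
      rw [← UniformSpace.Completion.coe_add]
      congr 1
      exact Subtype.ext (funext fun x => add_smul _ _ _)
    have h1 := norm_preMul_sub_le (isAdmissible_approx h n) h
      (Eventually.of_forall (abs_sub_approx_le h n)) φ
    have h2 := norm_preMul_sub_le (isAdmissible_approx k n) k
      (Eventually.of_forall (abs_sub_approx_le k n)) φ
    have hn : (0 : ℝ) ≤ 1 / ((n : ℝ) + 1) := by positivity
    rw [e, add_sub_add_comm]
    refine (norm_add_le _ _).trans ((add_le_add h1 h2).trans ?_)
    nlinarith

lemma preMul_smul_left (c : ℝ) (h : Lp ℝ ∞ m) (φ : PreCotangent m) :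
    preMul (c • h) φ = c • preMul h φ := by
  refine (eq_preMul (|c| * (1 + ‖φ‖)) fun n => ⟨_, (IsAdmissible.const c).mul
    (isAdmissible_approx h n), ?_, ?_⟩).symm
  · filter_upwards [Lp.coeFn_smul c h] with x hx
    rw [hx, Pi.smul_apply, smul_eq_mul, ← mul_sub, abs_mul, mul_assoc]
    have hn : (0 : ℝ) ≤ 1 / ((n : ℝ) + 1) := by positivity
    refine mul_le_mul_of_nonneg_left ((abs_sub_approx_le h n x).trans ?_) (abs_nonneg c)
    nlinarith [mul_nonneg (norm_nonneg φ) hn]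
  · have e : (φ.mul ((IsAdmissible.const c).mul (isAdmissible_approx h n)) : Cotangent m) =
        c • (φ.mul (isAdmissible_approx h n) : Cotangent m) := by
      rw [← UniformSpace.Completion.coe_smul]
      congr 1
      exact Subtype.ext (funext fun x => mul_smul _ _ _)
    have h1 := norm_preMul_sub_le (isAdmissible_approx h n) h
      (Eventually.of_forall (abs_sub_approx_le h n)) φ
    have hn : (0 : ℝ) ≤ 1 / ((n : ℝ) + 1) := by positivity
    rw [e, ← smul_sub, norm_smul, Real.norm_eq_abs, mul_assoc]
    refine mul_le_mul_of_nonneg_left (h1.trans ?_) (abs_nonneg c)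
    nlinarith

lemma cotangentMul_preMul (h k : Lp ℝ ∞ m) (φ : PreCotangent m) :
    cotangentMul h (preMul k φ) = preMul (h • k : Lp ℝ ∞ m) φ := by
  set K := (‖h‖ + ‖k‖ + 1) * (1 + ‖φ‖)
  have hn : ∀ n : ℕ, (0 : ℝ) ≤ 1 / ((n : ℝ) + 1) := fun n => by positivity
  have hn1 : ∀ n : ℕ, 1 / ((n : ℝ) + 1) ≤ 1 := fun n => by
    rw [div_le_one (by positivity)]
    linarith [n.cast_nonneg (α := ℝ)]
  have hk : ∀ n : ℕ, ∀ᵐ x ∂m, |approx k n x| ≤ ‖k‖ + 1 := fun n => by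
    filter_upwards [Linfty.ae_abs_le k] with x hx
    have h1 := abs_sub_approx_le k n x
    rw [abs_sub_comm] at h1
    have := abs_sub_abs_le_abs_sub (approx k n x) (k x)
    linarith [hn1 n]
  refine eq_preMul K fun n => ⟨_, (isAdmissible_approx h n).mul (isAdmissible_approx k n), ?_, ?_⟩
  · filter_upwards [Lp.coeFn_lpSMul (r := ∞) h k, Linfty.ae_abs_le h, hk n] with x hx h1 h2
    rw [hx, Pi.smul_apply', smul_eq_mul]
    calc |h x * k x - approx h n x * approx k n x|
        = |h x * (k x - approx k n x) + (h x - approx h n x) * approx k n x| := by ring_nf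
      _ ≤ |h x| * |k x - approx k n x| + |h x - approx h n x| * |approx k n x| := by
          rw [← abs_mul, ← abs_mul]; exact abs_add_le _ _
      _ ≤ ‖h‖ * (1 / (n + 1)) + (1 / (n + 1)) * (‖k‖ + 1) := by
          gcongr
          · exact abs_sub_approx_le k n x
          · exact abs_sub_approx_le h n x
      _ = (‖h‖ + ‖k‖ + 1) * (1 / (n + 1)) := by ring
      _ ≤ K * (1 / (n + 1)) := by
          refine mul_le_mul_of_nonneg_right ?_ (hn n)
          exact le_mul_of_one_le_right (by positivity) (by linarith [norm_nonneg φ])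
  · have e : φ.mul ((isAdmissible_approx h n).mul (isAdmissible_approx k n)) =
        (φ.mul (isAdmissible_approx k n)).mul (isAdmissible_approx h n) :=
      Subtype.ext (funext fun x => mul_smul _ _ _)
    have h1 := norm_preMul_sub_le (isAdmissible_approx k n) k
      (Eventually.of_forall (abs_sub_approx_le k n)) φ
    have h2 := norm_preMul_sub_le (isAdmissible_approx h n) h
      (Eventually.of_forall (abs_sub_approx_le h n)) (φ.mul (isAdmissible_approx k n))
    have h3 := φ.norm_mul_le (isAdmissible_approx k n) (hk n)
    rw [e]
    calc ‖cotangentMul h (preMul k φ) -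
          ((φ.mul (isAdmissible_approx k n)).mul (isAdmissible_approx h n) : Cotangent m)‖
        = ‖cotangentMul h (preMul k φ - (φ.mul (isAdmissible_approx k n) : Cotangent m)) +
          (preMul h (φ.mul (isAdmissible_approx k n)) -
          ((φ.mul (isAdmissible_approx k n)).mul (isAdmissible_approx h n) : Cotangent m))‖ := by
          rw [map_sub, cotangentMul_coe, sub_add_sub_cancel]
      _ ≤ ‖h‖ * (1 / (n + 1) * ‖φ‖) + 1 / (n + 1) * ((‖k‖ + 1) * ‖φ‖) := by
          refine (norm_add_le _ _).trans (add_le_add ?_ ?_)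
          · exact (norm_cotangentMul_le h _).trans
              (mul_le_mul_of_nonneg_left h1 (norm_nonneg h))
          · exact h2.trans (mul_le_mul_of_nonneg_left h3 (hn n))
      _ = (‖h‖ + ‖k‖ + 1) * ‖φ‖ * (1 / (n + 1)) := by ring
      _ ≤ K * (1 / (n + 1)) := by
          refine mul_le_mul_of_nonneg_right ?_ (hn n)
          exact mul_le_mul_of_nonneg_left (by linarith) (by positivity)

/-- `L²(T*M)` carries the multiplication by functions in `L^∞(m)`. -/
instance cotangentPremodule : LinftyPremodule m (Cotangent m) where
  mul := LinearMap.mk₂ ℝ (fun h ω => cotangentMul h ω)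
    (fun h k ω => by
      refine UniformSpace.Completion.induction_on ω ?_ fun φ => ?_
      · exact isClosed_eq (cotangentMul (h + k)).continuous
          ((cotangentMul h).continuous.add (cotangentMul k).continuous)
      · rw [cotangentMul_coe, cotangentMul_coe, cotangentMul_coe, preMul_add_left])
    (fun c h ω => by
      refine UniformSpace.Completion.induction_on ω ?_ fun φ => ?_
      · exact isClosed_eq (cotangentMul (c • h)).continuous
          ((cotangentMul h).continuous.const_smul c)
      · rw [cotangentMul_coe, cotangentMul_coe, preMul_smul_left])
    (fun h ω η => map_add (cotangentMul h) ω η)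
    (fun c h ω => map_smul (cotangentMul h) c ω)
  mul_mul h k ω := by
    refine UniformSpace.Completion.induction_on ω ?_ fun φ => ?_
    · exact isClosed_eq (cotangentMul (h • k : Lp ℝ ∞ m)).continuous
        ((cotangentMul h).continuous.comp (cotangentMul k).continuous)
    · change cotangentMul (h • k : Lp ℝ ∞ m) (φ : Cotangent m) =
        cotangentMul h (cotangentMul k (φ : Cotangent m))
      rw [cotangentMul_coe, cotangentMul_coe, cotangentMul_preMul]
  one_mul ω := by
    refine UniformSpace.Completion.induction_on ω ?_ fun φ => ?_
    · exact isClosed_eq (cotangentMul (chi m MeasurableSet.univ)).continuous continuous_id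
    · change cotangentMul (chi m MeasurableSet.univ) (φ : Cotangent m) = (φ : Cotangent m)
      rw [cotangentMul_coe]
      refine (eq_preMul 0 fun n => ⟨_, IsAdmissible.const 1, ?_, ?_⟩).symm
      · filter_upwards [coeFn_chi m MeasurableSet.univ] with x hx
        rw [hx]
        simp
      · have : φ.mul (IsAdmissible.const (m := m) 1) = φ :=
          Subtype.ext (funext fun x => one_smul _ _)
        rw [this]
        simp
  norm_mul_le h ω := norm_cotangentMul_le h ω

end Cotangent

/-! ## The tangent module, gradients and infinitesimal properties of the space -/

section Tangent

variable {M : Type*} [MetricSpace M] [SecondCountableTopology M] [MeasurableSpace M]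
  [BorelSpace M] (m : Measure M)

/-- The tangent module `L²(TM)`: the dual module of `L²(T*M)`. For `X ∈ L²(TM)` and
`ω ∈ L²(T*M)`, the function `ω(X) ∈ L¹(m)` is `X ω`. -/
abbrev Tangent : Type _ := DualModule m (Cotangent m)

variable {m}

/-- `g ∈ L²(m)` is the pointwise norm `|X|` of the vector field `X`: the essential supremum of
the functions `|ω(X)|` over all `ω ∈ L²(T*M)` with `|ω|_* ≤ 1` a.e. -/
def IsPointwiseNorm (X : Tangent m) (g : Lp ℝ 2 m) : Prop :=
  IsLUB {u : M →ₘ[m] ℝ | ∃ ω : Cotangent m, (∀ᵐ x ∂m, cotangentNorm ω x ≤ 1) ∧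
    u = |(X ω : M →ₘ[m] ℝ)|} (g : M →ₘ[m] ℝ)

/-- `X` is a gradient of `f ∈ S²(M)`: `df(X) = |X|² = |df|_*²` a.e. -/
def IsGradient (f : sobolevClass m) (X : Tangent m) : Prop :=
  ∃ g : Lp ℝ 2 m, IsPointwiseNorm X g ∧
    ∀ᵐ x ∂m, X (differential f) x = g x ^ 2 ∧
      g x ^ 2 = cotangentNorm (differential f) x ^ 2

variable (m)

/-- Infinitesimally strictly convex spaces: every `g ∈ S²(M)` has exactly one gradient. -/
def InfinitesimallyStrictlyConvex : Prop :=
  ∀ g : sobolevClass m, ∃! X : Tangent m, IsGradient g X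

variable {m} in
/-- The gradient `∇g` on an infinitesimally strictly convex space. -/
def gradient (h : InfinitesimallyStrictlyConvex m) (g : sobolevClass m) : Tangent m :=
  (h g).choose

/-- Infinitesimally Hilbertian spaces: `W^{1,2}(M)` is a Hilbert space. -/
def InfinitesimallyHilbertian : Prop := IsHilbertSpace (W12 m)

end Tangent

end

end MMS

/-! All five conditions are equivalent to one statement, `PointwiseParallelogram`: |D(f+g)|² +
|D(f-g)|² = 2|Df|² + 2|Dg|² a.e. for all f, g in S²(M).

From condition 1 to the pointwise law. The parallelogram identity of W^{1,2} is global, contains L²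
terms and only concerns square integrable functions; locality of |Df| removes all three defects. The
zigzag function of height at most δ is piecewise of the form ±y + const, so composing f and g with
it changes neither |Df| and |Dg| nor the sum |D(f+g)|² + |D(f-g)|². After multiplication by a
bounded cutoff ψ in L² ∩ S² the composed functions lie in W^{1,2}, have L² norm O(δ), and their
gradients are |ψ||Df|, |ψ||Dg| up to δ|Dψ|. Letting δ → 0 gives an inequality of integrals weighted
by ψ² (`integral_weighted_parallelogram_le`). Lipschitz cutoffs that approximate indicators of open
sets, together with outer regularity, make it pointwise; the reverse inequality is the same one for
the pair f+g, f-g.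

From the pointwise law to the other conditions. The law passes by density to all 1-forms, so the
polarization `ptInner` is a pointwise scalar product that is bilinear over L^∞(m). The Riesz theorem
turns it into an isometry `sharpEquiv` from L²(T*M) onto L²(TM), and the unique gradient of f is the
image of df. Symmetry, additivity and the Leibniz rule for gradients are then those of the scalar
product and of the differential.

Back to the pointwise law. Under condition 3 the parallelogram identity is applied to χ_A df and χ_A
dg for every Borel set A. Under 2 and 4 one expands d(f±g)(∇(f±g)); the mixed terms cancel in the
sum. Under 5 the product (1+εf)(1+εg) = 1 + ε(f+g+εfg) yields additivity of the gradient up to an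
error of order ε.

The calculus for |Df| rests on localizing the integrated inequality to almost every curve
(`IsPlanGradient.ae_curve`). The functions t ↦ f(γ_t) are not known to be continuous, so arguments
along a curve use almost all times or a countable dense set of times only. They give locality
(`IsPlanGradient.indicator_ne_zero`) and stability under minima (`IsPlanGradient.min`); the latter,
with closedness, shows that the infimum |Df| is itself a weak upper gradient. -/

namespace MMS

noncomputable section

/-! ## Restriction of curves and of test plans -/

section Restriction

variable {M : Type*} [MetricSpace M]

/-- The affine reparametrization `t ↦ (1 - t) a + t b` of the unit interval. -/
def affineTime (a b : I) : C(I, I) where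
  toFun t := ⟨(1 - (t : ℝ)) * a + t * b, by
    have h1 := t.2.1
    have h2 := t.2.2
    have h3 := a.2.1
    have h4 := a.2.2
    have h5 := b.2.1
    have h6 := b.2.2
    constructor <;> nlinarith⟩
  continuous_toFun := by fun_prop

lemma coe_affineTime (a b t : I) : (affineTime a b t : ℝ) = (1 - (t : ℝ)) * a + t * b := rfl

lemma affineTime_zero (a b : I) : affineTime a b 0 = a :=
  Subtype.ext (by simp [coe_affineTime])

lemma affineTime_one (a b : I) : affineTime a b 1 = b :=
  Subtype.ext (by simp [coe_affineTime])

lemma edist_affineTime (a b s t : I) :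
    edist (affineTime a b s) (affineTime a b t) = edist a b * edist s t := by
  simp only [edist_dist, Subtype.dist_eq, Real.dist_eq, coe_affineTime]
  rw [← ENNReal.ofReal_mul (abs_nonneg _), ← abs_mul, ← abs_neg]
  congr 2
  ring

lemma affineTime_ne {a b : I} (hab : a ≠ b) {s t : I} (hst : s ≠ t) :
    affineTime a b s ≠ affineTime a b t := by
  rw [← edist_pos, edist_affineTime]
  exact ENNReal.mul_pos (edist_pos.2 hab).ne' (edist_pos.2 hst).ne'

lemma setLIntegral_unitInterval (S : Set I) (h : I → ℝ≥0∞) :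
    ∫⁻ t in S, h t = ∫⁻ x in ((↑) : I → ℝ) '' S, h (Set.projIcc 0 1 zero_le_one x) := by
  rw [← setLIntegral_subtype (μ := volume) (measurableSet_Icc (a := (0 : ℝ)) (b := 1)) S
    (fun x => h (Set.projIcc 0 1 zero_le_one x))]
  simp only [Set.projIcc_val]
  rfl

lemma lintegral_affineTime {a b : I} (hab : a < b) (h : I → ℝ≥0∞) :
    ∫⁻ t, edist a b * h (affineTime a b t) = ∫⁻ t in Set.Icc a b, h t := by
  rw [← setLIntegral_univ, setLIntegral_unitInterval, setLIntegral_unitInterval]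
  have hab' : (0 : ℝ) < b - a := sub_pos.2 hab
  have e1 : ((↑) : I → ℝ) '' Set.univ = Set.Icc 0 1 := by
    rw [Set.image_univ, Subtype.range_coe]
  have e2 : ((↑) : I → ℝ) '' Set.Icc a b = (fun x : ℝ => (b - a) * x + a) '' Set.Icc 0 1 := by
    rw [Set.image_affine_Icc' hab']
    ext x
    simp only [Set.mem_image, Set.mem_Icc, mul_zero, zero_add, mul_one, sub_add_cancel]
    constructor
    · rintro ⟨y, hy, rfl⟩
      exact hy
    · intro hx
      exact ⟨⟨x, a.2.1.trans hx.1, hx.2.trans b.2.2⟩, hx, rfl⟩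
  rw [e1, e2, lintegral_image_eq_lintegral_abs_deriv_mul (f' := fun _ => (b : ℝ) - a)
    measurableSet_Icc]
  · refine setLIntegral_congr_fun measurableSet_Icc fun x hx => ?_
    have e3 : edist a b = ENNReal.ofReal |(b : ℝ) - a| := by
      rw [edist_comm, edist_dist, Subtype.dist_eq, Real.dist_eq]
    have e4 : affineTime a b (Set.projIcc 0 1 zero_le_one x) =
        Set.projIcc 0 1 zero_le_one ((b - a) * x + a) := by
      rw [Set.projIcc_of_mem _ hx]
      have : (b - a) * x + a ∈ Set.Icc (0 : ℝ) 1 := by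
        have h3 := a.2.1
        have h6 := b.2.2
        constructor <;> nlinarith [hx.1, hx.2]
      rw [Set.projIcc_of_mem _ this]
      refine Subtype.ext ?_
      rw [coe_affineTime]
      ring
    simp only [e3, e4]
  · intro x _
    simpa using ((hasDerivAt_id x).const_mul ((b : ℝ) - a)).add_const (a : ℝ) |>.hasDerivWithinAt
  · intro x _ y _ hxy
    simpa [hab'.ne'] using hxy

/-- The restriction of a curve to `[a, b]`, reparametrized on `[0, 1]`. -/
def subCurve (a b : I) (γ : C(I, M)) : C(I, M) := γ.comp (affineTime a b)

lemma subCurve_apply (a b : I) (γ : C(I, M)) (t : I) : subCurve a b γ t = γ (affineTime a b t) :=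
  rfl

lemma continuous_subCurve (a b : I) : Continuous (subCurve a b : C(I, M) → C(I, M)) :=
  ContinuousMap.continuous_precomp _

/-- The affine map multiplies distances of times by exactly |b - a|, hence also the difference
quotients. Only an inequality results because the restricted times approach the limit point inside
[a, b], which matters at its end points. -/
lemma metricSpeed_subCurve_le {a b : I} (hab : a < b) (γ : C(I, M)) (t : I) :
    metricSpeed (subCurve a b γ) t ≤ edist a b * metricSpeed γ (affineTime a b t) := by
  have hne : edist a b ≠ 0 := (edist_pos.2 hab.ne).ne'
  have htop : edist a b ≠ ∞ := edist_ne_top _ _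
  set w : I → ℝ≥0∞ := fun r => edist (γ r) (γ (affineTime a b t)) / edist r (affineTime a b t)
  have h1 : metricSpeed (subCurve a b γ) t =
      limsup (fun s => edist a b * w (affineTime a b s)) (𝓝[≠] t) := by
    refine limsup_congr ?_
    filter_upwards with s
    simp only [w, subCurve_apply, edist_affineTime, div_eq_mul_inv]
    rw [ENNReal.mul_inv (Or.inl hne) (Or.inl htop), mul_left_comm (edist a b),
      ← mul_assoc (edist a b), ENNReal.mul_inv_cancel hne htop, one_mul]
  rw [h1, ENNReal.limsup_const_mul_of_ne_top htop]
  gcongr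
  change limsup (w ∘ affineTime a b) _ ≤ _
  rw [limsup_comp]
  refine limsup_le_limsup_of_le ?_
  refine tendsto_nhdsWithin_of_tendsto_nhds_of_eventually_within _
    ((affineTime a b).continuous.continuousAt.mono_left nhdsWithin_le_nhds) ?_
  filter_upwards [self_mem_nhdsWithin] with s hs
  exact affineTime_ne hab.ne hs

/-- The integrand has degree one in the speed, so the factor |b - a| is exactly the Jacobian of the
change of time. -/
lemma lintegral_mul_metricSpeed_subCurve_le {a b : I} (hab : a < b) (γ : C(I, M))
    (G : M → ℝ≥0∞) :
    ∫⁻ t, G (subCurve a b γ t) * metricSpeed (subCurve a b γ) t ≤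
      ∫⁻ t in Set.Icc a b, G (γ t) * metricSpeed γ t := by
  rw [← lintegral_affineTime hab]
  refine lintegral_mono fun t => ?_
  rw [mul_left_comm]
  exact mul_le_mul' le_rfl (metricSpeed_subCurve_le hab γ t)

lemma IsACCurve.subCurve {γ : C(I, M)} (hγ : IsACCurve γ) {a b : I} (hab : a < b) :
    IsACCurve (subCurve a b γ) := by
  obtain ⟨f, hf, hd⟩ := hγ
  have hab' : (0 : ℝ) < b - a := sub_pos.2 hab
  refine ⟨fun r => ((b : ℝ) - a) * f (a + (b - a) * r), ?_, fun s t hst => ?_⟩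
  · have h1 : IntegrableOn f (Set.Icc (a : ℝ) b) :=
      hf.mono_set (Set.Icc_subset_Icc a.2.1 b.2.2)
    have e2 : Set.Icc (a : ℝ) b = (fun x : ℝ => (b - a) * x + a) '' Set.Icc 0 1 := by
      rw [Set.image_affine_Icc' hab']
      simp
    rw [e2, integrableOn_image_iff_integrableOn_abs_deriv_smul (f' := fun _ => (b : ℝ) - a)
      measurableSet_Icc] at h1
    · simpa [abs_of_pos hab', add_comm] using h1
    · intro x _
      simpa using
        ((hasDerivAt_id x).const_mul ((b : ℝ) - a)).add_const (a : ℝ) |>.hasDerivWithinAt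
    · intro x _ y _ hxy
      simpa [hab'.ne'] using hxy
  · have h1 : affineTime a b s ≤ affineTime a b t := by
      rw [← Subtype.coe_le_coe, coe_affineTime, coe_affineTime]
      have : (s : ℝ) ≤ t := hst
      nlinarith
    refine (hd _ _ h1).trans (le_of_eq ?_)
    rw [intervalIntegral.integral_const_mul, intervalIntegral.mul_integral_comp_add_mul]
    congr 1 <;> rw [coe_affineTime] <;> ring

/-- Of the two factors |b - a| in the squared speed, one is the Jacobian of the change of time and
the other is at most 1. -/
lemma kineticEnergy_subCurve_le {a b : I} (hab : a < b) (γ : C(I, M)) :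
    kineticEnergy (subCurve a b γ) ≤ kineticEnergy γ := by
  unfold kineticEnergy
  by_cases hγ : IsACCurve γ
  · rw [if_pos hγ, if_pos (hγ.subCurve hab)]
    have h1 : edist a b ≤ 1 := by
      rw [edist_dist, Subtype.dist_eq, ← ENNReal.ofReal_one]
      refine ENNReal.ofReal_le_ofReal ?_
      have h3 := a.2.1
      have h4 := a.2.2
      have h5 := b.2.1
      have h6 := b.2.2
      rw [Real.dist_eq, abs_le]
      constructor <;> linarith
    calc ∫⁻ t, metricSpeed (subCurve a b γ) t ^ 2
        ≤ ∫⁻ t, edist a b * metricSpeed γ (affineTime a b t) ^ 2 := by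
          refine lintegral_mono fun t => ?_
          refine (pow_le_pow_left₀ zero_le (metricSpeed_subCurve_le hab γ t) 2).trans ?_
          rw [mul_pow]
          refine mul_le_mul' ?_ le_rfl
          rw [sq]
          exact mul_le_of_le_one_left zero_le h1
      _ = ∫⁻ t in Set.Icc a b, metricSpeed γ t ^ 2 :=
          lintegral_affineTime hab fun t => metricSpeed γ t ^ 2
      _ ≤ _ := setLIntegral_le_lintegral _ _
  · rw [if_neg hγ]
    exact le_top

variable [MeasurableSpace M] {m : Measure M}

lemma measurable_eval [BorelSpace M] (t : I) : Measurable fun γ : C(I, M) => γ t :=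
  (continuous_eval_const t).measurable

lemma IsTestPlan.map_subCurve [BorelSpace M] {π : Measure C(I, M)} (hπ : IsTestPlan m π) {a b : I}
    (hab : a < b) : IsTestPlan m (π.map (subCurve a b)) := by
  have hm : Measurable (subCurve a b : C(I, M) → C(I, M)) := (continuous_subCurve a b).measurable
  have := hπ.isProbabilityMeasure
  obtain ⟨C, hC⟩ := hπ.bounded_compression
  refine ⟨Measure.isProbabilityMeasure_map hm.aemeasurable, ⟨C, fun t => ?_⟩, ?_⟩
  · rw [Measure.map_map (measurable_eval t) hm]
    exact hC (affineTime a b t)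
  · exact (lintegral_map_le _ _).trans_lt ((lintegral_mono fun γ =>
      kineticEnergy_subCurve_le hab γ).trans_lt hπ.finite_energy)

/-- Conditioning a plan on a set of curves multiplies compression constant and energy by at most
1/π(Γ). Together with `IsTestPlan.map_subCurve` this localizes integrated inequalities to sets of
curves and to intervals of time. -/
lemma IsTestPlan.cond [BorelSpace M] {π : Measure C(I, M)} (hπ : IsTestPlan m π)
    {Γ : Set C(I, M)} (h0 : π Γ ≠ 0) :
    IsTestPlan m ((π Γ)⁻¹ • π.restrict Γ) := by
  have := hπ.isProbabilityMeasure
  obtain ⟨C, hC⟩ := hπ.bounded_compression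
  refine ⟨⟨?_⟩, ⟨(π Γ)⁻¹.toNNReal * C, fun t => ?_⟩, ?_⟩
  · rw [Measure.smul_apply, Measure.restrict_apply_univ, smul_eq_mul,
      ENNReal.inv_mul_cancel h0 (measure_ne_top π Γ)]
  · rw [Measure.map_smul, mul_smul]
    have h1 : (π.restrict Γ).map (fun γ : C(I, M) => γ t) ≤ C • m :=
      (Measure.map_mono Measure.restrict_le_self (measurable_eval t)).trans (hC t)
    have h2 : ((π Γ)⁻¹.toNNReal : ℝ≥0∞) = (π Γ)⁻¹ :=
      ENNReal.coe_toNNReal (ENNReal.inv_ne_top.2 h0)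
    refine Measure.le_iff.2 fun s hs => ?_
    have h3 := Measure.le_iff.1 h1 s hs
    rw [Measure.smul_apply, Measure.smul_apply, ENNReal.smul_def, h2]
    exact mul_le_mul' le_rfl h3
  · rw [lintegral_smul_measure]
    exact ENNReal.mul_lt_top (ENNReal.inv_lt_top.2 (pos_iff_ne_zero.2 h0))
      ((setLIntegral_le_lintegral _ _).trans_lt hπ.finite_energy)

end Restriction

/-! ### Joint measurability of the metric speed in the curve and the time. -/

section Measurability

variable {M : Type*} [MetricSpace M]

/-- The difference quotient is continuous away from t, so its supremum over a punctured ball is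
already the supremum over a dense set. With D countable, the upper limit becomes a countable
combination of measurable functions. -/
lemma metricSpeed_eq_iInf (γ : C(I, M)) (t : I) {D : Set I} (hD : Dense D) :
    metricSpeed γ t = ⨅ n : ℕ, ⨆ s ∈ D, {s : I | dist s t < 1 / ((n : ℝ) + 1) ∧ s ≠ t}.indicator
      (fun s => edist (γ s) (γ t) / edist s t) s := by
  set w : I → ℝ≥0∞ := fun s => edist (γ s) (γ t) / edist s t
  have hB : (𝓝[≠] t).HasBasis (fun _ : ℕ => True)
      fun n => {s : I | dist s t < 1 / ((n : ℝ) + 1) ∧ s ≠ t} :=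
    nhdsWithin_hasBasis Metric.nhds_basis_ball_inv_nat_succ {t}ᶜ
  rw [metricSpeed, hB.limsup_eq_iInf_iSup]
  simp only [iInf_pos]
  refine iInf_congr fun n => ?_
  set B := {s : I | dist s t < 1 / ((n : ℝ) + 1) ∧ s ≠ t}
  have hBo : IsOpen B := Metric.isOpen_ball.inter isOpen_ne
  refine le_antisymm (iSup₂_le fun s hs => ?_) (iSup₂_le fun s _ => ?_)
  · have hc : ContinuousAt w s := by
      refine ENNReal.Tendsto.div (γ.continuous.edist continuous_const).continuousAt ?_
        (continuous_id.edist continuous_const).continuousAt ?_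
      · exact Or.inr (edist_pos.2 hs.2).ne'
      · exact Or.inl (edist_ne_top _ _)
    have hs' : s ∈ closure (B ∩ D) := hD.open_subset_closure_inter hBo hs
    have : w s ∈ closure (w '' (B ∩ D)) := mem_closure_image hc hs'
    refine closure_minimal ?_ isClosed_Iic this
    rintro _ ⟨r, hr, rfl⟩
    rw [Set.mem_Iic, ← Set.indicator_of_mem hr.1 w]
    exact le_iSup₂ (f := fun i (_ : i ∈ D) => B.indicator w i) r hr.2
  · by_cases hs : s ∈ B
    · rw [Set.indicator_of_mem hs]
      exact le_iSup₂ (f := fun i (_ : i ∈ B) => w i) s hs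
    · rw [Set.indicator_of_notMem hs]
      exact zero_le

variable [SecondCountableTopology M]

lemma measurable_metricSpeed : Measurable fun q : C(I, M) × I => metricSpeed q.1 q.2 := by
  obtain ⟨D, hDc, hD⟩ := TopologicalSpace.exists_countable_dense I
  have : (fun q : C(I, M) × I => metricSpeed q.1 q.2) = fun q => ⨅ n : ℕ, ⨆ s ∈ D,
      {q : C(I, M) × I | dist s q.2 < 1 / ((n : ℝ) + 1) ∧ s ≠ q.2}.indicator
        (fun q => edist (q.1 s) (q.1 q.2) / edist s q.2) q := by
    funext q
    rw [metricSpeed_eq_iInf q.1 q.2 hD]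
    rfl
  rw [this]
  refine Measurable.iInf fun n => Measurable.biSup D hDc fun s _ => ?_
  have h1 : Continuous fun q : C(I, M) × I => edist (q.1 s) (q.1 q.2) := by fun_prop
  have h2 : Continuous fun q : C(I, M) × I => edist s q.2 := by fun_prop
  refine (h1.measurable.div h2.measurable).indicator (MeasurableSet.inter ?_ ?_)
  · exact (isOpen_lt (continuous_const.dist continuous_snd) continuous_const).measurableSet
  · exact (isOpen_ne_fun continuous_const continuous_snd).measurableSet

end Measurability

end

end MMS

namespace MMS

noncomputable section

/-! ## Upper gradient inequalities along test plans and along almost every curve -/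

section PlanGradient

variable {M : Type*} [MetricSpace M] [SecondCountableTopology M] [MeasurableSpace M]
  [BorelSpace M] {m : Measure M}

variable (m) in
/-- The upper gradient inequality, integrated along test plans, for a function `f` and an
extended nonnegative function `G`. -/
def IsPlanGradient (f : M → ℝ) (G : M → ℝ≥0∞) : Prop :=
  ∀ π : Measure C(I, M), IsTestPlan m π →
    ∫⁻ γ, ENNReal.ofReal |f (γ 1) - f (γ 0)| ∂π ≤
      ∫⁻ γ, (∫⁻ t : I, G (γ t) * metricSpeed γ t) ∂π

lemma measurable_uncurry_eval : Measurable fun q : C(I, M) × I => q.1 q.2 :=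
  (continuous_eval : Continuous fun q : C(I, M) × I => q.1 q.2).measurable

lemma measurable_curve (γ : C(I, M)) : Measurable γ := γ.continuous.measurable

lemma measurable_mul_metricSpeed {G : M → ℝ≥0∞} (hG : Measurable G) :
    Measurable fun q : C(I, M) × I => G (q.1 q.2) * metricSpeed q.1 q.2 :=
  (hG.comp measurable_uncurry_eval).mul measurable_metricSpeed

lemma measurable_mul_metricSpeed_right {G : M → ℝ≥0∞} (hG : Measurable G) (γ : C(I, M)) :
    Measurable fun t => G (γ t) * metricSpeed γ t :=
  (measurable_mul_metricSpeed hG).comp measurable_prodMk_left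

lemma measurable_lintegral_metricSpeed {G : M → ℝ≥0∞} (hG : Measurable G) :
    Measurable fun γ : C(I, M) => ∫⁻ t, G (γ t) * metricSpeed γ t :=
  (measurable_mul_metricSpeed hG).lintegral_prod_right'

/-- This joint measurability permits exchanging "for every t and almost every γ" with "for almost
every γ and almost every t" in inequalities whose domain of integration depends on t. -/
lemma measurable_setLIntegral_metricSpeed_prod {G : M → ℝ≥0∞} (hG : Measurable G)
    {S : I → Set I} (hS : MeasurableSet {p : I × I | p.2 ∈ S p.1}) :
    Measurable fun q : C(I, M) × I => ∫⁻ r in S q.2, G (q.1 r) * metricSpeed q.1 r := by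
  have h1 : ∀ q : C(I, M) × I, ∫⁻ r in S q.2, G (q.1 r) * metricSpeed q.1 r =
      ∫⁻ r, {p : (C(I, M) × I) × I | p.2 ∈ S p.1.2}.indicator
        (fun p => G (p.1.1 p.2) * metricSpeed p.1.1 p.2) (q, r) := fun q => by
    have : MeasurableSet (S q.2) := measurable_prodMk_left (x := q.2) hS
    rw [← lintegral_indicator this]
    rfl
  simp only [h1]
  refine Measurable.lintegral_prod_right' (f := {p : (C(I, M) × I) × I | p.2 ∈ S p.1.2}.indicator
        (fun p => G (p.1.1 p.2) * metricSpeed p.1.1 p.2)) (Measurable.indicator ?_ ?_)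
  · exact (measurable_mul_metricSpeed hG).comp
      ((measurable_fst.comp measurable_fst).prodMk measurable_snd)
  · exact ((measurable_snd.comp measurable_fst).prodMk measurable_snd) hS

lemma measurable_ofReal_abs_sub {f : M → ℝ} (hf : Measurable f) (a b : I) :
    Measurable fun γ : C(I, M) => ENNReal.ofReal |f (γ b) - f (γ a)| :=
  (continuous_abs.measurable.comp
    ((hf.comp (measurable_eval b)).sub (hf.comp (measurable_eval a)))).ennreal_ofReal

lemma IsTestPlan.lintegral_metricSpeed_sq_lt_top {π : Measure C(I, M)} (hπ : IsTestPlan m π) :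
    ∫⁻ γ, (∫⁻ t, metricSpeed γ t ^ 2) ∂π < ∞ := by
  refine (lintegral_mono fun γ => ?_).trans_lt hπ.finite_energy
  unfold kineticEnergy
  split_ifs
  · exact le_rfl
  · exact le_top

lemma IsTestPlan.exists_lintegral_eval_le {π : Measure C(I, M)} (hπ : IsTestPlan m π) :
    ∃ C : ℝ≥0, ∀ H : M → ℝ≥0∞, Measurable H →
      (∀ t : I, ∫⁻ γ, H (γ t) ∂π ≤ C * ∫⁻ x, H x ∂m) ∧
      ∫⁻ γ, (∫⁻ t : I, H (γ t)) ∂π ≤ C * ∫⁻ x, H x ∂m := by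
  have := hπ.isProbabilityMeasure
  obtain ⟨C, hC⟩ := hπ.bounded_compression
  refine ⟨C, fun H hH => ?_⟩
  have h1 : ∀ t : I, ∫⁻ γ, H (γ t) ∂π ≤ C * ∫⁻ x, H x ∂m := fun t => by
    rw [← lintegral_map hH (measurable_eval t)]
    refine (lintegral_mono' (hC t) le_rfl).trans (le_of_eq ?_)
    rw [ENNReal.smul_def, lintegral_smul_measure, smul_eq_mul]
  refine ⟨h1, ?_⟩
  rw [lintegral_lintegral_swap (f := fun (γ : C(I, M)) (t : I) => H (γ t))
    (hH.comp measurable_uncurry_eval).aemeasurable]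
  calc ∫⁻ t : I, (∫⁻ γ, H (γ t) ∂π) ≤ ∫⁻ _ : I, C * ∫⁻ x, H x ∂m := lintegral_mono h1
    _ = _ := by simp

lemma lintegral_mul_metricSpeed_le (π : Measure C(I, M)) [SFinite π] {H : M → ℝ≥0∞}
    (hH : Measurable H) :
    ∫⁻ γ, (∫⁻ t : I, H (γ t) * metricSpeed γ t) ∂π ≤
      (∫⁻ γ, (∫⁻ t : I, H (γ t) ^ 2) ∂π) ^ (1 / 2 : ℝ) *
        (∫⁻ γ, (∫⁻ t : I, metricSpeed γ t ^ 2) ∂π) ^ (1 / 2 : ℝ) := by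
  have m1 := hH.comp measurable_uncurry_eval
  have m2 := measurable_metricSpeed (M := M)
  have h := ENNReal.lintegral_mul_le_Lp_mul_Lq (π.prod (volume : Measure I))
    Real.HolderConjugate.two_two m1.aemeasurable m2.aemeasurable
  simp only [ENNReal.rpow_ofNat] at h
  rw [lintegral_prod _ (m1.mul m2).aemeasurable, lintegral_prod _ (m1.pow_const 2).aemeasurable,
    lintegral_prod _ (m2.pow_const 2).aemeasurable] at h
  exact h

lemma IsTestPlan.lintegral_mul_metricSpeed_lt_top {π : Measure C(I, M)} (hπ : IsTestPlan m π)
    {H : M → ℝ≥0∞} (hH : Measurable H) (hH2 : ∫⁻ γ, (∫⁻ t : I, H (γ t) ^ 2) ∂π < ∞) :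
    ∫⁻ γ, (∫⁻ t : I, H (γ t) * metricSpeed γ t) ∂π < ∞ := by
  have := hπ.isProbabilityMeasure
  exact (lintegral_mul_metricSpeed_le π hH).trans_lt (ENNReal.mul_lt_top
    (ENNReal.rpow_lt_top_of_nonneg (by norm_num) hH2.ne)
    (ENNReal.rpow_lt_top_of_nonneg (by norm_num) hπ.lintegral_metricSpeed_sq_lt_top.ne))

/-- The integrated upper gradient inequality localizes to almost every curve. -/
lemma IsPlanGradient.ae_curve {f : M → ℝ} {G : M → ℝ≥0∞} (h : IsPlanGradient m f G)
    (hf : Measurable f) (hG : Measurable G) {π : Measure C(I, M)} (hπ : IsTestPlan m π)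
    {a b : I} (hab : a ≤ b) :
    ∀ᵐ γ ∂π, ENNReal.ofReal |f (γ b) - f (γ a)| ≤
      ∫⁻ t in Set.Icc a b, G (γ t) * metricSpeed γ t := by
  have := hπ.isProbabilityMeasure
  rcases hab.eq_or_lt with rfl | hab
  · simp
  -- It suffices to integrate over an arbitrary measurable set Γ of curves. If Γ has positive
  -- measure, π conditioned on Γ and restricted to [a, b] is again a test plan, and the normalizing
  -- factor cancels on both sides.
  refine ae_le_of_forall_setLIntegral_le_of_sigmaFinite (measurable_ofReal_abs_sub hf a b)
    fun Γ hΓ _ => ?_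
  by_cases h0 : π Γ = 0
  · rw [Measure.restrict_eq_zero.2 h0]
    simp
  have h1 := h _ ((hπ.cond h0).map_subCurve hab)
  have hm : Measurable (subCurve a b : C(I, M) → C(I, M)) := (continuous_subCurve a b).measurable
  rw [lintegral_map (measurable_ofReal_abs_sub hf 0 1) hm,
    lintegral_map (measurable_lintegral_metricSpeed hG) hm, lintegral_smul_measure,
    lintegral_smul_measure, smul_eq_mul, smul_eq_mul,
    ENNReal.mul_le_mul_iff_right (ENNReal.inv_ne_zero.2 (measure_ne_top π Γ))
      (ENNReal.inv_ne_top.2 h0)] at h1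
  simp only [subCurve_apply, affineTime_zero, affineTime_one] at h1
  exact h1.trans (lintegral_mono fun γ => lintegral_mul_metricSpeed_subCurve_le hab γ G)

lemma IsPlanGradient.of_ae_curve {f : M → ℝ} {G : M → ℝ≥0∞}
    (h : ∀ π : Measure C(I, M), IsTestPlan m π → ∀ᵐ γ ∂π, ENNReal.ofReal |f (γ 1) - f (γ 0)| ≤
      ∫⁻ t, G (γ t) * metricSpeed γ t) : IsPlanGradient m f G :=
  fun π hπ => lintegral_mono_ae (h π hπ)

/-- Between its first and its last zero the function u makes no net progress, so only the times
before and after contribute, and there u does not vanish. As u need not be continuous, the first and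
last zero are replaced by the infimum a and supremum b of the set Z of zeros at which both one-sided
estimates hold. -/
lemma ofReal_abs_sub_le_setLIntegral_ne_zero {u : I → ℝ} (hu : Measurable u) {g : I → ℝ≥0∞}
    (hfin : ∫⁻ t, g t ≠ ∞)
    (h0 : ∀ᵐ t : I, ENNReal.ofReal |u t - u 0| ≤ ∫⁻ r in Set.Iic t, g r)
    (h1 : ∀ᵐ t : I, ENNReal.ofReal |u 1 - u t| ≤ ∫⁻ r in Set.Ici t, g r)
    (h01 : ENNReal.ofReal |u 1 - u 0| ≤ ∫⁻ r, g r) :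
    ENNReal.ofReal |u 1 - u 0| ≤ ∫⁻ t in {t | u t ≠ 0}, g t := by
  set Z : Set I := {t | u t = 0 ∧ ENNReal.ofReal |u t - u 0| ≤ ∫⁻ r in Set.Iic t, g r ∧
    ENNReal.ofReal |u 1 - u t| ≤ ∫⁻ r in Set.Ici t, g r} with hZ
  have hae : ∀ᵐ t : I, u t = 0 → t ∈ Z := by
    filter_upwards [h0, h1] with t h0 h1 h
    exact ⟨h, h0, h1⟩
  rcases Z.eq_empty_or_nonempty with hZe | hZn
  · rw [hZe] at hae
    rwa [Measure.restrict_eq_self_of_ae_mem (by simpa using hae)]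
  set ν : Measure I := volume.withDensity g with hν
  have hνS : ∀ S : Set I, MeasurableSet S → ν S = ∫⁻ t in S, g t := fun S hS =>
    withDensity_apply g hS
  have hνf : IsFiniteMeasure ν := ⟨by
    rw [hνS _ MeasurableSet.univ, setLIntegral_univ]
    exact hfin.lt_top⟩
  have hν0 : ∀ a : I, ν {a} = 0 := fun a => by
    rw [hνS _ (measurableSet_singleton a)]
    simp
  set a := sInf Z
  set b := sSup Z
  -- Nothing is known about u at a itself. The estimate holds along a sequence in Z decreasing to a
  -- and passes to the limit by continuity of ν from above; the point a carries no mass.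
  have ha : ENNReal.ofReal |u 0| ≤ ν (Set.Iio a) := by
    obtain ⟨s, hs, hsa, hsZ⟩ := exists_seq_tendsto_sInf hZn (OrderBot.bddBelow Z)
    have e1 : (⋂ n, Set.Iic (s n)) = Set.Iic a := by
      ext x
      simp only [Set.mem_iInter, Set.mem_Iic]
      exact ⟨fun h => ge_of_tendsto' hsa h, fun h n => h.trans (hs.le_of_tendsto hsa n)⟩
    have e2 := tendsto_measure_iInter_atTop (μ := ν) (s := fun n => Set.Iic (s n))
      (fun n => measurableSet_Iic.nullMeasurableSet)
      (fun n k hnk => Set.Iic_subset_Iic.2 (hs hnk)) ⟨0, measure_ne_top _ _⟩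
    rw [e1] at e2
    have e3 : ν (Set.Iic a) ≤ ν (Set.Iio a) := by
      rw [← Set.Iio_union_right]
      refine (measure_union_le _ _).trans ?_
      rw [hν0, add_zero]
    refine le_trans ?_ e3
    refine ge_of_tendsto' e2 fun n => ?_
    have := (hsZ n).2.1
    rwa [(hsZ n).1, zero_sub, abs_neg, ← hνS _ measurableSet_Iic] at this
  have hb : ENNReal.ofReal |u 1| ≤ ν (Set.Ioi b) := by
    obtain ⟨s, hs, hsa, hsZ⟩ := exists_seq_tendsto_sSup hZn (OrderTop.bddAbove Z)
    have e1 : (⋂ n, Set.Ici (s n)) = Set.Ici b := by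
      ext x
      simp only [Set.mem_iInter, Set.mem_Ici]
      exact ⟨fun h => le_of_tendsto' hsa h, fun h n => (hs.ge_of_tendsto hsa n).trans h⟩
    have e2 := tendsto_measure_iInter_atTop (μ := ν) (s := fun n => Set.Ici (s n))
      (fun n => measurableSet_Ici.nullMeasurableSet)
      (fun n k hnk => Set.Ici_subset_Ici.2 (hs hnk)) ⟨0, measure_ne_top _ _⟩
    rw [e1] at e2
    have e3 : ν (Set.Ici b) ≤ ν (Set.Ioi b) := by
      rw [← Set.Ioi_union_left]
      refine (measure_union_le _ _).trans ?_
      rw [hν0, add_zero]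
    refine le_trans ?_ e3
    refine ge_of_tendsto' e2 fun n => ?_
    have := (hsZ n).2.2
    rwa [(hsZ n).1, sub_zero, ← hνS _ measurableSet_Ici] at this
  have hab : a ≤ b := by
    obtain ⟨t, ht⟩ := hZn
    exact (sInf_le ht).trans (le_sSup ht)
  have hdisj : Disjoint (Set.Iio a) (Set.Ioi b) :=
    Set.disjoint_left.2 fun x h1 h2 => (h1.trans_le hab).not_gt h2
  -- Almost every zero of u belongs to Z, hence to [a, b]; ν is absolutely continuous, so the
  -- exceptional zeros are ν-null.
  have hsub : ν (Set.Iio a ∪ Set.Ioi b) ≤ ν {t | u t ≠ 0} := by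
    refine measure_mono_ae ?_
    filter_upwards [(withDensity_absolutelyContinuous volume g).ae_le hae] with t ht hmem h
    have htZ := ht h
    rcases hmem with h1 | h1
    · exact (sInf_le htZ).not_gt h1
    · exact (le_sSup htZ).not_gt h1
  calc ENNReal.ofReal |u 1 - u 0| ≤ ENNReal.ofReal (|u 0| + |u 1|) := by
        refine ENNReal.ofReal_le_ofReal ?_
        rw [add_comm]
        exact abs_sub _ _
    _ = ENNReal.ofReal |u 0| + ENNReal.ofReal |u 1| :=
        ENNReal.ofReal_add (abs_nonneg _) (abs_nonneg _)
    _ ≤ ν (Set.Iio a) + ν (Set.Ioi b) := add_le_add ha hb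
    _ = ν (Set.Iio a ∪ Set.Ioi b) := (measure_union hdisj measurableSet_Ioi).symm
    _ ≤ ν {t | u t ≠ 0} := hsub
    _ = _ := hνS _ (hu (measurableSet_singleton 0).compl)

/-- Locality: an upper gradient of `f` can be replaced by `0` on `{f = 0}`. -/
lemma IsPlanGradient.indicator_ne_zero {f : M → ℝ} {G : M → ℝ≥0∞} (h : IsPlanGradient m f G)
    (hf : Measurable f) (hG : Measurable G)
    (hfin : ∀ π : Measure C(I, M), IsTestPlan m π →
      ∫⁻ γ, (∫⁻ t : I, G (γ t) * metricSpeed γ t) ∂π < ∞) :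
    IsPlanGradient m f ({x | f x ≠ 0}.indicator G) := by
  refine IsPlanGradient.of_ae_curve fun π hπ => ?_
  have := hπ.isProbabilityMeasure
  have mf : Measurable fun q : C(I, M) × I => f (q.1 q.2) := hf.comp measurable_uncurry_eval
  have mf' : ∀ a : I, Measurable fun q : C(I, M) × I => f (q.1 a) := fun a =>
    hf.comp ((measurable_eval a).comp measurable_fst)
  have h0 : ∀ᵐ γ ∂π, ∀ᵐ t : I, ENNReal.ofReal |f (γ t) - f (γ 0)| ≤
      ∫⁻ r in Set.Iic t, G (γ r) * metricSpeed γ r := by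
    -- For each fixed t the estimate on [0, t] holds for almost every curve; Fubini yields a single
    -- null set of curves outside of which it holds for almost all t.
    rw [Measure.ae_ae_comm]
    · refine Eventually.of_forall fun t => ?_
      have := h.ae_curve hf hG hπ (a := 0) (b := t) bot_le
      rwa [show Set.Icc (0 : I) t = Set.Iic t from Set.Icc_bot] at this
    · refine measurableSet_le ?_ ?_
      · exact (continuous_abs.measurable.comp (mf.sub (mf' 0))).ennreal_ofReal
      · exact measurable_setLIntegral_metricSpeed_prod hG (S := Set.Iic)
          (measurableSet_le measurable_snd measurable_fst)
  have h1 : ∀ᵐ γ ∂π, ∀ᵐ t : I, ENNReal.ofReal |f (γ 1) - f (γ t)| ≤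
      ∫⁻ r in Set.Ici t, G (γ r) * metricSpeed γ r := by
    rw [Measure.ae_ae_comm]
    · refine Eventually.of_forall fun t => ?_
      have := h.ae_curve hf hG hπ (a := t) (b := 1) le_top
      rwa [show Set.Icc t (1 : I) = Set.Ici t from Set.Icc_top] at this
    · refine measurableSet_le ?_ ?_
      · exact (continuous_abs.measurable.comp ((mf' 1).sub mf)).ennreal_ofReal
      · exact measurable_setLIntegral_metricSpeed_prod hG (S := Set.Ici)
          (measurableSet_le measurable_fst measurable_snd)
  have h01 := h.ae_curve hf hG hπ (a := 0) (b := 1) zero_le_one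
  have hf1 := ae_lt_top (measurable_lintegral_metricSpeed hG) (hfin π hπ).ne
  filter_upwards [h0, h1, h01, hf1] with γ h0 h1 h01 hf1
  have hmeas : Measurable fun t => f (γ t) := hf.comp (measurable_curve γ)
  rw [show Set.Icc (0 : I) 1 = Set.univ from Set.Icc_bot_top, setLIntegral_univ] at h01
  refine (ofReal_abs_sub_le_setLIntegral_ne_zero hmeas hf1.ne h0 h1 h01).trans (le_of_eq ?_)
  have hms : MeasurableSet {t | f (γ t) ≠ 0} := hmeas (measurableSet_singleton 0).compl
  rw [← lintegral_indicator hms]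
  refine lintegral_congr fun t => ?_
  by_cases ht : f (γ t) = 0 <;> simp [ht]

end PlanGradient

end

end MMS

namespace MMS

noncomputable section

/-! ## Minima of upper gradients, absolutely continuous curves -/

section Mixing

/-- For c < 1, the interval up to c is a countable intersection of intervals up to points d > c of a
countable dense subset of D. Thus intervals can be cut at times of D only, where the increments are
under control. -/
lemma borel_unitInterval_eq_generateFrom {D : Set I} (hD : Dense D) (hD1 : (1 : I) ∈ D) :
    borel I = MeasurableSpace.generateFrom (Set.Iic '' D) := by
  refine le_antisymm ?_ ?_
  · obtain ⟨D', hD'D, hD'c, hD'⟩ := hD.exists_countable_dense_subset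
    rw [borel_eq_generateFrom_Iic]
    refine MeasurableSpace.generateFrom_le ?_
    rintro _ ⟨c, rfl⟩
    rcases eq_or_lt_of_le (show c ≤ 1 from le_top) with rfl | hc
    · exact MeasurableSpace.measurableSet_generateFrom ⟨1, hD1, rfl⟩
    have : Set.Iic c = ⋂ d ∈ D' ∩ Set.Ioi c, Set.Iic d := by
      ext x
      simp only [Set.mem_Iic, Set.mem_iInter]
      refine ⟨fun h d hd => h.trans (le_of_lt hd.2), fun h => ?_⟩
      by_contra! hcx
      obtain ⟨d, hd, h1, h2⟩ := hD'.exists_between hcx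
      exact (h d ⟨hd, h1⟩).not_gt h2
    rw [this]
    refine MeasurableSet.biInter (hD'c.mono Set.inter_subset_left) fun d hd => ?_
    exact MeasurableSpace.measurableSet_generateFrom ⟨d, hD'D hd.1, rfl⟩
  · refine MeasurableSpace.generateFrom_le ?_
    rintro _ ⟨c, -, rfl⟩
    rw [← BorelSpace.measurable_eq (α := I)]
    exact measurableSet_Iic

/-- The increments of `u` between times in `D` are bounded by the integrals of `g`. -/
def IsSpeedBound (D : Set I) (u : I → ℝ) (g : I → ℝ≥0∞) : Prop :=
  Measurable g ∧ ∫⁻ t, g t ≠ ∞ ∧ ∀ s ∈ D, ∀ t ∈ D, s ≤ t →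
    ENNReal.ofReal |u t - u s| ≤ ∫⁻ r in Set.Ioc s t, g r

-- The sets over which any two bounds can be mixed form a σ-algebra: complements exchange the two
-- bounds, and countable unions are handled by limits. It contains the initial intervals ending in
-- D, since an increment can be split at such a time. The induction quantifies over both bounds, so
-- that a mixture can be mixed again.
open Classical in
lemma IsSpeedBound.piecewise {D : Set I} (hD : Dense D) (hD1 : (1 : I) ∈ D) {u : I → ℝ}
    {A : Set I} (hA : MeasurableSet A) {g₁ g₂ : I → ℝ≥0∞} (h₁ : IsSpeedBound D u g₁)
    (h₂ : IsSpeedBound D u g₂) : IsSpeedBound D u (A.piecewise g₁ g₂) := by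
  have key : ∀ A : Set I, MeasurableSet A → ∀ g₁ g₂ : I → ℝ≥0∞, IsSpeedBound D u g₁ →
      IsSpeedBound D u g₂ → Measurable (A.piecewise g₁ g₂) ∧ ∫⁻ t, A.piecewise g₁ g₂ t ≠ ∞ := by
    intro A hA g₁ g₂ h₁ h₂
    refine ⟨h₁.1.piecewise hA h₂.1, ne_top_of_le_ne_top
      (ENNReal.add_ne_top.2 ⟨h₁.2.1, h₂.2.1⟩) ?_⟩
    rw [← lintegral_add_left h₁.1]
    refine lintegral_mono fun t => ?_
    by_cases ht : t ∈ A
    · rw [Set.piecewise_eq_of_mem _ _ _ ht]; exact le_self_add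
    · rw [Set.piecewise_eq_of_notMem _ _ _ ht]; exact le_add_self
  have hB : MeasurableSpace.generateFrom (Set.Iic '' D) = (inferInstance : MeasurableSpace I) := by
    rw [← borel_unitInterval_eq_generateFrom hD hD1]
    exact BorelSpace.measurable_eq.symm
  have main : ∀ A, MeasurableSet[MeasurableSpace.generateFrom (Set.Iic '' D)] A →
      ∀ g₁ g₂ : I → ℝ≥0∞, IsSpeedBound D u g₁ →
      IsSpeedBound D u g₂ → IsSpeedBound D u (A.piecewise g₁ g₂) := by
    refine MeasurableSpace.generateFrom_induction _ (fun A _ => ∀ g₁ g₂ : I → ℝ≥0∞,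
      IsSpeedBound D u g₁ → IsSpeedBound D u g₂ → IsSpeedBound D u (A.piecewise g₁ g₂))
      ?_ ?_ ?_ ?_
    · rintro _ ⟨c, hc, rfl⟩ - g₁ g₂ h₁ h₂
      obtain ⟨A, hAc⟩ : ∃ A, A = Set.Iic c := ⟨_, rfl⟩
      rw [← hAc]
      obtain ⟨k1, k2⟩ := key A (hAc ▸ measurableSet_Iic) g₁ g₂ h₁ h₂
      have e1 : ∀ s t, t ≤ c → ∫⁻ r in Set.Ioc s t, A.piecewise g₁ g₂ r =
          ∫⁻ r in Set.Ioc s t, g₁ r := fun s t htc =>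
        setLIntegral_congr_fun measurableSet_Ioc fun r hr =>
          Set.piecewise_eq_of_mem _ _ _ (hAc ▸ hr.2.trans htc)
      have e2 : ∀ s t, c ≤ s → ∫⁻ r in Set.Ioc s t, A.piecewise g₁ g₂ r =
          ∫⁻ r in Set.Ioc s t, g₂ r := fun s t hcs =>
        setLIntegral_congr_fun measurableSet_Ioc fun r hr =>
          Set.piecewise_eq_of_notMem _ _ _ (hAc ▸
            fun h => (lt_of_le_of_lt hcs hr.1).not_ge h)
      refine ⟨k1, k2, fun s hs t ht hst => ?_⟩
      rcases le_total t c with htc | hct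
      · rw [e1 s t htc]; exact h₁.2.2 s hs t ht hst
      rcases le_total c s with hcs | hsc
      · rw [e2 s t hcs]; exact h₂.2.2 s hs t ht hst
      -- The cut c lies between s and t and belongs to D, so g₁ bounds the increment before c and g₂
      -- the one after it.
      rw [← Set.Ioc_union_Ioc_eq_Ioc hsc hct, lintegral_union measurableSet_Ioc
        (Set.Ioc_disjoint_Ioc_of_le le_rfl), e1 s c le_rfl, e2 c t le_rfl, add_comm]
      calc ENNReal.ofReal |u t - u s| ≤ ENNReal.ofReal (|u t - u c| + |u c - u s|) :=
            ENNReal.ofReal_le_ofReal (abs_sub_le _ _ _)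
        _ = ENNReal.ofReal |u t - u c| + ENNReal.ofReal |u c - u s| :=
            ENNReal.ofReal_add (abs_nonneg _) (abs_nonneg _)
        _ ≤ _ := add_le_add (h₂.2.2 c hc t ht hct) (h₁.2.2 s hs c hc hsc)
    · intro g₁ g₂ _ h₂
      rwa [Set.piecewise_empty]
    · intro A _ hA g₁ g₂ h₁ h₂
      rw [Set.piecewise_compl]
      exact hA g₂ g₁ h₂ h₁
    · intro A hAm hA g₁ g₂ h₁ h₂
      rw [hB] at hAm
      have hacc : ∀ n : ℕ, IsSpeedBound D u ((⋃ i < n, A i).piecewise g₁ g₂) := by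
        intro n
        induction n with
        | zero =>
          have : (⋃ i < 0, A i) = ∅ := by simp
          rw [this, Set.piecewise_empty]
          exact h₂
        -- No disjointness is needed: the mixture over the first n + 1 sets is g₁ on the last of
        -- them and the previous mixture elsewhere.
        | succ n ih =>
          have : (⋃ i < n + 1, A i).piecewise g₁ g₂ =
              (A n).piecewise g₁ ((⋃ i < n, A i).piecewise g₁ g₂) := by
            rw [Set.biUnion_lt_succ]
            funext x
            by_cases h1 : x ∈ A n <;> by_cases h2 : x ∈ ⋃ i < n, A i <;>
              simp [Set.piecewise, h1, h2]
          rw [this]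
          exact hA n _ _ h₁ ih
      obtain ⟨k1, k2⟩ := key (⋃ i, A i) (MeasurableSet.iUnion hAm) g₁ g₂ h₁ h₂
      refine ⟨k1, k2, fun s hs t ht hst => ?_⟩
      -- Dominated convergence with the integrable majorant g₁ + g₂; pointwise the mixtures are
      -- eventually constant.
      have hlim : Tendsto (fun n : ℕ => ∫⁻ r in Set.Ioc s t, (⋃ i < n, A i).piecewise g₁ g₂ r)
          atTop (𝓝 (∫⁻ r in Set.Ioc s t, (⋃ i, A i).piecewise g₁ g₂ r)) := by
        refine tendsto_lintegral_of_dominated_convergence (fun r => g₁ r + g₂ r)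
          (fun n => (hacc n).1) (fun n => Eventually.of_forall fun r => ?_) ?_
          (Eventually.of_forall fun r => ?_)
        · by_cases hr : r ∈ ⋃ i < n, A i
          · rw [Set.piecewise_eq_of_mem _ _ _ hr]; exact le_self_add
          · rw [Set.piecewise_eq_of_notMem _ _ _ hr]; exact le_add_self
        · refine ne_top_of_le_ne_top (ENNReal.add_ne_top.2 ⟨h₁.2.1, h₂.2.1⟩) ?_
          rw [← lintegral_add_left h₁.1]
          exact setLIntegral_le_lintegral _ _
        · refine tendsto_const_nhds.congr' ?_
          by_cases hr : r ∈ ⋃ i, A i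
          · obtain ⟨i, hi⟩ := Set.mem_iUnion.1 hr
            filter_upwards [eventually_gt_atTop i] with n hn
            rw [Set.piecewise_eq_of_mem _ _ _ hr, Set.piecewise_eq_of_mem]
            exact Set.mem_iUnion₂.2 ⟨i, hn, hi⟩
          · filter_upwards with n
            rw [Set.piecewise_eq_of_notMem _ _ _ hr, Set.piecewise_eq_of_notMem]
            intro h
            obtain ⟨i, -, hi⟩ := Set.mem_iUnion₂.1 h
            exact hr (Set.mem_iUnion.2 ⟨i, hi⟩)
      exact ge_of_tendsto' hlim fun n => (hacc n).2.2 s hs t ht hst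
  exact main A (by rwa [hB]) g₁ g₂ h₁ h₂

lemma IsSpeedBound.min {D : Set I} (hD : Dense D) (hD1 : (1 : I) ∈ D) {u : I → ℝ}
    {g₁ g₂ : I → ℝ≥0∞} (h₁ : IsSpeedBound D u g₁) (h₂ : IsSpeedBound D u g₂) :
    IsSpeedBound D u fun t => min (g₁ t) (g₂ t) := by
  classical
  have h := h₁.piecewise hD hD1 (measurableSet_le h₁.1 h₂.1) h₂
  convert h using 1
  funext t
  simp only [Set.piecewise, Set.mem_ofPred_eq]
  split_ifs with ht
  · exact min_eq_left ht
  · exact min_eq_right (le_of_not_ge ht)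

variable {M : Type*} [MetricSpace M] [SecondCountableTopology M] [MeasurableSpace M]
  [BorelSpace M] {m : Measure M}

/-- `IsPlanGradient.ae_curve` has an exceptional null set for each pair of times, so countably many
pairs can be treated at once. -/
lemma IsPlanGradient.ae_isSpeedBound {f : M → ℝ} {G : M → ℝ≥0∞} (h : IsPlanGradient m f G)
    (hf : Measurable f) (hG : Measurable G) {π : Measure C(I, M)} (hπ : IsTestPlan m π)
    (hfin : ∫⁻ γ, (∫⁻ t : I, G (γ t) * metricSpeed γ t) ∂π < ∞) {D : Set I} (hD : D.Countable) :
    ∀ᵐ γ ∂π, IsSpeedBound D (fun t => f (γ t)) fun t => G (γ t) * metricSpeed γ t := by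
  have h1 : ∀ᵐ γ ∂π, ∀ s ∈ D, ∀ t ∈ D, s ≤ t → ENNReal.ofReal |f (γ t) - f (γ s)| ≤
      ∫⁻ r in Set.Ioc s t, G (γ r) * metricSpeed γ r := by
    refine (ae_ball_iff hD).2 fun s _ => (ae_ball_iff hD).2 fun t _ => ?_
    by_cases hst : s ≤ t
    · filter_upwards [h.ae_curve hf hG hπ hst] with γ hγ _
      rwa [setLIntegral_congr Ioc_ae_eq_Icc]
    · exact Eventually.of_forall fun γ h => absurd h hst
  filter_upwards [h1, ae_lt_top (measurable_lintegral_metricSpeed hG) hfin.ne] with γ h1 h2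
  exact ⟨measurable_mul_metricSpeed_right hG γ, h2.ne, h1⟩

/-- The minimum is formed along each curve separately, where the region in which one gradient is
smaller becomes a Borel set of times. The countable dense set of times has to contain 0 and 1. -/
lemma IsPlanGradient.min {f : M → ℝ} {G₁ G₂ : M → ℝ≥0∞} (h₁ : IsPlanGradient m f G₁)
    (h₂ : IsPlanGradient m f G₂) (hf : Measurable f) (hG₁ : Measurable G₁) (hG₂ : Measurable G₂)
    (hfin₁ : ∀ π : Measure C(I, M), IsTestPlan m π →
      ∫⁻ γ, (∫⁻ t : I, G₁ (γ t) * metricSpeed γ t) ∂π < ∞)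
    (hfin₂ : ∀ π : Measure C(I, M), IsTestPlan m π →
      ∫⁻ γ, (∫⁻ t : I, G₂ (γ t) * metricSpeed γ t) ∂π < ∞) :
    IsPlanGradient m f fun x => min (G₁ x) (G₂ x) := by
  refine IsPlanGradient.of_ae_curve fun π hπ => ?_
  obtain ⟨D, hDc, hD, hD0, hD1⟩ := exists_countable_dense_bot_top I
  filter_upwards [h₁.ae_isSpeedBound hf hG₁ hπ (hfin₁ π hπ) hDc,
    h₂.ae_isSpeedBound hf hG₂ hπ (hfin₂ π hπ) hDc] with γ k₁ k₂
  have h := (k₁.min hD (hD1 1 isTop_top) k₂).2.2 0 (hD0 0 isBot_bot) 1 (hD1 1 isTop_top)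
    zero_le_one
  refine h.trans ((setLIntegral_le_lintegral _ _).trans (lintegral_mono fun t => ?_))
  rw [min_mul_of_nonneg _ _ zero_le]

end Mixing

/-! ### Length of absolutely continuous curves and upper gradients of Lipschitz functions. -/

section AbsolutelyContinuous

variable {M : Type*} [MetricSpace M]

/-- The increments of ρ are dominated by those of the primitive of f, whose absolute continuity is
thus inherited. -/
lemma absolutelyContinuousOnInterval_of_dist_le {ρ f : ℝ → ℝ} (hf : IntegrableOn f (Set.Icc 0 1))
    (h : ∀ s ∈ Set.Icc (0 : ℝ) 1, ∀ t ∈ Set.Icc (0 : ℝ) 1, s ≤ t →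
      |ρ t - ρ s| ≤ ∫ r in s..t, f r) :
    AbsolutelyContinuousOnInterval ρ 0 1 := by
  have hfi : IntervalIntegrable f volume 0 1 :=
    (intervalIntegrable_iff_integrableOn_Icc_of_le zero_le_one).2 hf
  have h1 := hfi.absolutelyContinuousOnInterval_intervalIntegral (c := 0) (by simp)
  rw [absolutelyContinuousOnInterval_iff] at h1 ⊢
  intro ε hε
  obtain ⟨δ, hδ, H⟩ := h1 ε hε
  refine ⟨δ, hδ, fun E hE hEδ => lt_of_le_of_lt (Finset.sum_le_sum fun i hi => ?_) (H E hE hEδ)⟩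
  obtain ⟨e1, e2⟩ := hE.1 i hi
  rw [Set.uIcc_of_le zero_le_one] at e1 e2
  have hsub : ∀ s ∈ Set.Icc (0 : ℝ) 1, IntervalIntegrable f volume 0 s := fun s hs =>
    hfi.mono_set (by rw [Set.uIcc_of_le zero_le_one, Set.uIcc_of_le hs.1]
                     exact Set.Icc_subset_Icc_right hs.2)
  rw [Real.dist_eq, Real.dist_eq]
  rcases le_total (E.2 i).1 (E.2 i).2 with hle | hle
  · rw [abs_sub_comm, abs_sub_comm (∫ r in _..(E.2 i).1, f r),
      intervalIntegral.integral_interval_sub_left (hsub _ e2) (hsub _ e1)]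
    exact (h _ e1 _ e2 hle).trans (le_abs_self _)
  · rw [intervalIntegral.integral_interval_sub_left (hsub _ e1) (hsub _ e2)]
    exact (h _ e2 _ e1 hle).trans (le_abs_self _)

/-- The length of an absolutely continuous curve bounds the distance of its end points. -/
lemma IsACCurve.edist_le {γ : C(I, M)} (hγ : IsACCurve γ) :
    edist (γ 0) (γ 1) ≤ ∫⁻ t, metricSpeed γ t := by
  obtain ⟨f, hf, hd⟩ := hγ
  set p : ℝ → I := Set.projIcc 0 1 zero_le_one with hp
  -- The distance to the initial point reduces the claim to the fundamental theorem of calculus for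
  -- a real function: ρ increases from 0 to d(γ_0, γ_1), and |ρ'| is at most the metric speed.
  set ρ : ℝ → ℝ := fun t => dist (γ (p t)) (γ 0) with hρ
  have hρ' : ∀ s t, |ρ t - ρ s| ≤ dist (γ (p t)) (γ (p s)) := fun s t =>
    abs_dist_sub_le _ _ _
  have hAC : AbsolutelyContinuousOnInterval ρ 0 1 := by
    refine absolutelyContinuousOnInterval_of_dist_le hf fun s hs t ht hst => ?_
    refine (hρ' s t).trans ?_
    have := hd (p s) (p t) (Set.monotone_projIcc _ hst)
    rw [hp, Set.projIcc_of_mem _ hs, Set.projIcc_of_mem _ ht] at this ⊢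
    exact this
  have hFTC := hAC.integral_deriv_eq_sub
  have h0 : ρ 0 = 0 := by simp [hρ, hp]
  have h1 : ρ 1 = dist (γ 0) (γ 1) := by
    rw [dist_comm]
    simp [hρ, hp]
  -- Where ρ is differentiable, its difference quotients converge and each is dominated by the
  -- difference quotient of γ, whose upper limit is the speed.
  have hspeed : ∀ᵐ x ∂(volume.restrict (Set.Ioo (0 : ℝ) 1)),
      ENNReal.ofReal |deriv ρ x| ≤ metricSpeed γ (p x) := by
    rw [ae_restrict_iff' measurableSet_Ioo]
    filter_upwards [hAC.ae_differentiableAt] with x hx hxI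
    have hxI' : x ∈ Set.Icc (0 : ℝ) 1 := Set.Ioo_subset_Icc_self hxI
    have hder := (hx (by rwa [Set.uIcc_of_le zero_le_one])).hasDerivAt
    rw [hasDerivAt_iff_tendsto_slope] at hder
    have hmap : Tendsto ((↑) : I → ℝ) (𝓝[≠] (p x)) (𝓝[≠] x) := by
      refine tendsto_nhdsWithin_of_tendsto_nhds_of_eventually_within _ ?_ ?_
      · have : Tendsto ((↑) : I → ℝ) (𝓝 (p x)) (𝓝 (p x : ℝ)) :=
          continuous_subtype_val.continuousAt
        rw [hp, Set.projIcc_of_mem _ hxI'] at this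
        rw [hp, Set.projIcc_of_mem _ hxI']
        exact this.mono_left nhdsWithin_le_nhds
      · filter_upwards [self_mem_nhdsWithin] with s hs hsx
        refine hs (Subtype.ext ?_)
        rw [hp, Set.projIcc_of_mem _ hxI']
        exact hsx
    have hne : NeBot (𝓝[≠] (p x)) := inferInstance
    have hlim : Tendsto (fun s : I => ENNReal.ofReal |slope ρ x s|) (𝓝[≠] (p x))
        (𝓝 (ENNReal.ofReal |deriv ρ x|)) :=
      ENNReal.tendsto_ofReal ((hder.comp hmap).abs)
    rw [← hlim.limsup_eq, metricSpeed]
    refine limsup_le_limsup ?_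
    filter_upwards [self_mem_nhdsWithin] with s hs
    have hsx : (s : ℝ) - x ≠ 0 := by
      intro h
      refine hs (Subtype.ext ?_)
      rw [hp, Set.projIcc_of_mem _ hxI']
      exact sub_eq_zero.1 h
    rw [slope_def_field, abs_div, ENNReal.ofReal_div_of_pos (abs_pos.2 hsx), edist_dist,
      edist_dist]
    have e1 : dist s (p x) = |(s : ℝ) - x| := by
      rw [Subtype.dist_eq, hp, Set.projIcc_of_mem _ hxI', Real.dist_eq]
    rw [e1]
    gcongr
    have := hρ' x s
    rwa [show p s = s from Set.projIcc_val _ s] at this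
  have hI : ∫⁻ t, metricSpeed γ t = ∫⁻ x in Set.Icc (0 : ℝ) 1, metricSpeed γ (p x) := by
    rw [← setLIntegral_univ, setLIntegral_unitInterval, Set.image_univ, Subtype.range_coe]
  rw [hI, edist_dist, ← h1, show ρ 1 = ρ 1 - ρ 0 by rw [h0, sub_zero], ← hFTC,
    intervalIntegral.integral_of_le zero_le_one, setLIntegral_congr Ioo_ae_eq_Icc.symm,
    integral_Ioc_eq_integral_Ioo]
  calc ENNReal.ofReal (∫ x in Set.Ioo (0 : ℝ) 1, deriv ρ x)
      ≤ ENNReal.ofReal ‖∫ x in Set.Ioo (0 : ℝ) 1, deriv ρ x‖ :=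
        ENNReal.ofReal_le_ofReal (le_abs_self _)
    _ = ‖∫ x in Set.Ioo (0 : ℝ) 1, deriv ρ x‖ₑ := ofReal_norm _
    _ ≤ ∫⁻ x in Set.Ioo (0 : ℝ) 1, ‖deriv ρ x‖ₑ := enorm_integral_le_lintegral_enorm _
    _ ≤ _ := by
      refine lintegral_mono_ae ?_
      filter_upwards [hspeed] with x hx
      rwa [← ofReal_norm]

variable [SecondCountableTopology M] [MeasurableSpace M] [BorelSpace M] {m : Measure M}

/-- Curves violating the inequality are not absolutely continuous, so their energy is infinite; a
set of such curves of positive measure would contradict finite energy. Only this exceptional set has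
to be measurable, not the set of absolutely continuous curves. -/
lemma IsTestPlan.ae_edist_le {π : Measure C(I, M)} (hπ : IsTestPlan m π) :
    ∀ᵐ γ ∂π, edist (γ 0) (γ 1) ≤ ∫⁻ t, metricSpeed γ t := by
  set B : Set C(I, M) := {γ | ∫⁻ t, metricSpeed γ t < edist (γ 0) (γ 1)}
  have hm : Measurable fun γ : C(I, M) => ∫⁻ t, metricSpeed γ t := by
    simpa using measurable_lintegral_metricSpeed (M := M) (G := fun _ => 1) measurable_const
  have hB : MeasurableSet B := measurableSet_lt hm
    (Continuous.measurable (by fun_prop))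
  have hB0 : π B = 0 := by
    by_contra h0
    have h1 : ∫⁻ γ, B.indicator (fun _ => ∞) γ ∂π ≤ ∫⁻ γ, kineticEnergy γ ∂π := by
      refine lintegral_mono fun γ => ?_
      by_cases hγ : γ ∈ B
      · have : ¬ IsACCurve γ := fun h => (h.edist_le).not_gt hγ
        rw [kineticEnergy, if_neg this]
        exact le_top
      · simp [hγ]
    rw [lintegral_indicator_const hB, ENNReal.top_mul h0] at h1
    exact (h1.trans_lt hπ.finite_energy).ne rfl
  filter_upwards [measure_eq_zero_iff_ae_notMem.1 hB0] with γ hγ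
  exact not_lt.1 hγ

/-- The increment of f is at most K times the distance of the end points, which is at most the
length for almost every curve. -/
lemma isPlanGradient_of_lipschitzWith {f : M → ℝ} {K : ℝ≥0} (hf : LipschitzWith K f) :
    IsPlanGradient m f fun _ => (K : ℝ≥0∞) := by
  refine IsPlanGradient.of_ae_curve (G := fun _ => (K : ℝ≥0∞)) fun π hπ => ?_
  have hm : ∀ γ : C(I, M), Measurable fun t => metricSpeed γ t := fun γ => by
    simpa using measurable_mul_metricSpeed_right (G := fun _ => 1) measurable_const γ
  have h1 : ∀ x y : M, ENNReal.ofReal |f x - f y| ≤ K * edist y x := fun x y => by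
    have := hf x y
    rwa [edist_dist, Real.dist_eq, edist_comm] at this
  filter_upwards [hπ.ae_edist_le] with γ hγ
  rw [lintegral_const_mul (K : ℝ≥0∞) (hm γ)]
  exact (h1 _ _).trans (mul_le_mul' le_rfl hγ)

/-- A Lipschitz function has its Lipschitz constant, restricted to the set where the function does
not vanish, as an upper gradient. -/
lemma isPlanGradient_indicator_of_lipschitzWith {f : M → ℝ} {K : ℝ≥0} (hf : LipschitzWith K f) :
    IsPlanGradient m f ({x | f x ≠ 0}.indicator fun _ => (K : ℝ≥0∞)) := by
  refine IsPlanGradient.indicator_ne_zero (isPlanGradient_of_lipschitzWith hf)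
    hf.continuous.measurable measurable_const fun π hπ => ?_
  have := hπ.isProbabilityMeasure
  refine hπ.lintegral_mul_metricSpeed_lt_top (H := fun _ => (K : ℝ≥0∞)) measurable_const ?_
  simp only [lintegral_const, measure_univ, mul_one]
  exact ENNReal.pow_lt_top ENNReal.coe_lt_top

end AbsolutelyContinuous

end

end MMS

namespace MMS

noncomputable section

/-! ## Weak upper gradients -/

section WeakUpperGradient

variable {M : Type*} [MeasurableSpace M] {m : Measure M}

lemma lintegral_enorm_sq (G : Lp ℝ 2 m) : ∫⁻ x, ‖G x‖ₑ ^ 2 ∂m = ENNReal.ofReal ‖G‖ ^ 2 := by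
  rw [ofReal_norm, Lp.enorm_def, eLpNorm_eq_lintegral_rpow_enorm_toReal (by simp) (by simp),
    ← ENNReal.rpow_natCast, ← ENNReal.rpow_mul]
  simp

lemma lintegral_ofReal_sq_le (G : Lp ℝ 2 m) :
    ∫⁻ x, ENNReal.ofReal (G x) ^ 2 ∂m ≤ ENNReal.ofReal ‖G‖ ^ 2 := by
  rw [← lintegral_enorm_sq]
  refine lintegral_mono fun x => ?_
  gcongr
  exact Real.ofReal_le_enorm _

lemma measurable_ofReal_coeFn (G : Lp ℝ 2 m) : Measurable fun x => ENNReal.ofReal (G x) :=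
  (Lp.stronglyMeasurable G).measurable.ennreal_ofReal

lemma exists_subseq_tendsto_ae {p : ℝ≥0∞} [Fact (1 ≤ p)] {f : ℕ → Lp ℝ p m} {f₀ : Lp ℝ p m}
    (h : Tendsto f atTop (𝓝 f₀)) :
    ∃ ns : ℕ → ℕ, StrictMono ns ∧ ∀ᵐ x ∂m, Tendsto (fun i => f (ns i) x) atTop (𝓝 (f₀ x)) :=
  (tendstoInMeasure_of_tendsto_Lp h).exists_seq_tendsto_ae

variable [MetricSpace M] [SecondCountableTopology M] [BorelSpace M]

lemma IsTestPlan.lintegral_ofReal_Lp_lt_top {π : Measure C(I, M)} (hπ : IsTestPlan m π)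
    (G : Lp ℝ 2 m) :
    ∫⁻ γ, (∫⁻ t : I, ENNReal.ofReal (G (γ t)) * metricSpeed γ t) ∂π < ∞ := by
  obtain ⟨C, hC⟩ := hπ.exists_lintegral_eval_le
  refine hπ.lintegral_mul_metricSpeed_lt_top (measurable_ofReal_coeFn G) ?_
  refine ((hC _ ((measurable_ofReal_coeFn G).pow_const 2)).2).trans_lt
    (ENNReal.mul_lt_top ENNReal.coe_lt_top ((lintegral_ofReal_sq_le G).trans_lt ?_))
  exact ENNReal.pow_lt_top ENNReal.ofReal_lt_top

lemma IsPlanGradient.mono_ae {f : M → ℝ} {G H : M → ℝ≥0∞} (h : IsPlanGradient m f G)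
    (hGH : ∀ᵐ x ∂m, G x ≤ H x) : IsPlanGradient m f H := fun π hπ => by
  refine (h π hπ).trans (lintegral_mono_ae ?_)
  filter_upwards [hπ.ae_ae_eval hGH] with γ hγ
  refine lintegral_mono_ae ?_
  filter_upwards [hγ] with t ht
  exact mul_le_mul' ht le_rfl

lemma IsWeakUpperGradient.isPlanGradient {f : M →ₘ[m] ℝ} {G : Lp ℝ 2 m}
    (h : IsWeakUpperGradient f G) : IsPlanGradient m f fun x => ENNReal.ofReal (G x) := h.2

lemma IsWeakUpperGradient.of_le {f : M →ₘ[m] ℝ} {G : M → ℝ≥0∞} (h : IsPlanGradient m f G)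
    {H : Lp ℝ 2 m} (hH : 0 ≤ H) (hGH : ∀ᵐ x ∂m, G x ≤ ENNReal.ofReal (H x)) :
    IsWeakUpperGradient f H :=
  ⟨hH, h.mono_ae hGH⟩

lemma IsWeakUpperGradient.mono {f : M →ₘ[m] ℝ} {G H : Lp ℝ 2 m} (h : IsWeakUpperGradient f G)
    (hGH : G ≤ H) : IsWeakUpperGradient f H := by
  refine IsWeakUpperGradient.of_le h.isPlanGradient (h.1.trans hGH) ?_
  filter_upwards [(Lp.coeFn_le _ _).2 hGH] with x hx
  exact ENNReal.ofReal_le_ofReal hx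

lemma IsWeakUpperGradient.inf {f : M →ₘ[m] ℝ} {G H : Lp ℝ 2 m} (hG : IsWeakUpperGradient f G)
    (hH : IsWeakUpperGradient f H) : IsWeakUpperGradient f (G ⊓ H) := by
  refine IsWeakUpperGradient.of_le (hG.isPlanGradient.min hH.isPlanGradient f.measurable
    (measurable_ofReal_coeFn G) (measurable_ofReal_coeFn H)
    (fun π hπ => hπ.lintegral_ofReal_Lp_lt_top G) (fun π hπ => hπ.lintegral_ofReal_Lp_lt_top H))
    (le_inf hG.1 hH.1) ?_
  filter_upwards [Lp.coeFn_inf G H] with x hx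
  rw [hx]
  rcases le_total (G x) (H x) with h | h
  · simp [h]
  · simp [h]

/-- Weak upper gradients are stable under a.e. convergence of the functions and `L²`-convergence of
the gradients. -/
lemma IsWeakUpperGradient.of_tendsto {f : ℕ → M →ₘ[m] ℝ} {f₀ : M →ₘ[m] ℝ} {G : ℕ → Lp ℝ 2 m}
    {G₀ : Lp ℝ 2 m} (h : ∀ n, IsWeakUpperGradient (f n) (G n))
    (hf : ∀ᵐ x ∂m, Tendsto (fun n => f n x) atTop (𝓝 (f₀ x))) (hG : Tendsto G atTop (𝓝 G₀)) :
    IsWeakUpperGradient f₀ G₀ := by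
  refine ⟨ge_of_tendsto' hG fun n => (h n).1, fun π hπ => ?_⟩
  have := hπ.isProbabilityMeasure
  obtain ⟨C, hC⟩ := hπ.exists_lintegral_eval_le
  set E := ∫⁻ γ, (∫⁻ t : I, metricSpeed γ t ^ 2) ∂π with hE
  have hEtop : E < ∞ := hπ.lintegral_metricSpeed_sq_lt_top
  -- Replacing G_n by G₀ costs an error that the Cauchy-Schwarz inequality on π × dt and bounded
  -- compression control by ‖G_n - G₀‖ times the square root of the energy.
  have h1 : ∀ n, ∫⁻ γ, ENNReal.ofReal |f n (γ 1) - f n (γ 0)| ∂π ≤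
      (∫⁻ γ, (∫⁻ t : I, ENNReal.ofReal (G₀ (γ t)) * metricSpeed γ t) ∂π) +
        (C * ENNReal.ofReal ‖G n - G₀‖ ^ 2) ^ (1 / 2 : ℝ) * E ^ (1 / 2 : ℝ) := fun n => by
    refine ((h n).2 π hπ).trans ?_
    have h2 : ∀ᵐ x ∂m, ENNReal.ofReal (G n x) ≤
        ENNReal.ofReal (G₀ x) + ENNReal.ofReal ((G n - G₀ : Lp ℝ 2 m) x) := by
      filter_upwards [Lp.coeFn_sub (G n) G₀] with x hx
      rw [hx, Pi.sub_apply]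
      calc ENNReal.ofReal (G n x) = ENNReal.ofReal (G₀ x + (G n x - G₀ x)) := by ring_nf
        _ ≤ _ := ENNReal.ofReal_add_le
    calc ∫⁻ γ, (∫⁻ t : I, ENNReal.ofReal (G n (γ t)) * metricSpeed γ t) ∂π
        ≤ ∫⁻ γ, ((∫⁻ t : I, ENNReal.ofReal (G₀ (γ t)) * metricSpeed γ t) +
          ∫⁻ t : I, ENNReal.ofReal ((G n - G₀ : Lp ℝ 2 m) (γ t)) * metricSpeed γ t) ∂π := by
          refine lintegral_mono_ae ?_
          filter_upwards [hπ.ae_ae_eval h2] with γ hγ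
          rw [← lintegral_add_left
            (measurable_mul_metricSpeed_right (measurable_ofReal_coeFn G₀) γ)]
          refine lintegral_mono_ae ?_
          filter_upwards [hγ] with t ht
          rw [← add_mul]
          exact mul_le_mul' ht le_rfl
      _ = (∫⁻ γ, (∫⁻ t : I, ENNReal.ofReal (G₀ (γ t)) * metricSpeed γ t) ∂π) +
          ∫⁻ γ, (∫⁻ t : I, ENNReal.ofReal ((G n - G₀ : Lp ℝ 2 m) (γ t)) * metricSpeed γ t) ∂π :=
          lintegral_add_left (measurable_lintegral_metricSpeed (measurable_ofReal_coeFn G₀)) _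
      _ ≤ _ := by
          gcongr
          refine (lintegral_mul_metricSpeed_le π
            (measurable_ofReal_coeFn (G n - G₀ : Lp ℝ 2 m))).trans ?_
          gcongr
          refine ((hC _ ((measurable_ofReal_coeFn _).pow_const 2)).2).trans ?_
          gcongr
          exact lintegral_ofReal_sq_le _
  have h2 : Tendsto (fun n => (∫⁻ γ, (∫⁻ t : I, ENNReal.ofReal (G₀ (γ t)) * metricSpeed γ t) ∂π) +
        (C * ENNReal.ofReal ‖G n - G₀‖ ^ 2) ^ (1 / 2 : ℝ) * E ^ (1 / 2 : ℝ)) atTop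
      (𝓝 (∫⁻ γ, (∫⁻ t : I, ENNReal.ofReal (G₀ (γ t)) * metricSpeed γ t) ∂π)) := by
    have e1 : Tendsto (fun n => ENNReal.ofReal ‖G n - G₀‖) atTop (𝓝 0) := by
      have := ENNReal.tendsto_ofReal (tendsto_iff_norm_sub_tendsto_zero.1 hG)
      simpa using this
    have e2 : Tendsto (fun n => (C : ℝ≥0∞) * ENNReal.ofReal ‖G n - G₀‖ ^ 2) atTop (𝓝 0) := by
      have := ENNReal.Tendsto.const_mul (ENNReal.Tendsto.pow (n := 2) e1)
        (Or.inr (ENNReal.coe_ne_top (r := C)))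
      simpa using this
    have e3 : Tendsto (fun n => ((C : ℝ≥0∞) * ENNReal.ofReal ‖G n - G₀‖ ^ 2) ^ (1 / 2 : ℝ)) atTop
        (𝓝 0) := by
      have := e2.ennrpow_const (1 / 2 : ℝ)
      rwa [ENNReal.zero_rpow_of_pos (by norm_num)] at this
    have e4 := ENNReal.Tendsto.mul_const e3 (Or.inr
      (ENNReal.rpow_lt_top_of_nonneg (y := (1 / 2 : ℝ)) (by norm_num) hEtop.ne).ne)
    rw [zero_mul] at e4
    simpa using e4.const_add (∫⁻ γ, (∫⁻ t : I, ENNReal.ofReal (G₀ (γ t)) * metricSpeed γ t) ∂π)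
  -- Almost every curve has both end points in the set of convergence, so the left side passes to
  -- the limit by Fatou's lemma.
  have h3 : ∫⁻ γ, ENNReal.ofReal |f₀ (γ 1) - f₀ (γ 0)| ∂π ≤
      ∫⁻ γ, liminf (fun n => ENNReal.ofReal |f n (γ 1) - f n (γ 0)|) atTop ∂π := by
    refine lintegral_mono_ae ?_
    filter_upwards [hπ.ae_eval hf 1, hπ.ae_eval hf 0] with γ g1 g0
    exact (ENNReal.tendsto_ofReal ((g1.sub g0).abs)).liminf_eq.ge
  refine h3.trans ((lintegral_liminf_le fun n =>
    measurable_ofReal_abs_sub (f n).measurable 0 1).trans ?_)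
  rw [← h2.liminf_eq]
  exact liminf_le_liminf (Eventually.of_forall h1)

lemma norm_sq_add_norm_sub_sq_le {H K : Lp ℝ 2 m} (hH : 0 ≤ H) (hHK : H ≤ K) :
    ‖H‖ ^ 2 + ‖K - H‖ ^ 2 ≤ ‖K‖ ^ 2 := by
  have hin : 0 ≤ inner ℝ H (K - H) := by
    rw [L2.inner_def]
    refine integral_nonneg_of_ae ?_
    filter_upwards [(Lp.coeFn_nonneg H).2 hH, (Lp.coeFn_nonneg (K - H)).2 (sub_nonneg.2 hHK)]
      with x h1 h2
    exact mul_nonneg h2 h1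
  have := norm_add_sq_real H (K - H)
  rw [add_sub_cancel] at this
  linarith

/-- The minimal weak upper gradient is a weak upper gradient. -/
lemma isWeakUpperGradient_weakGrad (f : sobolevClass m) :
    IsWeakUpperGradient (f : M →ₘ[m] ℝ) (weakGrad f) := by
  set S : Set (Lp ℝ 2 m) := {G | IsWeakUpperGradient (f : M →ₘ[m] ℝ) G}
  have hne : S.Nonempty := f.2
  have hcl : IsClosed S := by
    refine IsSeqClosed.isClosed fun G G₀ hG hlim => ?_
    exact IsWeakUpperGradient.of_tendsto (f := fun _ => (f : M →ₘ[m] ℝ)) (G := G) hG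
      (Eventually.of_forall fun x => tendsto_const_nhds) hlim
  have hconv : Convex ℝ S := fun G hG H hH a b ha hb hab => by
    refine IsWeakUpperGradient.comb hG hH ha hb fun π hπ => Eventually.of_forall fun γ => ?_
    rw [← add_mul, hab, one_mul]
  -- The weak upper gradients form a closed convex set, which has an element of least norm.
  obtain ⟨G, hG, hmin⟩ := exists_norm_eq_iInf_of_complete_convex hne hcl.isComplete hconv 0
  have hle : ∀ H ∈ S, ‖G‖ ≤ ‖H‖ := fun H hH => by
    simp only [zero_sub, norm_neg] at hmin
    rw [hmin]
    exact ciInf_le ⟨0, by rintro _ ⟨w, rfl⟩; exact norm_nonneg _⟩ (⟨H, hH⟩ : S)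
  -- For any competitor H the minimum of G and H is again a weak upper gradient, of norm at least
  -- that of G; being below G, it equals G.
  have hleast : IsLeast S G := by
    refine ⟨hG, fun H hH => ?_⟩
    have h1 : G ⊓ H ∈ S := hG.inf hH
    have h2 := norm_sq_add_norm_sub_sq_le h1.1 (inf_le_left : G ⊓ H ≤ G)
    have h3 := pow_le_pow_left₀ (norm_nonneg _) (hle _ h1) 2
    have h4 : ‖G - G ⊓ H‖ ^ 2 = 0 := le_antisymm (by linarith) (sq_nonneg _)
    have h5 : G = G ⊓ H := by
      rw [← sub_eq_zero, ← norm_eq_zero]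
      exact pow_eq_zero_iff (two_ne_zero) |>.1 h4
    exact h5 ▸ inf_le_right
  rw [weakGrad_eq_of_isLeast f hleast]
  exact hG

lemma weakGrad_le_of_isWeakUpperGradient {f : sobolevClass m} {G : Lp ℝ 2 m}
    (h : IsWeakUpperGradient (f : M →ₘ[m] ℝ) G) : weakGrad f ≤ G :=
  (weakGrad_isGLB f).1 h

end WeakUpperGradient

end

end MMS

namespace MMS

noncomputable section

/-! ## Calculus with minimal weak upper gradients -/

section Calculus

variable {M : Type*} [MetricSpace M] [SecondCountableTopology M] [MeasurableSpace M]
  [BorelSpace M] {m : Measure M}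

/-- By bounded compression almost every curve has its end points outside a given null set, so a
comparison of increments off a null set suffices. -/
lemma isWeakUpperGradient_of_increments {f g : sobolevClass m} {h : M →ₘ[m] ℝ} {a b : ℝ}
    (ha : 0 ≤ a) (hb : 0 ≤ b) {p : M → Prop} (hp : ∀ᵐ x ∂m, p x)
    (hh : ∀ x y, p x → p y → |h x - h y| ≤
      a * |(f : M →ₘ[m] ℝ) x - (f : M →ₘ[m] ℝ) y| + b * |(g : M →ₘ[m] ℝ) x - (g : M →ₘ[m] ℝ) y|) :
    IsWeakUpperGradient h (a • weakGrad f + b • weakGrad g) := by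
  refine IsWeakUpperGradient.comb (isWeakUpperGradient_weakGrad f)
    (isWeakUpperGradient_weakGrad g) ha hb fun π hπ => ?_
  filter_upwards [hπ.ae_eval hp 0, hπ.ae_eval hp 1] with γ h0 h1
  exact hh _ _ h1 h0

lemma coeFn_sobolev_add (f g : sobolevClass m) :
    ((f + g : sobolevClass m) : M →ₘ[m] ℝ) =ᵐ[m]
      fun x => (f : M →ₘ[m] ℝ) x + (g : M →ₘ[m] ℝ) x := AEEqFun.coeFn_add f.1 g.1

lemma coeFn_sobolev_sub (f g : sobolevClass m) :
    ((f - g : sobolevClass m) : M →ₘ[m] ℝ) =ᵐ[m]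
      fun x => (f : M →ₘ[m] ℝ) x - (g : M →ₘ[m] ℝ) x := AEEqFun.coeFn_sub f.1 g.1

lemma coeFn_sobolev_smul (c : ℝ) (f : sobolevClass m) :
    ((c • f : sobolevClass m) : M →ₘ[m] ℝ) =ᵐ[m]
      fun x => c * (f : M →ₘ[m] ℝ) x := AEEqFun.coeFn_smul c f.1

lemma ae_weakGrad_nonneg' (f : sobolevClass m) : ∀ᵐ x ∂m, 0 ≤ weakGrad f x :=
  (Lp.coeFn_nonneg _).2 (weakGrad_nonneg f)

lemma ae_weakGrad_add_le' (f g : sobolevClass m) :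
    ∀ᵐ x ∂m, weakGrad (f + g) x ≤ weakGrad f x + weakGrad g x :=
  ae_weakGrad_add_le (IsCountablyValued.const f) (IsCountablyValued.const g)

lemma ae_weakGrad_smul' (c : ℝ) (f : sobolevClass m) :
    ∀ᵐ x ∂m, weakGrad (c • f) x = |c| * weakGrad f x :=
  ae_weakGrad_smul (IsCountablyValued.const c) (IsCountablyValued.const f)

lemma weakGrad_neg (f : sobolevClass m) : weakGrad (-f) = weakGrad f := by
  rw [← neg_one_smul ℝ f, weakGrad_smul]
  simp

lemma ae_abs_weakGrad_sub_le (f g : sobolevClass m) :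
    ∀ᵐ x ∂m, |weakGrad f x - weakGrad g x| ≤ weakGrad (f - g) x := by
  have h1 := ae_weakGrad_add_le' (f - g) g
  have h2 := ae_weakGrad_add_le' (g - f) f
  rw [sub_add_cancel, ← neg_sub f g, weakGrad_neg] at h2
  rw [sub_add_cancel] at h1
  filter_upwards [h1, h2] with x h1 h2
  rw [abs_le]
  constructor <;> linarith

/-- Locality: `|Df| = 0` a.e. on `{f = 0}`. -/
lemma ae_weakGrad_eq_zero (f : sobolevClass m) :
    ∀ᵐ x ∂m, (f : M →ₘ[m] ℝ) x = 0 → weakGrad f x = 0 := by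
  set G := weakGrad f
  have hset : MeasurableSet {x | (f : M →ₘ[m] ℝ) x ≠ 0} :=
    f.1.measurable (measurableSet_singleton 0).compl
  set H : Lp ℝ 2 m := ((Lp.memLp G).indicator hset).toLp
  have hH : H =ᵐ[m] {x | (f : M →ₘ[m] ℝ) x ≠ 0}.indicator G := MemLp.coeFn_toLp _
  have hGp := ae_weakGrad_nonneg' f
  have h1 := (isWeakUpperGradient_weakGrad f).isPlanGradient.indicator_ne_zero
    f.1.measurable (measurable_ofReal_coeFn G) fun π hπ => hπ.lintegral_ofReal_Lp_lt_top G
  have h2 : IsWeakUpperGradient (f : M →ₘ[m] ℝ) H := by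
    refine IsWeakUpperGradient.of_le h1 ?_ ?_
    · rw [← Lp.coeFn_nonneg]
      filter_upwards [hH, hGp] with x hx hG
      rw [hx]
      exact Set.indicator_apply_nonneg fun _ => hG
    · filter_upwards [hH] with x hx
      rw [hx]
      by_cases h : (f : M →ₘ[m] ℝ) x = 0 <;> simp [h, G]
  filter_upwards [(Lp.coeFn_le _ _).2 (weakGrad_le_of_isWeakUpperGradient h2), hH, hGp]
    with x h3 h4 h5 hx
  refine le_antisymm ?_ h5
  rw [h4, Set.indicator_of_notMem (by simpa using hx)] at h3
  exact h3

/-- Locality: `|Df| = |Dg|` a.e. on `{f = g}`. -/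
lemma ae_weakGrad_congr (f g : sobolevClass m) :
    ∀ᵐ x ∂m, (f : M →ₘ[m] ℝ) x = (g : M →ₘ[m] ℝ) x → weakGrad f x = weakGrad g x := by
  filter_upwards [ae_weakGrad_eq_zero (f - g), ae_abs_weakGrad_sub_le f g, coeFn_sobolev_sub f g]
    with x h1 h2 h3 hx
  rw [h1 (by rw [h3, hx, sub_self])] at h2
  exact sub_eq_zero.1 (abs_nonpos_iff.1 h2)

variable (m) in
/-- Constant functions belong to the Sobolev class. -/
def sobolevConst (c : ℝ) : sobolevClass m :=
  ⟨AEEqFun.const M c, by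
    have h := isWeakUpperGradient_of_increments (m := m) (f := 0) (g := 0)
      (h := AEEqFun.const M c) le_rfl le_rfl (p := fun x => (AEEqFun.const M c : M →ₘ[m] ℝ) x = c)
      (AEEqFun.coeFn_const M c) fun x y hx hy => by rw [hx, hy]; simp
    exact ⟨_, h⟩⟩

lemma coeFn_sobolevConst (c : ℝ) : (sobolevConst m c : M →ₘ[m] ℝ) =ᵐ[m] fun _ => c :=
  AEEqFun.coeFn_const M c

lemma weakGrad_sobolevConst (c : ℝ) : weakGrad (sobolevConst m c) = 0 := by
  refine le_antisymm ?_ (weakGrad_nonneg _)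
  have h := isWeakUpperGradient_of_increments (m := m) (f := 0) (g := 0)
      (h := sobolevConst m c) le_rfl le_rfl (p := fun x => (sobolevConst m c : M →ₘ[m] ℝ) x = c)
      (coeFn_sobolevConst c) fun x y hx hy => by rw [hx, hy]; simp
  simpa using weakGrad_le_of_isWeakUpperGradient h

/-- Locality applied to f and g + c, since adding a constant leaves |Dg| unchanged. -/
lemma ae_weakGrad_congr_add_const (f g : sobolevClass m) (c : ℝ) :
    ∀ᵐ x ∂m, (f : M →ₘ[m] ℝ) x = (g : M →ₘ[m] ℝ) x + c → weakGrad f x = weakGrad g x := by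
  have h0 : (weakGrad (sobolevConst m c)) =ᵐ[m] fun _ => 0 := by
    rw [weakGrad_sobolevConst]
    exact Lp.coeFn_zero ℝ 2 m
  have h1 := ae_abs_weakGrad_sub_le (g + sobolevConst m c) g
  rw [add_sub_cancel_left] at h1
  filter_upwards [ae_weakGrad_congr f (g + sobolevConst m c), coeFn_sobolev_add g (sobolevConst m c),
    coeFn_sobolevConst (m := m) c, h0, h1] with x h2 h3 h4 h5 h6 hx
  rw [h2 (by rw [h3, h4, hx])]
  rw [h5] at h6
  exact sub_eq_zero.1 (abs_nonpos_iff.1 h6)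

lemma weakGrad_congr_add_const {f g : sobolevClass m} (c : ℝ)
    (h : ∀ᵐ x ∂m, (f : M →ₘ[m] ℝ) x = (g : M →ₘ[m] ℝ) x + c) : weakGrad f = weakGrad g := by
  refine Lp.ext ?_
  filter_upwards [h, ae_weakGrad_congr_add_const f g c] with x h1 h2
  exact h2 h1

/-- Post-composition with a `1`-Lipschitz function. -/
def sobolevComp {φ : ℝ → ℝ} (hφ : LipschitzWith 1 φ) (f : sobolevClass m) : sobolevClass m :=
  ⟨AEEqFun.comp φ hφ.continuous f, by
    have h := isWeakUpperGradient_of_increments (m := m) (f := f) (g := f)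
      (h := AEEqFun.comp φ hφ.continuous f) zero_le_one le_rfl
      (AEEqFun.coeFn_comp φ hφ.continuous f.1) fun x y hx hy => by
        rw [hx, hy]
        have := hφ.dist_le_mul ((f : M →ₘ[m] ℝ) x) ((f : M →ₘ[m] ℝ) y)
        rw [Real.dist_eq, Real.dist_eq] at this
        simpa using this
    exact ⟨_, h⟩⟩

lemma coeFn_sobolevComp {φ : ℝ → ℝ} (hφ : LipschitzWith 1 φ) (f : sobolevClass m) :
    (sobolevComp hφ f : M →ₘ[m] ℝ) =ᵐ[m] fun x => φ ((f : M →ₘ[m] ℝ) x) :=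
  AEEqFun.coeFn_comp φ hφ.continuous f.1

lemma lipschitzWith_clamp (N : ℝ) : LipschitzWith 1 fun y : ℝ => max (-N) (min N y) :=
  (LipschitzWith.id.const_min N).const_max (-N)

/-- The truncation of a Sobolev function at height `N`. -/
def sobolevTrunc (N : ℝ) (f : sobolevClass m) : sobolevClass m :=
  sobolevComp (lipschitzWith_clamp N) f

lemma ae_sobolevTrunc_eq (N : ℝ) (f : sobolevClass m) :
    ∀ᵐ x ∂m, |(f : M →ₘ[m] ℝ) x| ≤ N →
      (sobolevTrunc N f : M →ₘ[m] ℝ) x = (f : M →ₘ[m] ℝ) x := by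
  filter_upwards [coeFn_sobolevComp (lipschitzWith_clamp N) f] with x hx h
  rw [abs_le] at h
  rw [sobolevTrunc, hx, min_eq_right h.2, max_eq_right h.1]

lemma ae_abs_sobolevTrunc_le {N : ℝ} (hN : 0 ≤ N) (f : sobolevClass m) :
    ∀ᵐ x ∂m, |(sobolevTrunc N f : M →ₘ[m] ℝ) x| ≤ N := by
  filter_upwards [coeFn_sobolevComp (lipschitzWith_clamp N) f] with x hx
  rw [sobolevTrunc, hx, abs_le]
  exact ⟨le_max_left _ _, max_le (by linarith) (min_le_left _ _)⟩

/-- `f` is essentially bounded. -/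
def IsEssBounded (f : M →ₘ[m] ℝ) : Prop := ∃ C : ℝ, ∀ᵐ x ∂m, |f x| ≤ C

lemma IsEssBounded.sub_const {f : sobolevClass m} (hf : IsEssBounded (f : M →ₘ[m] ℝ)) (c : ℝ) :
    IsEssBounded ((f - sobolevConst m c : sobolevClass m) : M →ₘ[m] ℝ) := by
  obtain ⟨C, hC⟩ := hf
  refine ⟨C + |c|, ?_⟩
  filter_upwards [hC, coeFn_sobolev_sub f (sobolevConst m c), coeFn_sobolevConst (m := m) c]
    with x h1 h2 h3
  rw [h2, h3]
  exact (abs_sub _ _).trans (by linarith)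

lemma isWeakUpperGradient_mul {f g : sobolevClass m} {a b : ℝ} (ha : 0 ≤ a) (hb : 0 ≤ b)
    (hf : ∀ᵐ x ∂m, |(f : M →ₘ[m] ℝ) x| ≤ a) (hg : ∀ᵐ x ∂m, |(g : M →ₘ[m] ℝ) x| ≤ b) :
    IsWeakUpperGradient ((f : M →ₘ[m] ℝ) * (g : M →ₘ[m] ℝ)) (b • weakGrad f + a • weakGrad g) := by
  refine isWeakUpperGradient_of_increments hb ha
    (((AEEqFun.coeFn_mul f.1 g.1).and hf).and hg) ?_
  rintro x y ⟨⟨h1, h2⟩, h3⟩ ⟨⟨h4, h5⟩, h6⟩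
  rw [h1, h4, Pi.mul_apply, Pi.mul_apply]
  set u := (f : M →ₘ[m] ℝ)
  set v := (g : M →ₘ[m] ℝ)
  calc |u x * v x - u y * v y| = |v x * (u x - u y) + u y * (v x - v y)| := by ring_nf
    _ ≤ |v x| * |u x - u y| + |u y| * |v x - v y| := by
        rw [← abs_mul, ← abs_mul]; exact abs_add_le _ _
    _ ≤ _ := by gcongr

/-- The product of two essentially bounded Sobolev functions. -/
def sobolevMul (f g : sobolevClass m) (hf : IsEssBounded (f : M →ₘ[m] ℝ))
    (hg : IsEssBounded (g : M →ₘ[m] ℝ)) : sobolevClass m :=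
  ⟨(f : M →ₘ[m] ℝ) * (g : M →ₘ[m] ℝ), by
    obtain ⟨a, ha⟩ := hf
    obtain ⟨b, hb⟩ := hg
    exact ⟨_, isWeakUpperGradient_mul (abs_nonneg a) (abs_nonneg b)
      (ha.mono fun x hx => hx.trans (le_abs_self a))
      (hb.mono fun x hx => hx.trans (le_abs_self b))⟩⟩

lemma coeFn_sobolevMul (f g : sobolevClass m) (hf : IsEssBounded (f : M →ₘ[m] ℝ))
    (hg : IsEssBounded (g : M →ₘ[m] ℝ)) : (sobolevMul f g hf hg : M →ₘ[m] ℝ) =ᵐ[m]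
      fun x => (f : M →ₘ[m] ℝ) x * (g : M →ₘ[m] ℝ) x := AEEqFun.coeFn_mul f.1 g.1

lemma isEssBounded_sobolevTrunc {N : ℝ} (hN : 0 ≤ N) (f : sobolevClass m) :
    IsEssBounded (sobolevTrunc N f : M →ₘ[m] ℝ) := ⟨N, ae_abs_sobolevTrunc_le hN f⟩

lemma le_of_forall_pos_le_add_mul {A B Y : ℝ} (h : ∀ ε > 0, A ≤ B + ε * Y) : A ≤ B := by
  have h1 : Tendsto (fun ε : ℝ => B + ε * Y) (𝓝[>] 0) (𝓝 (B + 0 * Y)) :=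
    ((continuous_const.add (continuous_id.mul continuous_const)).tendsto 0).mono_left
      nhdsWithin_le_nhds
  rw [zero_mul, add_zero] at h1
  exact ge_of_tendsto h1 (eventually_mem_nhdsWithin.mono h)

/-- The pointwise Leibniz inequality. -/
lemma ae_weakGrad_sobolevMul_le (f g : sobolevClass m) (hf : IsEssBounded (f : M →ₘ[m] ℝ))
    (hg : IsEssBounded (g : M →ₘ[m] ℝ)) :
    ∀ᵐ x ∂m, weakGrad (sobolevMul f g hf hg) x ≤
      |(g : M →ₘ[m] ℝ) x| * weakGrad f x + |(f : M →ₘ[m] ℝ) x| * weakGrad g x := by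
  -- Where |f| ≤ a and |g| ≤ b, the product agrees with that of the truncations, for which b|Df| +
  -- a|Dg| is an upper gradient. Rational bounds leave only countably many null sets.
  have key : ∀ a b : ℚ, ∀ᵐ x ∂m, |(f : M →ₘ[m] ℝ) x| ≤ a → |(g : M →ₘ[m] ℝ) x| ≤ b →
      weakGrad (sobolevMul f g hf hg) x ≤ b * weakGrad f x + a * weakGrad g x := fun a b => by
    rcases lt_or_ge (a : ℝ) 0 with ha | ha
    · exact Eventually.of_forall fun x hx => absurd ((abs_nonneg _).trans hx) ha.not_ge
    rcases lt_or_ge (b : ℝ) 0 with hb | hb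
    · exact Eventually.of_forall fun x _ hx => absurd ((abs_nonneg _).trans hx) hb.not_ge
    set fa := sobolevTrunc (a : ℝ) f
    set gb := sobolevTrunc (b : ℝ) g
    have h1 := weakGrad_le_of_isWeakUpperGradient
      (f := sobolevMul fa gb (isEssBounded_sobolevTrunc ha f) (isEssBounded_sobolevTrunc hb g))
      (isWeakUpperGradient_mul ha hb (ae_abs_sobolevTrunc_le ha f) (ae_abs_sobolevTrunc_le hb g))
    filter_upwards [(Lp.coeFn_le _ _).2 h1, ae_sobolevTrunc_eq a f, ae_sobolevTrunc_eq b g,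
      ae_weakGrad_congr f fa, ae_weakGrad_congr g gb, coeFn_sobolevMul f g hf hg,
      coeFn_sobolevMul fa gb (isEssBounded_sobolevTrunc ha f) (isEssBounded_sobolevTrunc hb g),
      ae_weakGrad_congr (sobolevMul f g hf hg)
        (sobolevMul fa gb (isEssBounded_sobolevTrunc ha f) (isEssBounded_sobolevTrunc hb g)),
      Lp.coeFn_add ((b : ℝ) • weakGrad fa) ((a : ℝ) • weakGrad gb),
      Lp.coeFn_smul (b : ℝ) (weakGrad fa), Lp.coeFn_smul (a : ℝ) (weakGrad gb)]
      with x e1 e2 e3 e4 e5 e6 e7 e8 e9 e10 e11 k1 k2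
    have e2 := e2 k1
    have e3 := e3 k2
    rw [e9, Pi.add_apply, e10, e11, Pi.smul_apply, Pi.smul_apply, smul_eq_mul, smul_eq_mul,
      ← e4 e2.symm, ← e5 e3.symm] at e1
    rwa [e8 (by rw [e6, e7, e2, e3])]
  have key' : ∀ᵐ x ∂m, ∀ a b : ℚ, |(f : M →ₘ[m] ℝ) x| ≤ a → |(g : M →ₘ[m] ℝ) x| ≤ b →
      weakGrad (sobolevMul f g hf hg) x ≤ b * weakGrad f x + a * weakGrad g x :=
    ae_all_iff.2 fun a => ae_all_iff.2 fun b => key a b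
  filter_upwards [key', ae_weakGrad_nonneg' f, ae_weakGrad_nonneg' g] with x hx hfx hgx
  -- The rational bounds are now chosen within ε of |f(x)| and |g(x)|, at the fixed point x.
  refine le_of_forall_pos_le_add_mul (Y := weakGrad f x + weakGrad g x) fun ε hε => ?_
  obtain ⟨a, ha1, ha2⟩ := exists_rat_btwn (show |(f : M →ₘ[m] ℝ) x| < |(f : M →ₘ[m] ℝ) x| + ε by
    linarith)
  obtain ⟨b, hb1, hb2⟩ := exists_rat_btwn (show |(g : M →ₘ[m] ℝ) x| < |(g : M →ₘ[m] ℝ) x| + ε by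
    linarith)
  have := hx a b ha1.le hb1.le
  nlinarith

/-- The Leibniz rule, in the form of an approximation of `D(fg)` by linear combinations of `Df`
and `Dg` with constant coefficients. -/
lemma ae_weakGrad_sobolevMul_sub_le (f g : sobolevClass m) (hf : IsEssBounded (f : M →ₘ[m] ℝ))
    (hg : IsEssBounded (g : M →ₘ[m] ℝ)) (c d : ℝ) :
    ∀ᵐ x ∂m, weakGrad (sobolevMul f g hf hg - (c • g + d • f)) x ≤
      |(f : M →ₘ[m] ℝ) x - c| * weakGrad g x + |(g : M →ₘ[m] ℝ) x - d| * weakGrad f x := by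
  set f' := f - sobolevConst m c
  set g' := g - sobolevConst m d
  have hf' := hf.sub_const c
  have hg' := hg.sub_const d
  have cf : ∀ᵐ x ∂m, (f' : M →ₘ[m] ℝ) x = (f : M →ₘ[m] ℝ) x - c := by
    filter_upwards [coeFn_sobolev_sub f (sobolevConst m c), coeFn_sobolevConst (m := m) c]
      with x h1 h2
    rw [h1, h2]
  have cg : ∀ᵐ x ∂m, (g' : M →ₘ[m] ℝ) x = (g : M →ₘ[m] ℝ) x - d := by
    filter_upwards [coeFn_sobolev_sub g (sobolevConst m d), coeFn_sobolevConst (m := m) d]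
      with x h1 h2
    rw [h1, h2]
  have e1 : weakGrad f' = weakGrad f :=
    weakGrad_congr_add_const (-c) (cf.mono fun x hx => by rw [hx]; ring)
  have e2 : weakGrad g' = weakGrad g :=
    weakGrad_congr_add_const (-d) (cg.mono fun x hx => by rw [hx]; ring)
  -- The identity fg - cg - df = (f - c)(g - d) - cd, in which the last constant does not affect the
  -- gradient.
  have e3 : weakGrad (sobolevMul f g hf hg - (c • g + d • f)) =
      weakGrad (sobolevMul f' g' hf' hg') := by
    refine weakGrad_congr_add_const (-(c * d)) ?_
    filter_upwards [cf, cg, coeFn_sobolevMul f' g' hf' hg', coeFn_sobolevMul f g hf hg,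
      coeFn_sobolev_sub (sobolevMul f g hf hg) (c • g + d • f), coeFn_sobolev_add (c • g) (d • f),
      coeFn_sobolev_smul c g, coeFn_sobolev_smul d f] with x h1 h2 h3 h4 h5 h6 h7 h8
    rw [h5, h6, h7, h8, h4, h3, h1, h2]
    ring
  rw [e3]
  filter_upwards [ae_weakGrad_sobolevMul_le f' g' hf' hg', cf, cg] with x h1 h2 h3
  rw [e1, e2, h2, h3] at h1
  linarith

lemma le_of_forall_rat {Φ Ψ : ℝ → ℝ} (hΦ : Continuous Φ) (hΨ : Continuous Ψ)
    (h : ∀ q : ℚ, Φ q ≤ Ψ q) (x : ℝ) : Φ x ≤ Ψ x :=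
  isClosed_property Rat.denseRange_cast (isClosed_le hΦ hΨ) h x

/-- The preceding estimate with d = 0 compares fg with cg for every rational c; at a fixed point
both sides are continuous in c, and c may tend to f(x). This two-sided form makes |f||Dg| the main
term of |D(fg)| when g is small. -/
lemma ae_abs_weakGrad_sobolevMul_sub_le (f g : sobolevClass m)
    (hf : IsEssBounded (f : M →ₘ[m] ℝ)) (hg : IsEssBounded (g : M →ₘ[m] ℝ)) :
    ∀ᵐ x ∂m, |weakGrad (sobolevMul f g hf hg) x - |(f : M →ₘ[m] ℝ) x| * weakGrad g x| ≤
      |(g : M →ₘ[m] ℝ) x| * weakGrad f x := by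
  have h : ∀ᵐ x ∂m, ∀ c : ℚ, |weakGrad (sobolevMul f g hf hg) x - |(c : ℝ)| * weakGrad g x| ≤
      |(f : M →ₘ[m] ℝ) x - c| * weakGrad g x + |(g : M →ₘ[m] ℝ) x| * weakGrad f x := by
    refine ae_all_iff.2 fun c => ?_
    filter_upwards [ae_weakGrad_sobolevMul_sub_le f g hf hg c 0,
      ae_abs_weakGrad_sub_le (sobolevMul f g hf hg) ((c : ℝ) • g), ae_weakGrad_smul' (c : ℝ) g]
      with x h1 h2 h3
    rw [zero_smul, add_zero, sub_zero] at h1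
    rw [h3] at h2
    exact h2.trans h1
  filter_upwards [h] with x hx
  have := le_of_forall_rat (Φ := fun c => |weakGrad (sobolevMul f g hf hg) x -
    |c| * weakGrad g x|) (Ψ := fun c => |(f : M →ₘ[m] ℝ) x - c| * weakGrad g x +
      |(g : M →ₘ[m] ℝ) x| * weakGrad f x) (by fun_prop) (by fun_prop) hx ((f : M →ₘ[m] ℝ) x)
  simpa using this

end Calculus

/-! ## Completeness of `W^{1,2}` and cutoff functions -/

section Completeness

variable {M : Type*} [MetricSpace M] [SecondCountableTopology M] [MeasurableSpace M]
  [BorelSpace M] {m : Measure M}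

lemma W12.norm_sq (f : W12 m) : ‖f‖ ^ 2 = ‖f.toL2‖ ^ 2 + ‖weakGrad f.toSobolevClass‖ ^ 2 := by
  rw [W12.norm_def, Real.sq_sqrt (by positivity)]

lemma W12.norm_toL2_le (f : W12 m) : ‖f.toL2‖ ≤ ‖f‖ :=
  abs_le_of_sq_le_sq' (by rw [W12.norm_sq]; nlinarith [sq_nonneg ‖weakGrad f.toSobolevClass‖])
    (norm_nonneg _) |>.2

lemma W12.norm_weakGrad_le (f : W12 m) : ‖weakGrad f.toSobolevClass‖ ≤ ‖f‖ :=
  abs_le_of_sq_le_sq' (by rw [W12.norm_sq]; nlinarith [sq_nonneg ‖f.toL2‖])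
    (norm_nonneg _) |>.2

/-- An element of `W^{1,2}` from an `L²`-function with a weak upper gradient. -/
def W12.mk (f : Lp ℝ 2 m) (hf : (f : M →ₘ[m] ℝ) ∈ sobolevClass m) : W12 m :=
  (⟨f, hf⟩ : ↥(w12Submodule m))

lemma norm_weakGrad_le_of_isWeakUpperGradient {f : sobolevClass m} {G : Lp ℝ 2 m}
    (h : IsWeakUpperGradient (f : M →ₘ[m] ℝ) G) : ‖weakGrad f‖ ≤ ‖G‖ := by
  refine norm_le_norm_of_abs_le_abs ?_
  rw [abs_of_nonneg (weakGrad_nonneg f)]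
  exact (weakGrad_le_of_isWeakUpperGradient h).trans (le_abs_self G)

lemma W12.isWeakUpperGradient_sum (u : ℕ → W12 m) (s : Finset ℕ) :
    IsWeakUpperGradient ((∑ i ∈ s, u i).toSobolevClass : M →ₘ[m] ℝ)
      (∑ i ∈ s, weakGrad (u i).toSobolevClass) := by
  refine (isWeakUpperGradient_weakGrad _).mono ?_
  induction s using Finset.cons_induction with
  | empty => rw [Finset.sum_empty, Finset.sum_empty, map_zero, weakGrad_zero]
  | cons a s ha ih =>
    rw [Finset.sum_cons, Finset.sum_cons, map_add]
    exact (weakGrad_add_le _ _).trans (add_le_add le_rfl ih)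

/-- For an absolutely convergent series the partial sums converge in L², and so do the sums of the
gradients |Du_i|. Closedness of weak upper gradients along an a.e. convergent subsequence puts the
limit in S² and bounds the gradient of the N-th remainder by the tail of the sum of the |Du_i|. -/
instance : CompleteSpace (W12 m) := by
  refine NormedAddCommGroup.completeSpace_of_summable_imp_tendsto fun u hu => ?_
  have hu1 : Summable fun i => ‖(u i).toL2‖ :=
    hu.of_nonneg_of_le (fun i => norm_nonneg _) fun i => (u i).norm_toL2_le
  have hu2 : Summable fun i => ‖weakGrad (u i).toSobolevClass‖ :=
    hu.of_nonneg_of_le (fun i => norm_nonneg _) fun i => (u i).norm_weakGrad_le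
  have hs1 := hu1.of_norm
  have hs2 := hu2.of_norm
  set F := ∑' i, (u i).toL2
  set S : ℕ → W12 m := fun n => ∑ i ∈ Finset.range n, u i
  set g : ℕ → Lp ℝ 2 m := fun i => weakGrad (u i).toSobolevClass
  have hSF : Tendsto (fun n => (S n).toL2) atTop (𝓝 F) := by
    refine hs1.hasSum.tendsto_sum_nat.congr fun n => ?_
    exact (map_sum W12.toL2 _ _).symm
  have hSg : Tendsto (fun n => ∑ i ∈ Finset.range n, g i) atTop (𝓝 (∑' i, g i)) :=
    hs2.hasSum.tendsto_sum_nat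
  obtain ⟨ns, hns, hae⟩ := exists_subseq_tendsto_ae hSF
  have hnsT := hns.tendsto_atTop
  have hF : (F : M →ₘ[m] ℝ) ∈ sobolevClass m := by
    refine ⟨∑' i, g i, IsWeakUpperGradient.of_tendsto
      (f := fun k => ((S (ns k)).toSobolevClass : M →ₘ[m] ℝ))
      (fun k => W12.isWeakUpperGradient_sum u (Finset.range (ns k))) hae (hSg.comp hnsT)⟩
  refine ⟨W12.mk F hF, ?_⟩
  have hgrad : ∀ N, ‖weakGrad (W12.mk F hF - S N).toSobolevClass‖ ≤
      ‖(∑' i, g i) - ∑ i ∈ Finset.range N, g i‖ := fun N => by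
    refine norm_weakGrad_le_of_isWeakUpperGradient ?_
    refine IsWeakUpperGradient.of_tendsto
      (f := fun k => ((S (ns (k + N)) - S N).toSobolevClass : M →ₘ[m] ℝ))
      (G := fun k => (∑ i ∈ Finset.range (ns (k + N)), g i) - ∑ i ∈ Finset.range N, g i)
      (fun k => ?_) ?_ ?_
    -- The subsequence is shifted by N so that each of its partial sums contains the first N terms;
    -- the difference is then a finite block of the series.
    · have hN : N ≤ ns (k + N) := (Nat.le_add_left N k).trans (hns.id_le _)
      have h1 := Finset.sum_range_add_sum_Ico g hN
      have h2 := Finset.sum_range_add_sum_Ico u hN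
      rw [← h1, add_sub_cancel_left]
      have h3 : S (ns (k + N)) - S N = ∑ i ∈ Finset.Ico N (ns (k + N)), u i := by
        rw [sub_eq_iff_eq_add', h2]
      rw [h3]
      exact W12.isWeakUpperGradient_sum u _
    · have h1 : ∀ᵐ x ∂m, ∀ k, ((S (ns (k + N)) - S N).toSobolevClass : M →ₘ[m] ℝ) x =
          (S (ns (k + N))).toL2 x - (S N).toL2 x :=
        ae_all_iff.2 fun k => Lp.coeFn_sub (S (ns (k + N))).toL2 (S N).toL2
      have h2 : ∀ᵐ x ∂m, ((W12.mk F hF - S N).toSobolevClass : M →ₘ[m] ℝ) x =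
          F x - (S N).toL2 x := Lp.coeFn_sub F (S N).toL2
      filter_upwards [hae, h1, h2] with x h3 h4 h5
      simp only [h4, h5]
      exact ((tendsto_add_atTop_iff_nat N).2 h3).sub_const _
    · exact ((tendsto_add_atTop_iff_nat N).2 (hSg.comp hnsT)).sub_const _
  rw [tendsto_iff_norm_sub_tendsto_zero]
  have h1 : Tendsto (fun N => ‖F - (S N).toL2‖ +
      ‖(∑' i, g i) - ∑ i ∈ Finset.range N, g i‖) atTop (𝓝 (0 + 0)) := by
    refine Tendsto.add ?_ ?_
    · simpa [norm_sub_rev] using tendsto_iff_norm_sub_tendsto_zero.1 hSF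
    · simpa [norm_sub_rev] using tendsto_iff_norm_sub_tendsto_zero.1 hSg
  rw [add_zero] at h1
  refine squeeze_zero (fun N => norm_nonneg _) (fun N => ?_) h1
  rw [norm_sub_rev]
  have h2 := W12.norm_sq (W12.mk F hF - S N)
  have h3 : (W12.mk F hF - S N).toL2 = F - (S N).toL2 := map_sub _ _ _
  rw [h3] at h2
  refine abs_le_of_sq_le_sq' ?_ (by positivity) |>.2
  rw [h2]
  have := hgrad N
  have h4 := norm_nonneg (F - (S N).toL2)
  have h5 := norm_nonneg (weakGrad (W12.mk F hF - S N).toSobolevClass)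
  nlinarith

/-- By locality the constant K is needed only where ψ does not vanish, and finite measure of that
set makes it square integrable. -/
lemma mem_sobolevClass_of_lipschitzWith {ψ : M → ℝ} {K : ℝ≥0} (hψ : LipschitzWith K ψ)
    (hfin : m {x | ψ x ≠ 0} ≠ ∞) {f : M →ₘ[m] ℝ} (hf : f =ᵐ[m] ψ) : f ∈ sobolevClass m := by
  have hset : MeasurableSet {x | ψ x ≠ 0} :=
    hψ.continuous.measurable (measurableSet_singleton 0).compl
  set H : Lp ℝ 2 m := indicatorConstLp 2 hset hfin (K : ℝ)
  have hH : H =ᵐ[m] {x | ψ x ≠ 0}.indicator fun _ => (K : ℝ) := indicatorConstLp_coeFn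
  have h1 : IsPlanGradient m ψ fun x => ENNReal.ofReal (H x) := by
    refine (isPlanGradient_indicator_of_lipschitzWith (m := m) hψ).mono_ae ?_
    filter_upwards [hH] with x hx
    rw [hx]
    by_cases h : ψ x = 0 <;> simp [h]
  refine ⟨H, ?_, fun π hπ => ?_⟩
  · rw [← Lp.coeFn_nonneg]
    filter_upwards [hH] with x hx
    rw [hx]
    exact Set.indicator_apply_nonneg fun _ => K.2
  · refine le_trans (le_of_eq (lintegral_congr_ae ?_)) (h1 π hπ)
    filter_upwards [hπ.ae_eval hf 1, hπ.ae_eval hf 0] with γ e1 e0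
    rw [e1, e0]

end Completeness

end

end MMS

namespace MMS

noncomputable section

/-! ## From the parallelogram identity in `W^{1,2}` to the pointwise parallelogram identity -/

section ZigZag

/-- The zigzag function: `δ` times the distance of `y / δ` from the integers. -/
def zigzag (δ y : ℝ) : ℝ := δ * |y / δ - round (y / δ)|

lemma abs_zigzag_le {δ : ℝ} (hδ : 0 < δ) (y : ℝ) : |zigzag δ y| ≤ δ := by
  rw [zigzag, abs_mul, abs_abs, abs_of_pos hδ]
  have := abs_sub_round (y / δ)
  nlinarith

lemma lipschitzWith_zigzag {δ : ℝ} (hδ : 0 < δ) : LipschitzWith 1 (zigzag δ) := by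
  refine LipschitzWith.of_le_add fun y z => ?_
  have h1 := round_le (y / δ) (round (z / δ))
  have h2 : |y / δ - round (z / δ)| ≤ |y / δ - z / δ| + |z / δ - round (z / δ)| := abs_sub_le _ _ _
  have h3 : δ * |y / δ - z / δ| = dist y z := by
    rw [← sub_div, abs_div, abs_of_pos hδ, Real.dist_eq, mul_div_cancel₀ _ hδ.ne']
  unfold zigzag
  nlinarith

/-- Here k is the nearest integer to y/δ and the sign tells on which side of it y/δ lies. Only
countably many affine branches of slope ±1 occur, as locality requires. -/
lemma exists_zigzag_eq {δ : ℝ} (hδ : 0 < δ) (y : ℝ) :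
    ∃ (k : ℤ) (ε : ℤˣ), zigzag δ y = ((ε : ℤ) : ℝ) * (y - δ * k) := by
  refine ⟨round (y / δ), ?_⟩
  have e : y = δ * (y / δ) := (mul_div_cancel₀ _ hδ.ne').symm
  rcases abs_choice (y / δ - round (y / δ)) with h | h
  · refine ⟨1, ?_⟩
    rw [zigzag, h]
    push_cast
    rw [mul_sub, ← e]
    ring
  · refine ⟨-1, ?_⟩
    rw [zigzag, h]
    push_cast
    rw [mul_neg, mul_sub, ← e]
    ring

end ZigZag

section L2

variable {M : Type*} [MeasurableSpace M] {m : Measure M}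

lemma norm_sq_eq_integral (G : Lp ℝ 2 m) : ‖G‖ ^ 2 = ∫ x, G x ^ 2 ∂m := by
  rw [← real_inner_self_eq_norm_sq, L2.inner_def]
  refine integral_congr_ae (Eventually.of_forall fun x => ?_)
  simp [sq]

lemma integrable_sq_coeFn (G : Lp ℝ 2 m) : Integrable (fun x => G x ^ 2) m :=
  (Lp.memLp G).integrable_sq

end L2

/-! ### The parallelogram identity: weighted integrals, localization and the Hilbert property of
W^{1,2}. -/

section Parallelogram

variable {M : Type*} [MetricSpace M] [SecondCountableTopology M] [MeasurableSpace M]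
  [BorelSpace M] {m : Measure M}

variable (m) in
/-- The pointwise parallelogram identity for minimal weak upper gradients. -/
def PointwiseParallelogram : Prop :=
  ∀ f g : sobolevClass m, ∀ᵐ x ∂m, weakGrad (f + g) x ^ 2 + weakGrad (f - g) x ^ 2 =
    2 * weakGrad f x ^ 2 + 2 * weakGrad g x ^ 2

/-- It suffices to check one inequality for bounded functions. -/
lemma PointwiseParallelogram.of_bounded_le
    (h : ∀ f g : sobolevClass m, IsEssBounded (f : M →ₘ[m] ℝ) → IsEssBounded (g : M →ₘ[m] ℝ) →
      ∀ᵐ x ∂m, weakGrad (f + g) x ^ 2 + weakGrad (f - g) x ^ 2 ≤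
        2 * weakGrad f x ^ 2 + 2 * weakGrad g x ^ 2) : PointwiseParallelogram m := by
  have key : ∀ f g : sobolevClass m, ∀ᵐ x ∂m, weakGrad (f + g) x ^ 2 + weakGrad (f - g) x ^ 2 ≤
        2 * weakGrad f x ^ 2 + 2 * weakGrad g x ^ 2 := by
    intro f g
    have hN : ∀ᵐ x ∂m, ∀ N : ℕ, |(f : M →ₘ[m] ℝ) x| ≤ N → |(g : M →ₘ[m] ℝ) x| ≤ N →
        weakGrad (f + g) x ^ 2 + weakGrad (f - g) x ^ 2 ≤
        2 * weakGrad f x ^ 2 + 2 * weakGrad g x ^ 2 := by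
      refine ae_all_iff.2 fun N => ?_
      -- On the set where |f| and |g| are at most N the truncations agree with f and g, hence so do
      -- all four gradients; these sets exhaust M as N grows.
      set f' := sobolevTrunc (N : ℝ) f
      set g' := sobolevTrunc (N : ℝ) g
      filter_upwards [h f' g' (isEssBounded_sobolevTrunc N.cast_nonneg f)
        (isEssBounded_sobolevTrunc N.cast_nonneg g), ae_sobolevTrunc_eq N f,
        ae_sobolevTrunc_eq N g, ae_weakGrad_congr f f', ae_weakGrad_congr g g',
        ae_weakGrad_congr (f + g) (f' + g'), ae_weakGrad_congr (f - g) (f' - g'),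
        coeFn_sobolev_add f g, coeFn_sobolev_add f' g', coeFn_sobolev_sub f g,
        coeFn_sobolev_sub f' g'] with x e0 e1 e2 e3 e4 e5 e6 e7 e8 e9 e10 k1 k2
      have e1 := e1 k1
      have e2 := e2 k2
      rwa [e3 e1.symm, e4 e2.symm, e5 (by rw [e7, e8, e1, e2]), e6 (by rw [e9, e10, e1, e2])]
    filter_upwards [hN] with x hx
    obtain ⟨N, hN⟩ := exists_nat_ge (max |(f : M →ₘ[m] ℝ) x| |(g : M →ₘ[m] ℝ) x|)
    exact hx N ((le_max_left _ _).trans hN) ((le_max_right _ _).trans hN)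
  intro f g
  -- The inequality for the pair f + g, f - g has 4|Df|² + 4|Dg|² on the left, which is the reverse
  -- inequality for f, g.
  have e1 : f + g + (f - g) = (2 : ℝ) • f := by rw [two_smul]; abel
  have e2 : f + g - (f - g) = (2 : ℝ) • g := by rw [two_smul]; abel
  have h2 := key (f + g) (f - g)
  rw [e1, e2] at h2
  filter_upwards [key f g, h2, ae_weakGrad_smul' 2 f, ae_weakGrad_smul' 2 g] with x h1 h2 h3 h4
  rw [h3, h4, abs_two] at h2
  nlinarith

/-- On each of countably many sets the composition is ±f plus a constant, so locality applies piece
by piece. -/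
lemma ae_weakGrad_zigzag {δ : ℝ} (hδ : 0 < δ) (f : sobolevClass m) :
    ∀ᵐ x ∂m, weakGrad (sobolevComp (lipschitzWith_zigzag hδ) f) x = weakGrad f x := by
  set W := sobolevComp (lipschitzWith_zigzag hδ) f
  have h : ∀ᵐ x ∂m, ∀ (k : ℤ) (ε : ℤˣ),
      (W : M →ₘ[m] ℝ) x = ((ε : ℤ) : ℝ) * ((f : M →ₘ[m] ℝ) x - δ * k) →
        weakGrad W x = weakGrad f x := by
    refine ae_all_iff.2 fun k => ae_all_iff.2 fun ε => ?_
    filter_upwards [ae_weakGrad_congr_add_const W (((ε : ℤ) : ℝ) • f) (-(((ε : ℤ) : ℝ) * (δ * k))),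
      ae_weakGrad_smul' (((ε : ℤ) : ℝ)) f, coeFn_sobolev_smul (((ε : ℤ) : ℝ)) f] with x h1 h2 h3 hx
    rw [h1 (by rw [h3, hx]; ring), h2]
    rcases Int.units_eq_one_or ε with rfl | rfl <;> simp
  filter_upwards [h, coeFn_sobolevComp (lipschitzWith_zigzag hδ) f] with x hx hW
  obtain ⟨k, ε, hk⟩ := exists_zigzag_eq hδ ((f : M →ₘ[m] ℝ) x)
  exact hx k ε (hW.trans hk)

/-- On each piece the compositions are ±f and ±g up to constants. Equal signs preserve the pair f +
g, f - g up to sign, opposite signs exchange its members; only the sum of the two squares is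
therefore invariant. -/
lemma ae_weakGrad_zigzag_add_sub {δ : ℝ} (hδ : 0 < δ) (f g : sobolevClass m) :
    ∀ᵐ x ∂m, weakGrad (sobolevComp (lipschitzWith_zigzag hδ) f +
        sobolevComp (lipschitzWith_zigzag hδ) g) x ^ 2 +
      weakGrad (sobolevComp (lipschitzWith_zigzag hδ) f -
        sobolevComp (lipschitzWith_zigzag hδ) g) x ^ 2 =
      weakGrad (f + g) x ^ 2 + weakGrad (f - g) x ^ 2 := by
  set W := sobolevComp (lipschitzWith_zigzag hδ) f
  set V := sobolevComp (lipschitzWith_zigzag hδ) g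
  have h : ∀ᵐ x ∂m, ∀ (k l : ℤ) (ε η : ℤˣ),
      (W : M →ₘ[m] ℝ) x = ((ε : ℤ) : ℝ) * ((f : M →ₘ[m] ℝ) x - δ * k) →
      (V : M →ₘ[m] ℝ) x = ((η : ℤ) : ℝ) * ((g : M →ₘ[m] ℝ) x - δ * l) →
        weakGrad (W + V) x ^ 2 + weakGrad (W - V) x ^ 2 =
          weakGrad (f + g) x ^ 2 + weakGrad (f - g) x ^ 2 := by
    refine ae_all_iff.2 fun k => ae_all_iff.2 fun l => ae_all_iff.2 fun ε => ae_all_iff.2 fun η => ?_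
    set a : ℝ := ((ε : ℤ) : ℝ) with ha
    set b : ℝ := ((η : ℤ) : ℝ) with hb
    have hsum : weakGrad (a • f + b • g) = weakGrad (f + g) ∧
        weakGrad (a • f - b • g) = weakGrad (f - g) ∨
        weakGrad (a • f + b • g) = weakGrad (f - g) ∧
        weakGrad (a • f - b • g) = weakGrad (f + g) := by
      have m1 : ∀ u : sobolevClass m, (-1 : ℝ) • u = -u := fun u => neg_one_smul ℝ u
      have n1 : -f - g = -(f + g) := by abel
      have n2 : -f + g = -(f - g) := by abel
      have n3 : -f + -g = -(f + g) := by abel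
      have n4 : -f - -g = -(f - g) := by abel
      have ha' : a = 1 ∨ a = -1 := by rcases Int.units_eq_one_or ε with h | h <;> simp [ha, h]
      have hb' : b = 1 ∨ b = -1 := by rcases Int.units_eq_one_or η with h | h <;> simp [hb, h]
      rcases ha' with h | h <;> rcases hb' with h' | h' <;> rw [h, h']
      · rw [one_smul, one_smul]
        exact Or.inl ⟨rfl, rfl⟩
      · rw [one_smul, m1, ← sub_eq_add_neg, sub_neg_eq_add]
        exact Or.inr ⟨rfl, rfl⟩
      · rw [one_smul, m1, n1, n2, weakGrad_neg, weakGrad_neg]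
        exact Or.inr ⟨rfl, rfl⟩
      · rw [m1, m1, n3, n4, weakGrad_neg, weakGrad_neg]
        exact Or.inl ⟨rfl, rfl⟩
    filter_upwards [ae_weakGrad_congr_add_const (W + V) (a • f + b • g)
        (-(a * (δ * k)) - b * (δ * l)),
      ae_weakGrad_congr_add_const (W - V) (a • f - b • g) (-(a * (δ * k)) + b * (δ * l)),
      coeFn_sobolev_add W V, coeFn_sobolev_sub W V, coeFn_sobolev_add (a • f) (b • g),
      coeFn_sobolev_sub (a • f) (b • g), coeFn_sobolev_smul a f, coeFn_sobolev_smul b g]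
      with x h1 h2 h3 h4 h5 h6 h7 h8 hW hV
    rw [h1 (by rw [h3, h5, h7, h8, hW, hV]; ring), h2 (by rw [h4, h6, h7, h8, hW, hV]; ring)]
    rcases hsum with ⟨e1, e2⟩ | ⟨e1, e2⟩
    · rw [e1, e2]
    · rw [e1, e2, add_comm]
  filter_upwards [h, coeFn_sobolevComp (lipschitzWith_zigzag hδ) f,
    coeFn_sobolevComp (lipschitzWith_zigzag hδ) g] with x hx hW hV
  obtain ⟨k, ε, hk⟩ := exists_zigzag_eq hδ ((f : M →ₘ[m] ℝ) x)
  obtain ⟨l, η, hl⟩ := exists_zigzag_eq hδ ((g : M →ₘ[m] ℝ) x)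
  exact hx k l ε η (hW.trans hk) (hV.trans hl)

/-- An element of `W^{1,2}` from a square integrable Sobolev function. -/
def W12.ofSobolev (f : sobolevClass m) (hf : MemLp (f : M →ₘ[m] ℝ) 2 m) : W12 m :=
  W12.mk ⟨(f : M →ₘ[m] ℝ), Lp.mem_Lp_iff_memLp.2 hf⟩ f.2

/-- Young's inequality with parameter δ: the mixed term costs δb² + (a - b)²/δ, and an error of
order δ stays small after division by δ. -/
lemma sq_le_of_abs_sub_le {a b e δ : ℝ} (hδ : 0 < δ) (h : |a - b| ≤ δ * e) :
    a ^ 2 ≤ (1 + δ) * b ^ 2 + (δ ^ 2 + δ) * e ^ 2 := by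
  have h1 : (a - b) ^ 2 ≤ (δ * e) ^ 2 := sq_le_sq.2 (h.trans (le_abs_self _))
  have h2 : 2 * (a - b) * b ≤ δ * b ^ 2 + (a - b) ^ 2 / δ := by
    have : 0 ≤ δ * (b - (a - b) / δ) ^ 2 := by positivity
    have e1 : δ * (b - (a - b) / δ) ^ 2 = δ * b ^ 2 - 2 * (a - b) * b + (a - b) ^ 2 / δ := by
      field_simp
      ring
    linarith
  have h3 : (a - b) ^ 2 / δ ≤ δ * e ^ 2 := by
    rw [div_le_iff₀ hδ]
    nlinarith
  nlinarith

lemma sobolevMul_add (ψ f g : sobolevClass m) (hψ : IsEssBounded (ψ : M →ₘ[m] ℝ))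
    (hf : IsEssBounded (f : M →ₘ[m] ℝ)) (hg : IsEssBounded (g : M →ₘ[m] ℝ))
    (hfg : IsEssBounded ((f + g : sobolevClass m) : M →ₘ[m] ℝ)) :
    sobolevMul ψ f hψ hf + sobolevMul ψ g hψ hg = sobolevMul ψ (f + g) hψ hfg := by
  refine Subtype.ext (AEEqFun.ext ?_)
  filter_upwards [coeFn_sobolev_add (sobolevMul ψ f hψ hf) (sobolevMul ψ g hψ hg),
    coeFn_sobolevMul ψ f hψ hf, coeFn_sobolevMul ψ g hψ hg, coeFn_sobolevMul ψ (f + g) hψ hfg,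
    coeFn_sobolev_add f g] with x h1 h2 h3 h4 h5
  rw [h1, h2, h3, h4, h5, mul_add]

lemma sobolevMul_sub (ψ f g : sobolevClass m) (hψ : IsEssBounded (ψ : M →ₘ[m] ℝ))
    (hf : IsEssBounded (f : M →ₘ[m] ℝ)) (hg : IsEssBounded (g : M →ₘ[m] ℝ))
    (hfg : IsEssBounded ((f - g : sobolevClass m) : M →ₘ[m] ℝ)) :
    sobolevMul ψ f hψ hf - sobolevMul ψ g hψ hg = sobolevMul ψ (f - g) hψ hfg := by
  refine Subtype.ext (AEEqFun.ext ?_)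
  filter_upwards [coeFn_sobolev_sub (sobolevMul ψ f hψ hf) (sobolevMul ψ g hψ hg),
    coeFn_sobolevMul ψ f hψ hf, coeFn_sobolevMul ψ g hψ hg, coeFn_sobolevMul ψ (f - g) hψ hfg,
    coeFn_sobolev_sub f g] with x h1 h2 h3 h4 h5
  rw [h1, h2, h3, h4, h5, mul_sub]

/-- The integrated parallelogram inequality with a weight. -/
lemma integral_weighted_parallelogram_le
    (hpar : ∀ a b : W12 m, ‖a + b‖ ^ 2 + ‖a - b‖ ^ 2 = 2 * ‖a‖ ^ 2 + 2 * ‖b‖ ^ 2)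
    (f g ψ : sobolevClass m) (hψ : MemLp (ψ : M →ₘ[m] ℝ) 2 m)
    (hψb : ∀ᵐ x ∂m, |(ψ : M →ₘ[m] ℝ) x| ≤ 1) :
    ∫ x, (ψ : M →ₘ[m] ℝ) x ^ 2 * (weakGrad (f + g) x ^ 2 + weakGrad (f - g) x ^ 2) ∂m ≤
      ∫ x, (ψ : M →ₘ[m] ℝ) x ^ 2 * (2 * weakGrad f x ^ 2 + 2 * weakGrad g x ^ 2) ∂m := by
  set L := ∫ x, (ψ : M →ₘ[m] ℝ) x ^ 2 * (weakGrad (f + g) x ^ 2 + weakGrad (f - g) x ^ 2) ∂m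
    with hL
  set R := ∫ x, (ψ : M →ₘ[m] ℝ) x ^ 2 * (2 * weakGrad f x ^ 2 + 2 * weakGrad g x ^ 2) ∂m with hR
  set K := ∫ x, weakGrad ψ x ^ 2 ∂m with hK
  set P := ∫ x, (ψ : M →ₘ[m] ℝ) x ^ 2 ∂m with hP
  have hψ2 : Integrable (fun x => (ψ : M →ₘ[m] ℝ) x ^ 2) m := hψ.integrable_sq
  have hKi := integrable_sq_coeFn (weakGrad ψ)
  have hbd : ∀ {u : M → ℝ}, Integrable u m →
      Integrable (fun x => (ψ : M →ₘ[m] ℝ) x ^ 2 * u x) m := fun {u} hu => by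
    refine hu.bdd_mul (c := 1) (ψ.1.measurable.pow_const 2).aestronglyMeasurable ?_
    filter_upwards [hψb] with x hx
    rw [Real.norm_eq_abs, abs_pow]
    exact pow_le_one₀ (abs_nonneg _) hx
  have hψE : IsEssBounded (ψ : M →ₘ[m] ℝ) := ⟨1, hψb⟩
  -- Each factor 1 + δ and each δ² + δ comes from `sq_le_of_abs_sub_le`. The zigzags are bounded by
  -- δ, and two terms with factor 2 give 4K; their sum and difference are bounded by 2δ, and two
  -- terms with error 2|Dψ| give 8K. The L² norms of the two products contribute 4δ²P.
  have main : ∀ δ : ℝ, 0 < δ → L ≤ (1 + δ) * ((1 + δ) * R + 4 * ((δ ^ 2 + δ) * K) + 4 * (δ ^ 2 * P))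
      + 8 * ((δ ^ 2 + δ) * K) := by
    intro δ hδ
    set W := sobolevComp (lipschitzWith_zigzag hδ) f with hW
    set V := sobolevComp (lipschitzWith_zigzag hδ) g with hV
    have bW : ∀ᵐ x ∂m, |(W : M →ₘ[m] ℝ) x| ≤ δ := by
      filter_upwards [coeFn_sobolevComp (lipschitzWith_zigzag hδ) f] with x hx
      rw [hW, hx]; exact abs_zigzag_le hδ _
    have bV : ∀ᵐ x ∂m, |(V : M →ₘ[m] ℝ) x| ≤ δ := by
      filter_upwards [coeFn_sobolevComp (lipschitzWith_zigzag hδ) g] with x hx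
      rw [hV, hx]; exact abs_zigzag_le hδ _
    have bA : ∀ᵐ x ∂m, |((W + V : sobolevClass m) : M →ₘ[m] ℝ) x| ≤ 2 * δ := by
      filter_upwards [bW, bV, coeFn_sobolev_add W V] with x h1 h2 h3
      rw [h3]; exact (abs_add_le _ _).trans (by linarith)
    have bS : ∀ᵐ x ∂m, |((W - V : sobolevClass m) : M →ₘ[m] ℝ) x| ≤ 2 * δ := by
      filter_upwards [bW, bV, coeFn_sobolev_sub W V] with x h1 h2 h3
      rw [h3]; exact (abs_sub _ _).trans (by linarith)
    set F := sobolevMul ψ W hψE ⟨δ, bW⟩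
    set G := sobolevMul ψ V hψE ⟨δ, bV⟩
    have hFA : F + G = sobolevMul ψ (W + V) hψE ⟨_, bA⟩ :=
      sobolevMul_add ψ W V hψE ⟨δ, bW⟩ ⟨δ, bV⟩ ⟨_, bA⟩
    have hFS : F - G = sobolevMul ψ (W - V) hψE ⟨_, bS⟩ :=
      sobolevMul_sub ψ W V hψE ⟨δ, bW⟩ ⟨δ, bV⟩ ⟨_, bS⟩
    have sqF : ∀ᵐ x ∂m, |(F : M →ₘ[m] ℝ) x| ≤ δ * |(ψ : M →ₘ[m] ℝ) x| := by
      filter_upwards [bW, coeFn_sobolevMul ψ W hψE ⟨δ, bW⟩] with x h1 h2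
      rw [h2, abs_mul, mul_comm]
      exact mul_le_mul_of_nonneg_right h1 (abs_nonneg _)
    have sqG : ∀ᵐ x ∂m, |(G : M →ₘ[m] ℝ) x| ≤ δ * |(ψ : M →ₘ[m] ℝ) x| := by
      filter_upwards [bV, coeFn_sobolevMul ψ V hψE ⟨δ, bV⟩] with x h1 h2
      rw [h2, abs_mul, mul_comm]
      exact mul_le_mul_of_nonneg_right h1 (abs_nonneg _)
    -- The bound δ|ψ| puts the products in L², although f and g themselves need not be square
    -- integrable.
    have mF : MemLp (F : M →ₘ[m] ℝ) 2 m :=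
      hψ.of_le_mul F.1.aestronglyMeasurable sqF
    have mG : MemLp (G : M →ₘ[m] ℝ) 2 m :=
      hψ.of_le_mul G.1.aestronglyMeasurable sqG
    set a := W12.ofSobolev F mF
    set b := W12.ofSobolev G mG
    have hab := hpar a b
    rw [W12.norm_sq, W12.norm_sq, W12.norm_sq, W12.norm_sq, map_add W12.toSobolevClass,
      map_sub W12.toSobolevClass, show a.toSobolevClass = F from rfl,
      show b.toSobolevClass = G from rfl] at hab
    have na : ‖a.toL2‖ ^ 2 ≤ δ ^ 2 * P := by
      rw [norm_sq_eq_integral, hP, ← integral_const_mul]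
      refine integral_mono_ae (integrable_sq_coeFn _) (hψ2.const_mul _) ?_
      filter_upwards [sqF] with x hx
      have := pow_le_pow_left₀ (abs_nonneg _) hx 2
      rwa [mul_pow, sq_abs, sq_abs] at this
    have nb : ‖b.toL2‖ ^ 2 ≤ δ ^ 2 * P := by
      rw [norm_sq_eq_integral, hP, ← integral_const_mul]
      refine integral_mono_ae (integrable_sq_coeFn _) (hψ2.const_mul _) ?_
      filter_upwards [sqG] with x hx
      have := pow_le_pow_left₀ (abs_nonneg _) hx 2
      rwa [mul_pow, sq_abs, sq_abs] at this
    -- The L² norms of F + G and F - G are dropped, which is why an inequality is obtained.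
    have hb1 : ‖weakGrad (F + G)‖ ^ 2 + ‖weakGrad (F - G)‖ ^ 2 ≤
        2 * (‖weakGrad F‖ ^ 2 + ‖weakGrad G‖ ^ 2) + 4 * (δ ^ 2 * P) := by
      nlinarith [sq_nonneg ‖(a + b).toL2‖, sq_nonneg ‖(a - b).toL2‖]
    have hup : 2 * (‖weakGrad F‖ ^ 2 + ‖weakGrad G‖ ^ 2) ≤
        (1 + δ) * R + 4 * ((δ ^ 2 + δ) * K) := by
      rw [norm_sq_eq_integral, norm_sq_eq_integral, hR, hK,
        ← integral_add (integrable_sq_coeFn _) (integrable_sq_coeFn _), ← integral_const_mul,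
        ← integral_const_mul, ← integral_const_mul, ← integral_const_mul, ← integral_add]
      · refine integral_mono_ae (((integrable_sq_coeFn _).add (integrable_sq_coeFn _)).const_mul _)
          (((hbd (((integrable_sq_coeFn _).const_mul 2).add
            ((integrable_sq_coeFn _).const_mul 2))).const_mul _).add
            ((hKi.const_mul _).const_mul _)) ?_
        filter_upwards [ae_abs_weakGrad_sobolevMul_sub_le ψ W hψE ⟨δ, bW⟩,
          ae_abs_weakGrad_sobolevMul_sub_le ψ V hψE ⟨δ, bV⟩, bW, bV, ae_weakGrad_zigzag hδ f,
          ae_weakGrad_zigzag hδ g, ae_weakGrad_nonneg' ψ] with x h1 h2 h3 h4 h5 h6 h7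
        rw [h5] at h1
        rw [h6] at h2
        have k1 := sq_le_of_abs_sub_le hδ (h1.trans (mul_le_mul_of_nonneg_right h3 h7))
        have k2 := sq_le_of_abs_sub_le hδ (h2.trans (mul_le_mul_of_nonneg_right h4 h7))
        rw [mul_pow, sq_abs] at k1 k2
        linarith
      · exact (hbd (((integrable_sq_coeFn _).const_mul 2).add
            ((integrable_sq_coeFn _).const_mul 2))).const_mul _
      · exact (hKi.const_mul _).const_mul _
    have hlow : L ≤ (1 + δ) * (‖weakGrad (F + G)‖ ^ 2 + ‖weakGrad (F - G)‖ ^ 2) +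
        8 * ((δ ^ 2 + δ) * K) := by
      rw [norm_sq_eq_integral, norm_sq_eq_integral, hL, hK,
        ← integral_add (integrable_sq_coeFn _) (integrable_sq_coeFn _), ← integral_const_mul,
        ← integral_const_mul, ← integral_const_mul, ← integral_add]
      · refine integral_mono_ae (hbd ((integrable_sq_coeFn _).add (integrable_sq_coeFn _)))
          ((((integrable_sq_coeFn _).add (integrable_sq_coeFn _)).const_mul _).add
            ((hKi.const_mul _).const_mul _)) ?_
        filter_upwards [ae_abs_weakGrad_sobolevMul_sub_le ψ (W + V) hψE ⟨_, bA⟩,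
          ae_abs_weakGrad_sobolevMul_sub_le ψ (W - V) hψE ⟨_, bS⟩, bA, bS,
          ae_weakGrad_zigzag_add_sub hδ f g, ae_weakGrad_nonneg' ψ] with x h1 h2 h3 h4 h5 h7
        rw [← hFA, abs_sub_comm] at h1
        rw [← hFS, abs_sub_comm] at h2
        have k1 := sq_le_of_abs_sub_le (e := 2 * weakGrad ψ x) hδ
          ((h1.trans (mul_le_mul_of_nonneg_right h3 h7)).trans (by linarith))
        have k2 := sq_le_of_abs_sub_le (e := 2 * weakGrad ψ x) hδ
          ((h2.trans (mul_le_mul_of_nonneg_right h4 h7)).trans (by linarith))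
        rw [mul_pow, sq_abs] at k1 k2
        rw [← h5]
        linarith
      · exact ((integrable_sq_coeFn _).add (integrable_sq_coeFn _)).const_mul _
      · exact (hKi.const_mul _).const_mul _
    refine hlow.trans (add_le_add ?_ le_rfl)
    refine mul_le_mul_of_nonneg_left ?_ (by linarith)
    linarith
  have hlim : Tendsto (fun δ : ℝ => (1 + δ) * ((1 + δ) * R + 4 * ((δ ^ 2 + δ) * K) +
      4 * (δ ^ 2 * P)) + 8 * ((δ ^ 2 + δ) * K)) (𝓝[>] 0) (𝓝 ((1 + 0) * ((1 + 0) * R +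
        4 * ((0 ^ 2 + 0) * K) + 4 * (0 ^ 2 * P)) + 8 * ((0 ^ 2 + 0) * K))) := by
    refine Tendsto.mono_left (Continuous.tendsto (f := fun δ : ℝ => (1 + δ) * ((1 + δ) * R +
      4 * ((δ ^ 2 + δ) * K) + 4 * (δ ^ 2 * P)) + 8 * ((δ ^ 2 + δ) * K)) (by fun_prop) 0)
      nhdsWithin_le_nhds
  have := ge_of_tendsto hlim (eventually_mem_nhdsWithin.mono main)
  simpa using this

/-- The weights are 1 minus thickened indicators of the closed complement of U. They are Lipschitz
with values in [0, 1], vanish off U, are admissible because U has finite measure, and tend to the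
indicator of U. -/
lemma setIntegral_isOpen_le {P Q : M → ℝ} (hP : Integrable P m) (hQ : Integrable Q m)
    (h : ∀ ψ : sobolevClass m, MemLp (ψ : M →ₘ[m] ℝ) 2 m → (∀ᵐ x ∂m, |(ψ : M →ₘ[m] ℝ) x| ≤ 1) →
      ∫ x, (ψ : M →ₘ[m] ℝ) x ^ 2 * P x ∂m ≤ ∫ x, (ψ : M →ₘ[m] ℝ) x ^ 2 * Q x ∂m)
    {U : Set M} (hU : IsOpen U) (hUfin : m U ≠ ∞) : ∫ x in U, P x ∂m ≤ ∫ x in U, Q x ∂m := by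
  have hpos : ∀ n : ℕ, (0 : ℝ) < 1 / ((n : ℝ) + 1) := fun n => by positivity
  set ψ : ℕ → M → ℝ := fun n x => 1 - ((thickenedIndicator (hpos n) Uᶜ x : ℝ≥0) : ℝ) with hψ
  have hψ01 : ∀ n x, 0 ≤ ψ n x ∧ ψ n x ≤ 1 := fun n x => by
    have h1 : (thickenedIndicator (hpos n) Uᶜ x : ℝ) ≤ 1 :=
      thickenedIndicator_le_one (hpos n) Uᶜ x
    have h2 : (0 : ℝ) ≤ (thickenedIndicator (hpos n) Uᶜ x : ℝ) := NNReal.coe_nonneg _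
    exact ⟨by simp only [hψ]; linarith, by simp only [hψ]; linarith⟩
  have hψU : ∀ n x, x ∉ U → ψ n x = 0 := fun n x hx => by
    simp only [hψ]
    rw [thickenedIndicator_one (hpos n) Uᶜ hx]
    simp
  have hψL : ∀ n : ℕ, LipschitzWith ((1 / (((n : ℕ) : ℝ) + 1)).toNNReal⁻¹) (ψ n) := fun n => by
    have h1 := lipschitzWith_thickenedIndicator (hpos n) Uᶜ
    refine LipschitzWith.of_dist_le_mul fun x y => ?_
    have h2 := h1.dist_le_mul x y
    rw [NNReal.dist_eq] at h2
    rw [Real.dist_eq, abs_sub_comm]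
    simp only [hψ]
    rwa [sub_sub_sub_cancel_left]
  have hψlim : ∀ x, Tendsto (fun n => ψ n x) atTop (𝓝 (U.indicator (fun _ => (1 : ℝ)) x)) := by
    intro x
    have h1 := thickenedIndicator_tendsto_indicator_closure hpos
      tendsto_one_div_add_atTop_nhds_zero_nat Uᶜ
    rw [tendsto_pi_nhds] at h1
    have h2 := (NNReal.tendsto_coe.2 (h1 x)).const_sub 1
    rw [hU.isClosed_compl.closure_eq] at h2
    convert h2 using 2
    by_cases hx : x ∈ U <;> simp [hx]
  have hmeas : ∀ n, AEStronglyMeasurable (ψ n) m := fun n =>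
    (hψL n).continuous.aestronglyMeasurable
  have hfin : ∀ n, m {x | ψ n x ≠ 0} ≠ ∞ := fun n =>
    ne_top_of_le_ne_top hUfin (measure_mono fun x hx => by
      by_contra hxU
      exact hx (hψU n x hxU))
  have hMem : ∀ n, MemLp (ψ n) 2 m := fun n => by
    have h1 : MemLp (U.indicator fun _ => (1 : ℝ)) 2 m :=
      memLp_indicator_const 2 hU.measurableSet 1 (Or.inr hUfin)
    refine h1.mono (hmeas n) (Eventually.of_forall fun x => ?_)
    by_cases hx : x ∈ U
    · rw [Set.indicator_of_mem hx, norm_one, Real.norm_eq_abs, abs_of_nonneg (hψ01 n x).1]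
      exact (hψ01 n x).2
    · rw [hψU n x hx, norm_zero]; exact norm_nonneg _
  have hn : ∀ n, ∫ x, ψ n x ^ 2 * P x ∂m ≤ ∫ x, ψ n x ^ 2 * Q x ∂m := fun n => by
    have hc : AEEqFun.mk (ψ n) (hmeas n) =ᵐ[m] ψ n := AEEqFun.coeFn_mk _ _
    have h1 := h ⟨AEEqFun.mk (ψ n) (hmeas n), mem_sobolevClass_of_lipschitzWith (hψL n) (hfin n) hc⟩
      ((memLp_congr_ae hc).2 (hMem n)) (hc.mono fun x hx => by
        change |(AEEqFun.mk (ψ n) (hmeas n)) x| ≤ 1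
        rw [hx, abs_of_nonneg (hψ01 n x).1]; exact (hψ01 n x).2)
    refine le_trans (le_of_eq ?_) (h1.trans (le_of_eq ?_))
    · refine integral_congr_ae ?_
      filter_upwards [hc] with x hx
      rw [hx]
    · refine integral_congr_ae ?_
      filter_upwards [hc] with x hx
      rw [hx]
  have hconv : ∀ u : M → ℝ, Integrable u m →
      Tendsto (fun n => ∫ x, ψ n x ^ 2 * u x ∂m) atTop (𝓝 (∫ x in U, u x ∂m)) := by
    intro u hu
    rw [← integral_indicator hU.measurableSet]
    refine tendsto_integral_of_dominated_convergence (fun x => ‖u x‖) (fun n => ?_) hu.norm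
      (fun n => Eventually.of_forall fun x => ?_) (Eventually.of_forall fun x => ?_)
    · exact ((hmeas n).pow 2).mul hu.aestronglyMeasurable
    · rw [norm_mul, Real.norm_eq_abs, abs_pow, abs_of_nonneg (hψ01 n x).1]
      exact mul_le_of_le_one_left (norm_nonneg _) (pow_le_one₀ (hψ01 n x).1 (hψ01 n x).2)
    · have h1 := ((hψlim x).pow 2).mul_const (u x)
      convert h1 using 2
      by_cases hx : x ∈ U <;> simp [hx]
  exact le_of_tendsto_of_tendsto' (hconv P hP) (hconv Q hQ) hn

/-- Outer regularity approximates a Borel set of finite measure by open sets from outside, and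
absolute continuity of the integral transfers the inequality to it. -/
lemma ae_le_of_setIntegral_isOpen_le [m.OuterRegular] {P Q : M → ℝ} (hP : Integrable P m)
    (hQ : Integrable Q m)
    (h : ∀ U : Set M, IsOpen U → m U ≠ ∞ → ∫ x in U, P x ∂m ≤ ∫ x in U, Q x ∂m) :
    ∀ᵐ x ∂m, P x ≤ Q x := by
  have hi : Integrable (fun x => Q x - P x) m := hQ.sub hP
  have key : 0 ≤ᵐ[m] fun x => Q x - P x := by
    refine ae_nonneg_of_forall_setIntegral_nonneg hi fun A hA hAfin => ?_
    have hex : ∀ n : ℕ, ∃ U, A ⊆ U ∧ IsOpen U ∧ m U < ∞ ∧ m (U \ A) < ((n : ℝ≥0∞) + 1)⁻¹ :=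
      fun n => hA.exists_isOpen_sdiff_lt hAfin.ne (by simp)
    choose U hAU hUo hUf hUA using hex
    have h0 : Tendsto (fun n => m (U n \ A)) atTop (𝓝 0) := by
      have h1 : Tendsto (fun n : ℕ => ((n : ℝ≥0∞) + 1)⁻¹) atTop (𝓝 0) := by
        have := (tendsto_add_atTop_iff_nat 1).2 ENNReal.tendsto_inv_nat_nhds_zero
        simpa using this
      exact tendsto_of_tendsto_of_tendsto_of_le_of_le tendsto_const_nhds h1
        (fun n => zero_le) fun n => (hUA n).le
    have h1 := hi.tendsto_setIntegral_nhds_zero h0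
    have h2 : ∀ n, 0 ≤ ∫ x in A, (Q x - P x) ∂m + ∫ x in U n \ A, (Q x - P x) ∂m := fun n => by
      have h3 : ∫ x in U n, (Q x - P x) ∂m =
          ∫ x in A, (Q x - P x) ∂m + ∫ x in U n \ A, (Q x - P x) ∂m := by
        rw [← setIntegral_union Set.disjoint_sdiff_right ((hUo n).measurableSet.diff hA)
          hi.integrableOn hi.integrableOn, Set.union_sdiff_cancel (hAU n)]
      rw [← h3, integral_sub hQ.integrableOn hP.integrableOn]
      exact sub_nonneg.2 (h (U n) (hUo n) (hUf n).ne)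
    have h3 := h1.const_add (∫ x in A, (Q x - P x) ∂m)
    rw [add_zero] at h3
    exact ge_of_tendsto' h3 h2
  filter_upwards [key] with x hx
  exact sub_nonneg.1 hx

lemma IsHilbertSpace.parallelogram {V : Type*} [NormedAddCommGroup V] [inst : NormedSpace ℝ V]
    (h : IsHilbertSpace V) (a b : V) : ‖a + b‖ ^ 2 + ‖a - b‖ ^ 2 = 2 * ‖a‖ ^ 2 + 2 * ‖b‖ ^ 2 := by
  obtain ⟨-, i, rfl⟩ := h
  have := parallelogram_law_with_norm ℝ a b
  nlinarith

/-- This is the Jordan-von Neumann theorem; the scalar product built from the norm keeps the given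
normed space structure definitionally. -/
lemma IsHilbertSpace.of_parallelogram {V : Type*} [NormedAddCommGroup V] [inst : NormedSpace ℝ V]
    [CompleteSpace V]
    (h : ∀ a b : V, ‖a + b‖ ^ 2 + ‖a - b‖ ^ 2 = 2 * ‖a‖ ^ 2 + 2 * ‖b‖ ^ 2) : IsHilbertSpace V :=
  ⟨inferInstance, InnerProductSpace.ofNorm ℝ fun x y => by
    have := h x y
    nlinarith, rfl⟩

lemma InfinitesimallyHilbertian.pointwiseParallelogram [IsLocallyFiniteMeasure m]
    (h : InfinitesimallyHilbertian m) : PointwiseParallelogram m := by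
  refine PointwiseParallelogram.of_bounded_le fun f g _ _ => ?_
  have hP : Integrable (fun x => weakGrad (f + g) x ^ 2 + weakGrad (f - g) x ^ 2) m :=
    (integrable_sq_coeFn _).add (integrable_sq_coeFn _)
  have hQ : Integrable (fun x => 2 * weakGrad f x ^ 2 + 2 * weakGrad g x ^ 2) m :=
    ((integrable_sq_coeFn _).const_mul 2).add ((integrable_sq_coeFn _).const_mul 2)
  exact ae_le_of_setIntegral_isOpen_le hP hQ fun U hU hUf =>
    setIntegral_isOpen_le hP hQ (fun ψ hψ hψb =>
      integral_weighted_parallelogram_le h.parallelogram f g ψ hψ hψb) hU hUf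

lemma PointwiseParallelogram.infinitesimallyHilbertian (h : PointwiseParallelogram m) :
    InfinitesimallyHilbertian m := by
  refine IsHilbertSpace.of_parallelogram fun a b => ?_
  rw [W12.norm_sq, W12.norm_sq, W12.norm_sq, W12.norm_sq, map_add, map_add, map_sub, map_sub]
  have h1 : ‖a.toL2 + b.toL2‖ ^ 2 + ‖a.toL2 - b.toL2‖ ^ 2 =
      2 * ‖a.toL2‖ ^ 2 + 2 * ‖b.toL2‖ ^ 2 := by
    have := parallelogram_law_with_norm ℝ a.toL2 b.toL2
    nlinarith
  have h2 : ‖weakGrad (a.toSobolevClass + b.toSobolevClass)‖ ^ 2 +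
      ‖weakGrad (a.toSobolevClass - b.toSobolevClass)‖ ^ 2 =
      2 * ‖weakGrad a.toSobolevClass‖ ^ 2 + 2 * ‖weakGrad b.toSobolevClass‖ ^ 2 := by
    simp only [norm_sq_eq_integral]
    rw [← integral_add (integrable_sq_coeFn _) (integrable_sq_coeFn _), ← integral_const_mul,
      ← integral_const_mul, ← integral_add ((integrable_sq_coeFn _).const_mul _)
        ((integrable_sq_coeFn _).const_mul _)]
    exact integral_congr_ae (h _ _)
  linarith

end Parallelogram

end

end MMS

namespace MMS

noncomputable section

/-! ## The pointwise norm of 1-forms -/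

section LpMul

variable {M : Type*} [MeasurableSpace M] {m : Measure M}

variable (m) in
/-- Multiplication `L^p × L^q → L^r` as a bounded bilinear map. -/
def lpMul (p q r : ℝ≥0∞) [Fact (1 ≤ p)] [Fact (1 ≤ q)] [Fact (1 ≤ r)] [ENNReal.HolderTriple p q r] :
    Lp ℝ p m →L[ℝ] Lp ℝ q m →L[ℝ] Lp ℝ r m :=
  (ContinuousLinearMap.mul ℝ ℝ).holderL m p q r

lemma coeFn_lpMul {p q r : ℝ≥0∞} [Fact (1 ≤ p)] [Fact (1 ≤ q)] [Fact (1 ≤ r)]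
    [ENNReal.HolderTriple p q r] (F : Lp ℝ p m) (G : Lp ℝ q m) :
    lpMul m p q r F G =ᵐ[m] fun x => F x * G x :=
  (ContinuousLinearMap.mul ℝ ℝ).coeFn_holder F G

lemma norm_lpMul_le {p q r : ℝ≥0∞} [Fact (1 ≤ p)] [Fact (1 ≤ q)] [Fact (1 ≤ r)]
    [ENNReal.HolderTriple p q r] (F : Lp ℝ p m) (G : Lp ℝ q m) :
    ‖lpMul m p q r F G‖ ≤ ‖F‖ * ‖G‖ := by
  have := (ContinuousLinearMap.mul ℝ ℝ).norm_holder_apply_apply_le (r := r) F G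
  rwa [ContinuousLinearMap.opNorm_mul, one_mul] at this

end LpMul

/-! ### Seminorm properties of the pointwise norm, its behaviour under multiplication, and the
differential. -/

section PointwiseNorm

variable {M : Type*} [MetricSpace M] [SecondCountableTopology M] [MeasurableSpace M]
  [BorelSpace M] {m : Measure M}

lemma continuous_cotangentNorm : Continuous (cotangentNorm : Cotangent m → Lp ℝ 2 m) :=
  UniformSpace.Completion.continuous_extension

lemma cotangentNorm_nonneg (ω : Cotangent m) : 0 ≤ cotangentNorm ω := by
  refine UniformSpace.Completion.induction_on ω ?_ fun φ => ?_
  · exact isClosed_le continuous_const continuous_cotangentNorm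
  · rw [cotangentNorm_coe]
    exact φ.ptNorm_nonneg

lemma ae_cotangentNorm_nonneg (ω : Cotangent m) : ∀ᵐ x ∂m, 0 ≤ cotangentNorm ω x :=
  (Lp.coeFn_nonneg _).2 (cotangentNorm_nonneg ω)

lemma ae_cotangentNorm_add_le (ω η : Cotangent m) :
    ∀ᵐ x ∂m, cotangentNorm (ω + η) x ≤ cotangentNorm ω x + cotangentNorm η x := by
  have : cotangentNorm (ω + η) ≤ cotangentNorm ω + cotangentNorm η := by
    refine UniformSpace.Completion.induction_on₂ ω η ?_ fun φ ψ => ?_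
    · exact isClosed_le (continuous_cotangentNorm.comp (continuous_fst.add continuous_snd))
        ((continuous_cotangentNorm.comp continuous_fst).add
          (continuous_cotangentNorm.comp continuous_snd))
    · rw [← UniformSpace.Completion.coe_add, cotangentNorm_coe, cotangentNorm_coe,
        cotangentNorm_coe]
      exact PreCotangent.ptNorm_add_le φ ψ
  filter_upwards [(Lp.coeFn_le _ _).2 this, Lp.coeFn_add (cotangentNorm ω) (cotangentNorm η)]
    with x h1 h2
  rwa [h2] at h1

lemma cotangentNorm_smul (c : ℝ) (ω : Cotangent m) :
    cotangentNorm (c • ω) = |c| • cotangentNorm ω := by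
  refine UniformSpace.Completion.induction_on ω ?_ fun φ => ?_
  · exact isClosed_eq (continuous_cotangentNorm.comp (continuous_const_smul c))
      ((continuous_const_smul |c|).comp continuous_cotangentNorm)
  · rw [← UniformSpace.Completion.coe_smul, cotangentNorm_coe, cotangentNorm_coe,
      PreCotangent.ptNorm_smul]

lemma ae_cotangentNorm_smul (c : ℝ) (ω : Cotangent m) :
    ∀ᵐ x ∂m, cotangentNorm (c • ω) x = |c| * cotangentNorm ω x := by
  rw [cotangentNorm_smul]
  exact Lp.coeFn_smul |c| (cotangentNorm ω)

lemma cotangentNorm_neg (ω : Cotangent m) : cotangentNorm (-ω) = cotangentNorm ω := by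
  rw [← neg_one_smul ℝ ω, cotangentNorm_smul]
  simp

lemma cotangentNorm_sub_comm (ω η : Cotangent m) :
    cotangentNorm (ω - η) = cotangentNorm (η - ω) := by
  rw [← neg_sub, cotangentNorm_neg]

lemma cotangentNorm_zero : cotangentNorm (0 : Cotangent m) = 0 := by
  simpa using cotangentNorm_smul 0 (0 : Cotangent m)

lemma cotangentNorm_eq_zero {ω : Cotangent m} (h : ∀ᵐ x ∂m, cotangentNorm ω x = 0) : ω = 0 := by
  have : cotangentNorm ω = 0 := (Lp.eq_zero_iff_ae_eq_zero).2 h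
  rw [← norm_eq_zero, ← norm_cotangentNorm, this, norm_zero]

lemma ae_abs_cotangentNorm_sub_le (ω η : Cotangent m) :
    ∀ᵐ x ∂m, |cotangentNorm ω x - cotangentNorm η x| ≤ cotangentNorm (ω - η) x := by
  have h1 := ae_cotangentNorm_add_le (ω - η) η
  have h2 := ae_cotangentNorm_add_le (η - ω) ω
  rw [sub_add_cancel, cotangentNorm_sub_comm] at h2
  rw [sub_add_cancel] at h1
  filter_upwards [h1, h2] with x h1 h2
  rw [abs_le]
  constructor <;> linarith

lemma norm_sq_cotangent (ω : Cotangent m) : ‖ω‖ ^ 2 = ∫ x, cotangentNorm ω x ^ 2 ∂m := by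
  rw [← norm_cotangentNorm, norm_sq_eq_integral]

/-- For the countably valued approximations of h the formula is the homogeneity of |Df| on each
piece; their uniform convergence and density of the pre-cotangent module give the general case. -/
lemma cotangentNorm_cotangentMul (h : Lp ℝ ∞ m) (ω : Cotangent m) :
    cotangentNorm (cotangentMul h ω) = lpMul m ∞ 2 2 |h| (cotangentNorm ω) := by
  refine UniformSpace.Completion.induction_on ω ?_ fun φ => ?_
  · exact isClosed_eq (continuous_cotangentNorm.comp (cotangentMul h).continuous)
      ((lpMul m ∞ 2 2 |h|).continuous.comp continuous_cotangentNorm)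
  · rw [cotangentMul_coe, cotangentNorm_coe]
    have h1 : Tendsto (fun n => cotangentNorm (mulSeq h φ n)) atTop
        (𝓝 (cotangentNorm (preMul h φ))) :=
      (continuous_cotangentNorm.tendsto _).comp (tendsto_preMul h φ)
    refine tendsto_nhds_unique h1 ?_
    rw [tendsto_iff_norm_sub_tendsto_zero]
    have h2 : Tendsto (fun n : ℕ => 1 / ((n : ℝ) + 1) * ‖φ.ptNorm‖) atTop
        (𝓝 (0 * ‖φ.ptNorm‖)) := tendsto_one_div_add_atTop_nhds_zero_nat.mul_const _
    rw [zero_mul] at h2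
    refine squeeze_zero (fun n => norm_nonneg _) (fun n => ?_) h2
    refine Lp.norm_le_mul_norm_of_ae_le_mul ?_
    rw [mulSeq, cotangentNorm_coe]
    filter_upwards [Lp.coeFn_sub (φ.mul (isAdmissible_approx h n)).ptNorm
        (lpMul m ∞ 2 2 |h| φ.ptNorm), coeFn_lpMul (r := 2) |h| φ.ptNorm, Lp.coeFn_abs h,
      (φ.mul (isAdmissible_approx h n)).coeFn_ptNorm, φ.coeFn_ptNorm,
      ae_weakGrad_smul (isAdmissible_approx h n).countablyValued φ.2.1] with x e1 e2 e3 e4 e5 e6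
    have e7 : weakGrad ((φ.mul (isAdmissible_approx h n)).1 x) x =
        |approx h n x| * weakGrad (φ.1 x) x := e6
    rw [e1, Pi.sub_apply, e2, e3, e4, e7, e5, ← sub_mul, norm_mul]
    refine mul_le_mul_of_nonneg_right ?_ (norm_nonneg _)
    refine (abs_abs_sub_abs_le_abs_sub _ _).trans ?_
    rw [abs_sub_comm]
    exact abs_sub_approx_le h n x

lemma ae_cotangentNorm_mul (h : Lp ℝ ∞ m) (ω : Cotangent m) :
    ∀ᵐ x ∂m, cotangentNorm (LinftyPremodule.mul h ω) x = |h x| * cotangentNorm ω x := by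
  change ∀ᵐ x ∂m, cotangentNorm (cotangentMul h ω) x = |h x| * cotangentNorm ω x
  rw [cotangentNorm_cotangentMul]
  filter_upwards [coeFn_lpMul (r := 2) |h| (cotangentNorm ω), Lp.coeFn_abs h] with x h1 h2
  rw [h1, h2]

lemma ae_cotangentNorm_chi {A : Set M} (hA : MeasurableSet A) (ω : Cotangent m) :
    ∀ᵐ x ∂m, cotangentNorm (LinftyPremodule.mul (chi m hA) ω) x =
      A.indicator (cotangentNorm ω) x := by
  filter_upwards [ae_cotangentNorm_mul (chi m hA) ω, coeFn_chi m hA] with x h1 h2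
  rw [h1, h2]
  by_cases hx : x ∈ A <;> simp [hx]

lemma continuous_mul (h : Lp ℝ ∞ m) :
    Continuous fun ω : Cotangent m => LinftyPremodule.mul h ω := (cotangentMul h).continuous

lemma differential_add (f g : sobolevClass m) :
    differential (f + g) = differential f + differential g := by
  rw [differential, differential, differential, ← UniformSpace.Completion.coe_add]
  rfl

lemma differential_smul (c : ℝ) (f : sobolevClass m) :
    differential (c • f) = c • differential f := by
  rw [differential, differential, ← UniformSpace.Completion.coe_smul]
  rfl

lemma differential_neg (f : sobolevClass m) : differential (-f) = -differential f := by
  rw [← neg_one_smul ℝ f, differential_smul, neg_one_smul]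

lemma differential_sub (f g : sobolevClass m) :
    differential (f - g) = differential f - differential g := by
  rw [sub_eq_add_neg, differential_add, differential_neg, sub_eq_add_neg]

/-- The Leibniz rule for the differential. -/
lemma differential_sobolevMul (f g : sobolevClass m) (hf : IsEssBounded (f : M →ₘ[m] ℝ))
    (hg : IsEssBounded (g : M →ₘ[m] ℝ)) (f' g' : Lp ℝ ∞ m) (hf' : f' =ᵐ[m] (f : M →ₘ[m] ℝ))
    (hg' : g' =ᵐ[m] (g : M →ₘ[m] ℝ)) :
    differential (sobolevMul f g hf hg) =
      LinftyPremodule.mul f' (differential g) + LinftyPremodule.mul g' (differential f) := by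
  have h1 : Tendsto (fun n => mulSeq f' (.ofSobolev g) n + mulSeq g' (.ofSobolev f) n) atTop
      (𝓝 (LinftyPremodule.mul f' (differential g) + LinftyPremodule.mul g' (differential f))) := by
    change Tendsto _ _ (𝓝 (cotangentMul f' (differential g) + cotangentMul g' (differential f)))
    rw [differential, differential, cotangentMul_coe, cotangentMul_coe]
    exact (tendsto_preMul _ _).add (tendsto_preMul _ _)
  refine tendsto_nhds_unique ?_ h1
  rw [tendsto_iff_norm_sub_tendsto_zero]
  have h2 : Tendsto (fun n : ℕ => 1 / ((n : ℝ) + 1) * ‖weakGrad g + weakGrad f‖) atTop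
      (𝓝 (0 * ‖weakGrad g + weakGrad f‖)) :=
    tendsto_one_div_add_atTop_nhds_zero_nat.mul_const _
  rw [zero_mul] at h2
  refine squeeze_zero (fun n => norm_nonneg _) (fun n => ?_) h2
  set a := isAdmissible_approx f' n
  set b := isAdmissible_approx g' n
  set φ := (PreCotangent.ofSobolev g).mul a + (PreCotangent.ofSobolev f).mul b
  have e : mulSeq f' (.ofSobolev g) n + mulSeq g' (.ofSobolev f) n -
      differential (sobolevMul f g hf hg) =
      ((φ - PreCotangent.ofSobolev (sobolevMul f g hf hg) : PreCotangent m) : Cotangent m) := by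
    rw [UniformSpace.Completion.coe_sub, UniformSpace.Completion.coe_add]
    rfl
  rw [e, UniformSpace.Completion.norm_coe, norm_sub_rev, PreCotangent.norm_def]
  refine Lp.norm_le_mul_norm_of_ae_le_mul ?_
  -- On each common level set the approximations of f and g are constants c and d, for which
  -- `ae_weakGrad_sobolevMul_sub_le` holds; there are countably many such sets.
  have h3 := (a.countablyValued.comp₂ b.countablyValued Prod.mk).ae_of_forall
    (p := fun s x => weakGrad (sobolevMul f g hf hg - (s.1 • g + s.2 • f)) x ≤
      |(f : M →ₘ[m] ℝ) x - s.1| * weakGrad g x + |(g : M →ₘ[m] ℝ) x - s.2| * weakGrad f x)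
    fun s => ae_weakGrad_sobolevMul_sub_le f g hf hg s.1 s.2
  filter_upwards [h3, PreCotangent.coeFn_ptNorm
      (PreCotangent.ofSobolev (sobolevMul f g hf hg) - φ), Lp.coeFn_add (weakGrad g) (weakGrad f),
    ae_weakGrad_nonneg' f, ae_weakGrad_nonneg' g,
    (Lp.coeFn_nonneg _).2 (PreCotangent.ptNorm_nonneg
      (PreCotangent.ofSobolev (sobolevMul f g hf hg) - φ)), hf', hg'] with x h3 h4 h5 h6 h7 h8 h9 h10
  have h8 : 0 ≤ (PreCotangent.ofSobolev (sobolevMul f g hf hg) - φ).ptNorm x := h8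
  rw [Real.norm_of_nonneg h8, h5, Pi.add_apply, Real.norm_of_nonneg (add_nonneg h7 h6), h4, mul_add]
  refine h3.trans (add_le_add ?_ ?_)
  · rw [← h9]
    exact mul_le_mul_of_nonneg_right (abs_sub_approx_le f' n x) h7
  · rw [← h10]
    exact mul_le_mul_of_nonneg_right (abs_sub_approx_le g' n x) h6

end PointwiseNorm

end

end MMS

namespace MMS

noncomputable section

/-! ## The cotangent module is an `L^∞`-module -/

section Module

variable {M : Type*} [MeasurableSpace M] {m : Measure M}

lemma smul_comm_Linfty (f g : Lp ℝ ∞ m) : (f • g : Lp ℝ ∞ m) = (g • f : Lp ℝ ∞ m) := by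
  refine Lp.ext ?_
  filter_upwards [Lp.coeFn_lpSMul (r := ∞) f g, Lp.coeFn_lpSMul (r := ∞) g f] with x h1 h2
  rw [h1, h2, Pi.smul_apply', Pi.smul_apply', smul_eq_mul, smul_eq_mul, mul_comm]

lemma chi_smul_chi {A B : Set M} (hA : MeasurableSet A) (hB : MeasurableSet B) :
    (chi m hA • chi m hB : Lp ℝ ∞ m) = chi m (hA.inter hB) := by
  refine Lp.ext ?_
  filter_upwards [Lp.coeFn_lpSMul (r := ∞) (chi m hA) (chi m hB), coeFn_chi m hA, coeFn_chi m hB,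
    coeFn_chi m (hA.inter hB)] with x h1 h2 h3 h4
  rw [h1, h4, Pi.smul_apply', h2, h3]
  by_cases ha : x ∈ A <;> by_cases hb : x ∈ B <;> simp [ha, hb]

variable {V : Type*} [NormedAddCommGroup V] [NormedSpace ℝ V] [LinftyPremodule m V]

lemma LinftyPremodule.mul_mul_comm (f g : Lp ℝ ∞ m) (v : V) :
    mul f (mul g v) = mul g (mul f v) := by
  rw [← mul_mul, ← mul_mul, smul_comm_Linfty]

lemma LinftyPremodule.chi_mul_chi {A B : Set M} (hA : MeasurableSet A) (hB : MeasurableSet B)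
    (v : V) : mul (chi m hA) (mul (chi m hB) v) = mul (chi m (hA.inter hB)) v := by
  rw [← mul_mul, chi_smul_chi]

lemma LinftyPremodule.chi_mul_chi_of_subset {A B : Set M} (hA : MeasurableSet A)
    (hB : MeasurableSet B) (h : A ⊆ B) (v : V) :
    mul (chi m hA) (mul (chi m hB) v) = mul (chi m hA) v := by
  rw [chi_mul_chi]
  have : ∀ {C : Set M} (hC : MeasurableSet C), C = A → chi m hC = chi m hA := by
    rintro C hC rfl
    rfl
  rw [this _ (Set.inter_eq_left.2 h)]

open LinftyPremodule

lemma Linfty.coeFn_const_smul_chi_univ (c : ℝ) :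
    (c • chi m MeasurableSet.univ : Lp ℝ ∞ m) =ᵐ[m] fun _ => c := by
  filter_upwards [Lp.coeFn_smul c (chi m MeasurableSet.univ), coeFn_chi m MeasurableSet.univ]
    with x h1 h2
  rw [h1, Pi.smul_apply, h2]
  simp

/-- Cutting off at δ keeps the inverse of a pointwise norm bounded, so that a form can be normalized
to pointwise norm at most 1 inside the module. -/
lemma exists_Linfty_eq_inv_max {δ : ℝ} (hδ : 0 < δ) (G : Lp ℝ 2 m) :
    ∃ f : Lp ℝ ∞ m, f =ᵐ[m] fun x => (max (G x) δ)⁻¹ := by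
  have hG : Measurable G := (Lp.stronglyMeasurable G).measurable
  have hmem : MemLp (fun x => (max (G x) δ)⁻¹) ∞ m := by
    refine memLp_top_of_bound (hG.max measurable_const).inv.aestronglyMeasurable δ⁻¹
      (Eventually.of_forall fun x => ?_)
    have : 0 < max (G x) δ := lt_max_of_lt_right hδ
    rw [Real.norm_of_nonneg (inv_nonneg.2 this.le)]
    exact inv_anti₀ hδ (le_max_right _ _)
  exact ⟨hmem.toLp, hmem.coeFn_toLp⟩

lemma mul_const_smul_chi_univ {V : Type*} [NormedAddCommGroup V] [NormedSpace ℝ V]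
    [LinftyPremodule m V] (c : ℝ) (v : V) :
    mul (c • chi m MeasurableSet.univ : Lp ℝ ∞ m) v = c • v := by
  rw [map_smul, LinearMap.smul_apply, LinftyPremodule.one_mul]

/-- Used to transport the module axioms from L²(T*M) to L²(TM) along the Riesz isomorphism. -/
lemma IsHilbertModule.of_linearIsometryEquiv {V W : Type*} [NormedAddCommGroup V] [NormedSpace ℝ V]
    [LinftyPremodule m V] [NormedAddCommGroup W] [NormedSpace ℝ W] [LinftyPremodule m W]
    (e : V ≃ₗᵢ[ℝ] W) (he : ∀ (f : Lp ℝ ∞ m) (v : V), e (mul f v) = mul f (e v))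
    (h : IsHilbertModule m V) : IsHilbertModule m W := by
  have he' : ∀ (f : Lp ℝ ∞ m) (w : W), e.symm (mul f w) = mul f (e.symm w) := fun f w => by
    rw [e.symm_apply_eq, he, e.apply_symm_apply]
  have := h.1.complete
  have hcW : CompleteSpace W := (completeSpace_congr (e := e.toEquiv) e.isometry.isUniformEmbedding).1 this
  refine ⟨⟨hcW, fun v A hA hv => ?_, fun v A hA hc hb => ?_⟩, IsHilbertSpace.of_parallelogram fun a b => ?_⟩
  · have := h.1.locality (e.symm v) A hA fun n => by rw [← he', hv, map_zero]
    rw [← he', e.symm_apply_eq, map_zero] at this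
    exact this
  · have hs : ∀ n, ‖∑ i ∈ Finset.range n, mul (chi m (hA i)) (e.symm (v i))‖ =
        ‖∑ i ∈ Finset.range n, mul (chi m (hA i)) (v i)‖ := fun n => by
      rw [← e.norm_map, map_sum]
      simp only [he, e.apply_symm_apply]
    obtain ⟨w, hw1, hw2⟩ := h.1.gluing (fun i => e.symm (v i)) A hA
      (fun i j => by rw [← he', ← he', hc]) (by simpa only [hs] using hb)
    refine ⟨e w, fun i => ?_, ?_⟩
    · rw [← he, hw1, he, e.apply_symm_apply]
    · rw [e.norm_map]
      simpa only [hs] using hw2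
  · have := h.2.parallelogram (e.symm a) (e.symm b)
    rwa [← map_add, ← map_sub, e.symm.norm_map, e.symm.norm_map, e.symm.norm_map,
      e.symm.norm_map] at this

end Module

/-! ### Locality and gluing in L²(T*M). -/

section CotangentModule

variable {M : Type*} [MetricSpace M] [SecondCountableTopology M] [MeasurableSpace M]
  [BorelSpace M] {m : Measure M}

open LinftyPremodule

/-- A Pythagorean identity for forms concentrated on disjoint sets; it holds in every cotangent
module because the norm is an L² norm of a pointwise norm. -/
lemma norm_sq_mul_chi_add {A : Set M} (hA : MeasurableSet A) (ω : Cotangent m) :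
    ‖ω‖ ^ 2 = ‖mul (chi m hA) ω‖ ^ 2 + ‖ω - mul (chi m hA) ω‖ ^ 2 := by
  have e : ω - mul (chi m hA) ω = mul (chi m hA.compl) ω := by
    have h1 : chi m hA + chi m hA.compl = chi m MeasurableSet.univ := by
      refine Lp.ext ?_
      filter_upwards [Lp.coeFn_add (chi m hA) (chi m hA.compl), coeFn_chi m hA,
        coeFn_chi m hA.compl, coeFn_chi m MeasurableSet.univ] with x h1 h2 h3 h4
      rw [h1, h4, Pi.add_apply, h2, h3]
      by_cases hx : x ∈ A <;> simp [hx]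
    have h2 := one_mul (m := m) ω
    rw [← h1, map_add, LinearMap.add_apply] at h2
    nth_rewrite 1 [← h2]
    rw [add_sub_cancel_left]
  rw [e, norm_sq_cotangent, norm_sq_cotangent, norm_sq_cotangent,
    ← integral_add (integrable_sq_coeFn _) (integrable_sq_coeFn _)]
  refine integral_congr_ae ?_
  filter_upwards [ae_cotangentNorm_chi hA ω, ae_cotangentNorm_chi hA.compl ω] with x h1 h2
  rw [h1, h2]
  by_cases hx : x ∈ A <;> simp [hx]

lemma cotangent_locality (v : Cotangent m) (A : ℕ → Set M) (hA : ∀ n, MeasurableSet (A n))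
    (h : ∀ n, mul (chi m (hA n)) v = 0) : mul (chi m (MeasurableSet.iUnion hA)) v = 0 := by
  refine cotangentNorm_eq_zero ?_
  have h1 : ∀ᵐ x ∂m, ∀ n, (A n).indicator (cotangentNorm v) x = 0 := by
    refine ae_all_iff.2 fun n => ?_
    filter_upwards [ae_cotangentNorm_chi (hA n) v, Lp.coeFn_zero ℝ 2 m] with x h1 h2
    rw [← h1, h n, cotangentNorm_zero, h2, Pi.zero_apply]
  filter_upwards [h1, ae_cotangentNorm_chi (MeasurableSet.iUnion hA) v] with x h1 h2
  rw [h2]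
  by_cases hx : x ∈ ⋃ n, A n
  · obtain ⟨n, hn⟩ := Set.mem_iUnion.1 hx
    have := h1 n
    rw [Set.indicator_of_mem hn] at this
    rw [Set.indicator_of_mem hx, this]
  · exact Set.indicator_of_notMem hx _

/-- The sets are first made disjoint. The sums w_n over the disjoint pieces are bounded by the given
sums S_n, and by the Pythagorean identity bounded sums with disjoint supports are Cauchy. Their
limit is the glued form. -/
lemma cotangent_gluing (v : ℕ → Cotangent m) (A : ℕ → Set M) (hA : ∀ n, MeasurableSet (A n))
    (hc : ∀ i j, mul (chi m ((hA i).inter (hA j))) (v i) = mul (chi m ((hA i).inter (hA j))) (v j))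
    (hb : BddAbove (Set.range fun n : ℕ => ‖∑ i ∈ Finset.range n, mul (chi m (hA i)) (v i)‖)) :
    ∃ w : Cotangent m, (∀ i, mul (chi m (hA i)) w = mul (chi m (hA i)) (v i)) ∧
      ‖w‖ ≤ liminf (fun n : ℕ => ‖∑ i ∈ Finset.range n, mul (chi m (hA i)) (v i)‖) atTop := by
  set B := disjointed A with hBdef
  have hB : ∀ n, MeasurableSet (B n) := fun n => MeasurableSet.disjointed hA n
  have hBA : ∀ n, B n ⊆ A n := fun n => disjointed_subset A n
  have hBd : Pairwise (Function.onFun Disjoint B) := disjoint_disjointed A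
  set S : ℕ → Cotangent m := fun n => ∑ i ∈ Finset.range n, mul (chi m (hA i)) (v i) with hS
  set w : ℕ → Cotangent m := fun n => ∑ i ∈ Finset.range n, mul (chi m (hB i)) (v i) with hw
  have hBB : ∀ i j, i ≠ j → ∀ u : Cotangent m, mul (chi m (hB i)) (mul (chi m (hB j)) u) = 0 := by
    intro i j hij u
    have h0 : chi m ((hB i).inter (hB j)) = 0 := by
      refine Lp.ext ?_
      filter_upwards [coeFn_chi m ((hB i).inter (hB j)), Lp.coeFn_zero ℝ ∞ m] with x h1 h2
      rw [h1, h2, (hBd hij).inter_eq]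
      simp
    rw [chi_mul_chi, h0, map_zero, LinearMap.zero_apply]
  have hBBs : ∀ i, ∀ u : Cotangent m, mul (chi m (hB i)) (mul (chi m (hB i)) u) =
      mul (chi m (hB i)) u := fun i u => chi_mul_chi_of_subset _ _ le_rfl u
  have hBw : ∀ n i, i < n → mul (chi m (hB i)) (w n) = mul (chi m (hB i)) (v i) := by
    intro n i hi
    rw [hw, map_sum, Finset.sum_eq_single i, hBBs]
    · intro j _ hj
      exact hBB i j hj.symm _
    · intro h
      exact absurd (Finset.mem_range.2 hi) h
  have hBS : ∀ n i, i < n → ∀ᵐ x ∂m, x ∈ B i → cotangentNorm (w n) x ≤ cotangentNorm (S n) x := by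
    -- On B_i the sum S_n equals c v_i, where c counts the sets A_j with j < n containing the point.
    -- Overlaps only enlarge it: c ≥ 1 on A_i.
    intro n i hi
    set c : Lp ℝ ∞ m := ∑ j ∈ Finset.range n, chi m (hA j) with hcdef
    have e : mul (chi m (hB i)) (S n) = mul c (mul (chi m (hB i)) (v i)) := by
      rw [hS, map_sum, hcdef, map_sum, LinearMap.sum_apply]
      refine Finset.sum_congr rfl fun j _ => ?_
      have h1 : mul (chi m (hA i)) (mul (chi m (hA j)) (v j)) =
          mul (chi m (hA i)) (mul (chi m (hA j)) (v i)) := by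
        rw [chi_mul_chi, chi_mul_chi, hc]
      rw [← chi_mul_chi_of_subset (hB i) (hA i) (hBA i), h1,
        chi_mul_chi_of_subset (hB i) (hA i) (hBA i), mul_mul_comm]
    have hcge : ∀ᵐ x ∂m, x ∈ A i → 1 ≤ c x := by
      have h1 : ∀ᵐ x ∂m, c x = ∑ j ∈ Finset.range n, chi m (hA j) x := by
        rw [hcdef]
        filter_upwards [Lp.coeFn_finsetSum (Finset.range n) fun j => chi m (hA j)] with x hx
        rw [hx, Finset.sum_apply]
      filter_upwards [h1, ae_all_iff.2 fun j => coeFn_chi m (hA j)] with x h1 h2 hx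
      rw [h1]
      have h3 : ∀ j ∈ Finset.range n, 0 ≤ chi m (hA j) x := fun j _ => by
        rw [h2]
        exact Set.indicator_nonneg (fun _ _ => zero_le_one) _
      refine le_trans (le_of_eq ?_) (Finset.single_le_sum h3 (Finset.mem_range.2 hi))
      rw [h2, Set.indicator_of_mem hx]
    filter_upwards [hcge, ae_cotangentNorm_chi (hB i) (S n), ae_cotangentNorm_chi (hB i) (w n),
      ae_cotangentNorm_mul c (mul (chi m (hB i)) (v i)), ae_cotangentNorm_nonneg (w n)]
      with x h1 h2 h3 h4 h5 hx
    rw [Set.indicator_of_mem hx] at h2 h3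
    rw [hBw n i hi] at h3
    rw [← h2, e, h4, h3]
    refine le_mul_of_one_le_left h5 ((h1 (hBA i hx)).trans (le_abs_self _))
  have hwS : ∀ n, ‖w n‖ ≤ ‖S n‖ := by
    intro n
    rw [← norm_cotangentNorm, ← norm_cotangentNorm]
    refine Lp.norm_le_norm_of_ae_le ?_
    have h1 : ∀ᵐ x ∂m, ∀ i, i < n → x ∈ B i → cotangentNorm (w n) x ≤ cotangentNorm (S n) x :=
      ae_all_iff.2 fun i => by
        by_cases hi : i < n
        · filter_upwards [hBS n i hi] with x hx _ using hx
        · exact Eventually.of_forall fun x h => absurd h hi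
    set C := ⋃ i ∈ Finset.range n, B i
    have hC : MeasurableSet C := Finset.measurableSet_biUnion _ fun i _ => hB i
    have h2 : mul (chi m hC) (w n) = w n := by
      rw [hw, map_sum]
      refine Finset.sum_congr rfl fun i hi => ?_
      have hs : B i ⊆ C := Set.subset_biUnion_of_mem (u := B) hi
      rw [mul_mul_comm, chi_mul_chi_of_subset (hB i) hC hs]
    filter_upwards [h1, ae_cotangentNorm_nonneg (w n), ae_cotangentNorm_nonneg (S n),
      ae_cotangentNorm_chi hC (w n)] with x h1 h3 h4 h5
    rw [Real.norm_of_nonneg h3, Real.norm_of_nonneg h4]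
    by_cases hx : x ∈ C
    · obtain ⟨i, hi, hxi⟩ := Set.mem_iUnion₂.1 hx
      exact h1 i (Finset.mem_range.1 hi) hxi
    · rw [h2, Set.indicator_of_notMem hx] at h5
      rw [h5]
      exact h4
  have hpyth : ∀ k n, k ≤ n → ‖w n‖ ^ 2 = ‖w k‖ ^ 2 + ‖w n - w k‖ ^ 2 := by
    intro k n hkn
    set C := ⋃ i ∈ Finset.range k, B i
    have hC : MeasurableSet C := Finset.measurableSet_biUnion _ fun i _ => hB i
    have h2 : mul (chi m hC) (w n) = w k := by
      rw [hw, map_sum]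
      rw [← Finset.sum_subset (Finset.range_subset_range.2 hkn)]
      · refine Finset.sum_congr rfl fun i hi => ?_
        have hs : B i ⊆ C := Set.subset_biUnion_of_mem (u := B) hi
        rw [mul_mul_comm, chi_mul_chi_of_subset (hB i) hC hs]
      · intro i _ hi
        have h0 : chi m (hC.inter (hB i)) = 0 := by
          refine Lp.ext ?_
          filter_upwards [coeFn_chi m (hC.inter (hB i)), Lp.coeFn_zero ℝ ∞ m] with x h1 h2
          have : C ∩ B i = ∅ := by
            rw [← Set.disjoint_iff_inter_eq_empty, Set.disjoint_iUnion₂_left]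
            intro j hj
            exact hBd (fun hji => hi (hji ▸ hj))
          rw [h1, h2, this]
          simp
        rw [chi_mul_chi, h0, map_zero, LinearMap.zero_apply]
    rw [norm_sq_mul_chi_add hC (w n), h2]
  have hmono : Monotone fun n => ‖w n‖ ^ 2 := fun k n hkn => by
    have := hpyth k n hkn
    nlinarith [sq_nonneg ‖w n - w k‖]
  obtain ⟨K, hK⟩ := hb
  have hKS : ∀ n, ‖S n‖ ≤ K := fun n => hK ⟨n, rfl⟩
  have hbdd : BddAbove (Set.range fun n => ‖w n‖ ^ 2) := ⟨K ^ 2, by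
    rintro _ ⟨n, rfl⟩
    exact pow_le_pow_left₀ (norm_nonneg _) ((hwS n).trans (hKS n)) 2⟩
  have hconv := tendsto_atTop_ciSup hmono hbdd
  have hcau : CauchySeq w := by
    refine cauchySeq_of_le_tendsto_0' (fun n => √((⨆ k, ‖w k‖ ^ 2) - ‖w n‖ ^ 2)) (fun k n hkn => ?_) ?_
    · rw [dist_comm, dist_eq_norm]
      refine Real.le_sqrt_of_sq_le ?_
      have := hpyth k n hkn
      have h2 := le_ciSup hbdd n
      linarith
    · have := (Real.continuous_sqrt.tendsto 0).comp
        (show Tendsto (fun n => (⨆ k, ‖w k‖ ^ 2) - ‖w n‖ ^ 2) atTop (𝓝 0) by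
          rw [← sub_self (⨆ k, ‖w k‖ ^ 2)]
          exact hconv.const_sub _)
      simpa [Function.comp_def] using this
  obtain ⟨u, hu⟩ := cauchySeq_tendsto_of_complete hcau
  refine ⟨u, fun i => ?_, ?_⟩
  · have hBu : ∀ k, mul (chi m (hB k)) u = mul (chi m (hB k)) (v k) := fun k => by
      refine tendsto_nhds_unique (((continuous_mul (chi m (hB k))).tendsto u).comp hu)
        (tendsto_const_nhds.congr' ?_)
      filter_upwards [eventually_gt_atTop k] with n hn
      exact (hBw n k hn).symm
    -- On B_k the limit agrees with v_k, and v_k agrees with v_i on A_k ∩ A_i. Hence z vanishes on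
    -- every B_k, and locality gives z = 0 because the B_k cover A_i.
    set z := mul (chi m (hA i)) (u - v i) with hz
    have h1 : ∀ k, mul (chi m (hB k)) z = 0 := fun k => by
      have h2 : mul (chi m (hB k)) (mul (chi m (hA i)) (v k)) =
          mul (chi m (hB k)) (mul (chi m (hA i)) (v i)) := by
        have h3 : ∀ y : Cotangent m, mul (chi m (hB k)) (mul (chi m (hA k)) y) =
          mul (chi m (hB k)) y := chi_mul_chi_of_subset (hB k) (hA k) (hBA k)
        rw [← h3, ← h3 (mul (chi m (hA i)) (v i)), chi_mul_chi (hA k), hc, ← chi_mul_chi]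
      rw [hz, mul_mul_comm, map_sub, hBu, map_sub, mul_mul_comm, h2, mul_mul_comm, sub_self]
    have h2 := cotangent_locality z B hB h1
    have h3 : A i ⊆ ⋃ k, B k := by
      rw [hBdef, iUnion_disjointed]
      exact Set.subset_iUnion A i
    have h4 : z = 0 := by
      rw [hz, ← chi_mul_chi_of_subset (hA i) (MeasurableSet.iUnion hB) h3, mul_mul_comm, ← hz, h2]
    rw [hz, map_sub, sub_eq_zero] at h4
    exact h4
  · have h1 := hu.norm.liminf_eq
    rw [← h1]
    refine liminf_le_liminf (Eventually.of_forall hwS) hu.norm.isBoundedUnder_ge ?_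
    exact IsBoundedUnder.isCoboundedUnder_ge ⟨K, eventually_map.2 (Eventually.of_forall hKS)⟩

lemma isLinftyModule_cotangent : IsLinftyModule m (Cotangent m) :=
  ⟨inferInstance, cotangent_locality, cotangent_gluing⟩

end CotangentModule

end

end MMS

namespace MMS

noncomputable section

/-! ## The pointwise scalar product of 1-forms -/

section PtInner

variable {M : Type*} [MetricSpace M] [SecondCountableTopology M] [MeasurableSpace M]
  [BorelSpace M] {m : Measure M}

open LinftyPremodule

/-- The square of the pointwise norm, as an element of `L¹(m)`. -/
def cotangentNormSq (ω : Cotangent m) : Lp ℝ 1 m :=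
  lpMul m 2 2 1 (cotangentNorm ω) (cotangentNorm ω)

lemma coeFn_cotangentNormSq (ω : Cotangent m) :
    cotangentNormSq ω =ᵐ[m] fun x => cotangentNorm ω x ^ 2 := by
  filter_upwards [coeFn_lpMul (r := 1) (cotangentNorm ω) (cotangentNorm ω)] with x hx
  rw [cotangentNormSq, hx, sq]

lemma continuous_cotangentNormSq : Continuous (cotangentNormSq : Cotangent m → Lp ℝ 1 m) :=
  ((lpMul m 2 2 1).continuous.comp continuous_cotangentNorm).clm_apply continuous_cotangentNorm

/-- The polarization of the squared pointwise norm. -/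
def ptInner (ω η : Cotangent m) : Lp ℝ 1 m :=
  (1 / 4 : ℝ) • (cotangentNormSq (ω + η) - cotangentNormSq (ω - η))

lemma coeFn_ptInner (ω η : Cotangent m) : ptInner ω η =ᵐ[m]
    fun x => (cotangentNorm (ω + η) x ^ 2 - cotangentNorm (ω - η) x ^ 2) / 4 := by
  filter_upwards [Lp.coeFn_smul (1 / 4 : ℝ) (cotangentNormSq (ω + η) - cotangentNormSq (ω - η)),
    Lp.coeFn_sub (cotangentNormSq (ω + η)) (cotangentNormSq (ω - η)),
    coeFn_cotangentNormSq (ω + η), coeFn_cotangentNormSq (ω - η)] with x h1 h2 h3 h4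
  rw [ptInner, h1, Pi.smul_apply, h2, Pi.sub_apply, h3, h4, smul_eq_mul]
  ring

lemma continuous_ptInner_left (η : Cotangent m) : Continuous fun ω => ptInner ω η := by
  unfold ptInner
  have h1 : Continuous fun ω : Cotangent m => cotangentNormSq (ω + η) :=
    continuous_cotangentNormSq.comp (continuous_id.add continuous_const)
  have h2 : Continuous fun ω : Cotangent m => cotangentNormSq (ω - η) :=
    continuous_cotangentNormSq.comp (continuous_id.sub continuous_const)
  exact (continuous_const_smul (1 / 4 : ℝ)).comp (h1.sub h2)

lemma ptInner_comm (ω η : Cotangent m) : ptInner ω η = ptInner η ω := by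
  have : cotangentNormSq (ω - η) = cotangentNormSq (η - ω) := by
    rw [cotangentNormSq, cotangentNormSq, cotangentNorm_sub_comm]
  rw [ptInner, ptInner, add_comm, this]

lemma ae_ptInner_self (ω : Cotangent m) : ∀ᵐ x ∂m, ptInner ω ω x = cotangentNorm ω x ^ 2 := by
  have h := ae_cotangentNorm_smul 2 ω
  rw [two_smul] at h
  filter_upwards [coeFn_ptInner ω ω, h, Lp.coeFn_zero ℝ 2 m] with x h1 h2 h3
  rw [h1, h2, sub_self, cotangentNorm_zero, h3, abs_two, Pi.zero_apply]
  ring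

/-- The pointwise Cauchy-Schwarz inequality. -/
lemma ae_abs_ptInner_le (ω η : Cotangent m) :
    ∀ᵐ x ∂m, |ptInner ω η x| ≤ cotangentNorm ω x * cotangentNorm η x := by
  have h := ae_abs_cotangentNorm_sub_le ω (-η)
  rw [cotangentNorm_neg, sub_neg_eq_add] at h
  have h' := ae_cotangentNorm_add_le ω (-η)
  rw [cotangentNorm_neg, ← sub_eq_add_neg] at h'
  filter_upwards [coeFn_ptInner ω η, ae_abs_cotangentNorm_sub_le ω η, h, h',
    ae_cotangentNorm_add_le ω η, ae_cotangentNorm_nonneg (ω + η), ae_cotangentNorm_nonneg (ω - η)]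
    with x h1 h2 h3 h4 h5 h6 h7
  have k2 := pow_le_pow_left₀ (abs_nonneg _) h2 2
  have k3 := pow_le_pow_left₀ (abs_nonneg _) h3 2
  have k4 := pow_le_pow_left₀ h7 h4 2
  have k5 := pow_le_pow_left₀ h6 h5 2
  rw [sq_abs] at k2 k3
  rw [h1, abs_le]
  constructor <;> nlinarith

lemma norm_ptInner_le (ω η : Cotangent m) : ‖ptInner ω η‖ ≤ ‖ω‖ * ‖η‖ := by
  rw [← norm_cotangentNorm ω, ← norm_cotangentNorm η]
  refine le_trans (Lp.norm_le_norm_of_ae_le ?_)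
    (norm_lpMul_le (r := 1) (cotangentNorm ω) (cotangentNorm η))
  filter_upwards [ae_abs_ptInner_le ω η, coeFn_lpMul (r := 1) (cotangentNorm ω) (cotangentNorm η)]
    with x h1 h2
  rw [h2]
  exact h1.trans (le_abs_self _)

lemma norm_ptInner_self (ω : Cotangent m) : ‖ptInner ω ω‖ = ‖ω‖ ^ 2 := by
  rw [norm_sq_cotangent, L1.norm_eq_integral_norm]
  refine integral_congr_ae ?_
  filter_upwards [ae_ptInner_self ω] with x hx
  rw [hx, Real.norm_of_nonneg (sq_nonneg _)]

lemma integral_ptInner (ω η : Cotangent m) :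
    ∫ x, ptInner ω η x ∂m = (‖ω + η‖ ^ 2 - ‖ω - η‖ ^ 2) / 4 := by
  rw [norm_sq_cotangent, norm_sq_cotangent, ← integral_sub (integrable_sq_coeFn _)
    (integrable_sq_coeFn _), ← integral_div]
  exact integral_congr_ae (coeFn_ptInner ω η)

/-- On the pre-cotangent module the identity holds on each piece of a common refinement; it is
closed as an equation between the L¹ functions `cotangentNormSq`, and density finishes. -/
lemma PointwiseParallelogram.ae_cotangentNorm (h : PointwiseParallelogram m) (ω η : Cotangent m) :
    ∀ᵐ x ∂m, cotangentNorm (ω + η) x ^ 2 + cotangentNorm (ω - η) x ^ 2 =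
      2 * cotangentNorm ω x ^ 2 + 2 * cotangentNorm η x ^ 2 := by
  have key : cotangentNormSq (ω + η) + cotangentNormSq (ω - η) =
      (2 : ℝ) • cotangentNormSq ω + (2 : ℝ) • cotangentNormSq η := by
    refine UniformSpace.Completion.induction_on₂ ω η ?_ fun φ ψ => ?_
    · exact isClosed_eq
        ((continuous_cotangentNormSq.comp (continuous_fst.add continuous_snd)).add
          (continuous_cotangentNormSq.comp (continuous_fst.sub continuous_snd)))
        (((continuous_const_smul (2 : ℝ)).comp (continuous_cotangentNormSq.comp continuous_fst)).add
          ((continuous_const_smul (2 : ℝ)).comp (continuous_cotangentNormSq.comp continuous_snd)))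
    · rw [← UniformSpace.Completion.coe_add, ← UniformSpace.Completion.coe_sub]
      refine Lp.ext ?_
      have h1 := (φ.2.1.comp₂ ψ.2.1 Prod.mk).ae_of_forall
        (p := fun s x => weakGrad (s.1 + s.2) x ^ 2 + weakGrad (s.1 - s.2) x ^ 2 =
          2 * weakGrad s.1 x ^ 2 + 2 * weakGrad s.2 x ^ 2) fun s => h s.1 s.2
      filter_upwards [h1, (φ + ψ).coeFn_ptNorm, (φ - ψ).coeFn_ptNorm, φ.coeFn_ptNorm,
        ψ.coeFn_ptNorm, coeFn_cotangentNormSq ((φ + ψ : PreCotangent m) : Cotangent m),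
        coeFn_cotangentNormSq ((φ - ψ : PreCotangent m) : Cotangent m),
        coeFn_cotangentNormSq (φ : Cotangent m), coeFn_cotangentNormSq (ψ : Cotangent m),
        Lp.coeFn_add (cotangentNormSq ((φ + ψ : PreCotangent m) : Cotangent m))
          (cotangentNormSq ((φ - ψ : PreCotangent m) : Cotangent m)),
        Lp.coeFn_add ((2 : ℝ) • cotangentNormSq (φ : Cotangent m))
          ((2 : ℝ) • cotangentNormSq (ψ : Cotangent m)),
        Lp.coeFn_smul (2 : ℝ) (cotangentNormSq (φ : Cotangent m)),
        Lp.coeFn_smul (2 : ℝ) (cotangentNormSq (ψ : Cotangent m))]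
        with x h1 h2 h3 h4 h5 h6 h7 h8 h9 h10 h11 h12 h13
      rw [h10, h11, Pi.add_apply, Pi.add_apply, h12, h13, Pi.smul_apply, Pi.smul_apply, h6, h7, h8,
        h9, cotangentNorm_coe, cotangentNorm_coe, cotangentNorm_coe, cotangentNorm_coe, h2, h3, h4,
        h5]
      exact h1
  have e : ∀ᵐ x ∂m, (cotangentNormSq (ω + η) + cotangentNormSq (ω - η)) x =
      ((2 : ℝ) • cotangentNormSq ω + (2 : ℝ) • cotangentNormSq η) x := by
    rw [key]
    exact Eventually.of_forall fun _ => rfl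
  filter_upwards [e, coeFn_cotangentNormSq (ω + η), coeFn_cotangentNormSq (ω - η),
    coeFn_cotangentNormSq ω, coeFn_cotangentNormSq η,
    Lp.coeFn_add (cotangentNormSq (ω + η)) (cotangentNormSq (ω - η)),
    Lp.coeFn_add ((2 : ℝ) • cotangentNormSq ω) ((2 : ℝ) • cotangentNormSq η),
    Lp.coeFn_smul (2 : ℝ) (cotangentNormSq ω), Lp.coeFn_smul (2 : ℝ) (cotangentNormSq η)]
    with x h1 h2 h3 h4 h5 h6 h7 h8 h9
  rw [h6, h7, Pi.add_apply, Pi.add_apply, h8, h9, Pi.smul_apply, Pi.smul_apply, h2, h3, h4, h5] at h1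
  exact h1

lemma PointwiseParallelogram.isHilbertSpace_cotangent (h : PointwiseParallelogram m) :
    IsHilbertSpace (Cotangent m) := by
  refine IsHilbertSpace.of_parallelogram fun ω η => ?_
  rw [norm_sq_cotangent, norm_sq_cotangent, norm_sq_cotangent, norm_sq_cotangent,
    ← integral_add (integrable_sq_coeFn _) (integrable_sq_coeFn _), ← integral_const_mul,
    ← integral_const_mul, ← integral_add ((integrable_sq_coeFn _).const_mul _)
      ((integrable_sq_coeFn _).const_mul _)]
  exact integral_congr_ae (h.ae_cotangentNorm ω η)

/-- The Jordan-von Neumann argument at almost every point: of the four parallelogram identities, the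
two with +ζ minus the two with -ζ give twice the claim; the remaining mixed terms cancel in pairs.
-/
lemma PointwiseParallelogram.ptInner_add_left (h : PointwiseParallelogram m)
    (ω η ζ : Cotangent m) : ptInner (ω + η) ζ = ptInner ω ζ + ptInner η ζ := by
  refine Lp.ext ?_
  have e1 : ω + ζ + η = ω + η + ζ := by abel
  have e2 : η + ζ + ω = ω + η + ζ := by abel
  have e3 : ω - ζ + η = ω + η - ζ := by abel
  have e4 : η - ζ + ω = ω + η - ζ := by abel
  have e5 : ω + ζ - η = -(η - ζ - ω) := by abel
  have e6 : η + ζ - ω = -(ω - ζ - η) := by abel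
  have h1 := h.ae_cotangentNorm (ω + ζ) η
  have h2 := h.ae_cotangentNorm (η + ζ) ω
  have h3 := h.ae_cotangentNorm (ω - ζ) η
  have h4 := h.ae_cotangentNorm (η - ζ) ω
  rw [e1, e5, cotangentNorm_neg] at h1
  rw [e2, e6, cotangentNorm_neg] at h2
  rw [e3] at h3
  rw [e4] at h4
  filter_upwards [h1, h2, h3, h4, coeFn_ptInner (ω + η) ζ, coeFn_ptInner ω ζ, coeFn_ptInner η ζ,
    Lp.coeFn_add (ptInner ω ζ) (ptInner η ζ)] with x h1 h2 h3 h4 h5 h6 h7 h8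
  rw [h8, Pi.add_apply, h5, h6, h7]
  linarith

/-- The map `ω ↦ ⟨ω, η⟩`, for the pointwise scalar product. -/
def ptInnerL (h : PointwiseParallelogram m) (η : Cotangent m) : Cotangent m →L[ℝ] Lp ℝ 1 m :=
  -- Homogeneity follows from additivity and continuity.
  AddMonoidHom.toRealLinearMap
    { toFun := fun ω => ptInner ω η
      map_zero' := by
        have := h.ptInner_add_left 0 0 η
        rwa [add_zero, left_eq_add] at this
      map_add' := fun ω ζ => h.ptInner_add_left ω ζ η } (continuous_ptInner_left η)

lemma ptInnerL_apply (h : PointwiseParallelogram m) (η ω : Cotangent m) :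
    ptInnerL h η ω = ptInner ω η := rfl

/-- For rational c the difference ⟨fω, η⟩ - c⟨ω, η⟩ equals ⟨(f - c)ω, η⟩ and is at most |f -
c||ω||η| by the pointwise Cauchy-Schwarz inequality. At almost every point x, let c tend to f(x). -/
lemma PointwiseParallelogram.ptInner_mul_left (h : PointwiseParallelogram m) (f : Lp ℝ ∞ m)
    (ω η : Cotangent m) : ptInner (mul f ω) η = (f • ptInner ω η : Lp ℝ 1 m) := by
  refine Lp.ext ?_
  have h1 : ∀ᵐ x ∂m, ∀ c : ℚ, |ptInner (mul f ω) η x - (c : ℝ) * ptInner ω η x| ≤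
      |f x - c| * (cotangentNorm ω x * cotangentNorm η x) := by
    refine ae_all_iff.2 fun c => ?_
    set k : Lp ℝ ∞ m := f - (c : ℝ) • chi m MeasurableSet.univ with hk
    have e : ptInner (mul f ω) η - (c : ℝ) • ptInner ω η = ptInner (mul k ω) η := by
      rw [hk, map_sub, LinearMap.sub_apply, mul_const_smul_chi_univ]
      simp only [← ptInnerL_apply h]
      rw [map_sub, map_smul]
    filter_upwards [ae_abs_ptInner_le (mul k ω) η, ae_cotangentNorm_mul k ω,
      Lp.coeFn_sub f ((c : ℝ) • chi m MeasurableSet.univ),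
      Linfty.coeFn_const_smul_chi_univ (m := m) (c : ℝ),
      Lp.coeFn_sub (ptInner (mul f ω) η) ((c : ℝ) • ptInner ω η),
      Lp.coeFn_smul (c : ℝ) (ptInner ω η)] with x h1 h2 h3 h4 h5 h6
    rw [← e, h5, Pi.sub_apply, h6, h2, h3, Pi.sub_apply, h4, mul_assoc] at h1
    exact h1
  filter_upwards [h1, Lp.coeFn_lpSMul (r := 1) f (ptInner ω η)] with x h1 h2
  rw [h2, Pi.smul_apply', smul_eq_mul, ← sub_eq_zero, ← abs_nonpos_iff]
  have := le_of_forall_rat (Φ := fun c => |ptInner (mul f ω) η x - c * ptInner ω η x|)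
    (Ψ := fun c => |f x - c| * (cotangentNorm ω x * cotangentNorm η x)) (by fun_prop)
    (by fun_prop) h1 (f x)
  simpa using this

end PtInner

/-! ## The Riesz isomorphism between the cotangent and the tangent module -/

section Riesz

variable {M : Type*} [MetricSpace M] [SecondCountableTopology M] [MeasurableSpace M]
  [BorelSpace M] {m : Measure M}

open LinftyPremodule

/-- The representing vector is described through the norm by polarization, a form that matches
`integral_ptInner` and mentions no chosen scalar product. -/
lemma IsHilbertSpace.exists_riesz {V : Type*} [NormedAddCommGroup V] [inst : NormedSpace ℝ V]
    (h : IsHilbertSpace V) (ℓ : V →L[ℝ] ℝ) :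
    ∃ η : V, ∀ ω, ℓ ω = (‖ω + η‖ ^ 2 - ‖ω - η‖ ^ 2) / 4 := by
  obtain ⟨hc, i, rfl⟩ := h
  refine ⟨(InnerProductSpace.toDual ℝ V).symm ℓ, fun ω => ?_⟩
  rw [← InnerProductSpace.toDual_symm_apply (𝕜 := ℝ) (y := ℓ), real_inner_comm,
    norm_add_sq_real, norm_sub_sq_real, real_inner_comm]
  ring

/-- The vector field that corresponds to a 1-form. -/
def sharp (h : PointwiseParallelogram m) (η : Cotangent m) : Tangent m :=
  ⟨ptInnerL h η, fun f ω => h.ptInner_mul_left f ω η⟩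

lemma sharp_apply (h : PointwiseParallelogram m) (η ω : Cotangent m) :
    sharp h η ω = ptInner ω η := rfl

lemma Tangent.ext {X Y : Tangent m} (h : ∀ ω, X ω = Y ω) : X = Y :=
  Subtype.ext (ContinuousLinearMap.ext h)

lemma Tangent.add_apply (X Y : Tangent m) (ω : Cotangent m) : (X + Y) ω = X ω + Y ω := rfl

lemma Tangent.smul_apply (c : ℝ) (X : Tangent m) (ω : Cotangent m) : (c • X) ω = c • X ω := rfl

lemma sharp_add (h : PointwiseParallelogram m) (η ζ : Cotangent m) :
    sharp h (η + ζ) = sharp h η + sharp h ζ := by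
  refine Tangent.ext fun ω => ?_
  rw [Tangent.add_apply, sharp_apply, sharp_apply, sharp_apply, ptInner_comm, h.ptInner_add_left,
    ptInner_comm η, ptInner_comm ζ]

lemma sharp_smul (h : PointwiseParallelogram m) (c : ℝ) (η : Cotangent m) :
    sharp h (c • η) = c • sharp h η := by
  refine Tangent.ext fun ω => ?_
  rw [Tangent.smul_apply, sharp_apply, sharp_apply, ptInner_comm, ptInner_comm ω,
    ← ptInnerL_apply h, map_smul, ptInnerL_apply]

lemma sharp_mul (h : PointwiseParallelogram m) (f : Lp ℝ ∞ m) (η : Cotangent m) :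
    sharp h (mul f η) = mul f (sharp h η) := by
  refine Tangent.ext fun ω => ?_
  rw [DualModule.mul_apply, sharp_apply, sharp_apply, ptInner_comm, h.ptInner_mul_left,
    ptInner_comm]

lemma norm_sharp (h : PointwiseParallelogram m) (η : Cotangent m) : ‖sharp h η‖ = ‖η‖ := by
  refine le_antisymm ?_ ?_
  · refine ContinuousLinearMap.opNorm_le_bound _ (norm_nonneg _) fun ω => ?_
    exact (norm_ptInner_le ω η).trans (le_of_eq (_root_.mul_comm _ _))
  · have h1 : ‖sharp h η η‖ ≤ ‖sharp h η‖ * ‖η‖ := (sharp h η).1.le_opNorm η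
    rw [sharp_apply, norm_ptInner_self] at h1
    rcases (norm_nonneg η).eq_or_lt with h0 | h0
    · rw [← h0]; exact norm_nonneg _
    · nlinarith

/-- The Riesz theorem is applied to the functional ω ↦ ∫ ω(X) dm. Inserting χ_A ω for every Borel
set A turns equality of integrals into equality a.e., by L^∞-linearity of both sides. -/
lemma sharp_surjective (h : PointwiseParallelogram m) (X : Tangent m) : ∃ η, sharp h η = X := by
  obtain ⟨η, hη⟩ := h.isHilbertSpace_cotangent.exists_riesz ((L1.integralCLM (α := M) (E := ℝ)).comp X.1)
  refine ⟨η, Tangent.ext fun ω => ?_⟩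
  have h1 : ∀ ω, ∫ x, X ω x ∂m = ∫ x, ptInner ω η x ∂m := fun ω => by
    rw [integral_ptInner, ← hη, ContinuousLinearMap.comp_apply, ← L1.integral_eq, L1.integral_eq_integral]
  have h2 : ∀ (u : Lp ℝ 1 m) {A : Set M} (hA : MeasurableSet A),
      ∫ x, (chi m hA • u : Lp ℝ 1 m) x ∂m = ∫ x in A, u x ∂m := fun u A hA => by
    rw [← integral_indicator hA]
    refine integral_congr_ae ?_
    filter_upwards [Lp.coeFn_lpSMul (r := 1) (chi m hA) u, coeFn_chi m hA] with x k1 k2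
    rw [k1, Pi.smul_apply', k2]
    by_cases hx : x ∈ A <;> simp [hx]
  refine Lp.ext (Integrable.ae_eq_of_forall_setIntegral_eq _ _ (L1.integrable_coeFn _)
    (L1.integrable_coeFn _) fun A hA _ => ?_)
  rw [← h2 _ hA, ← h2 _ hA, sharp_apply, ← h.ptInner_mul_left, ← h1]
  rw [show X (mul (chi m hA) ω) = (chi m hA • X ω : Lp ℝ 1 m) from X.2 _ _]

/-- The Riesz isomorphism. -/
def sharpEquiv (h : PointwiseParallelogram m) : Cotangent m ≃ₗᵢ[ℝ] Tangent m :=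
  LinearIsometryEquiv.ofSurjective
    { toFun := sharp h
      map_add' := sharp_add h
      map_smul' := sharp_smul h
      norm_map' := norm_sharp h } (sharp_surjective h)

lemma PointwiseParallelogram.isHilbertModule_cotangent (h : PointwiseParallelogram m) :
    IsHilbertModule m (Cotangent m) := ⟨isLinftyModule_cotangent, h.isHilbertSpace_cotangent⟩

lemma PointwiseParallelogram.isHilbertModule_tangent (h : PointwiseParallelogram m) :
    IsHilbertModule m (Tangent m) :=
  h.isHilbertModule_cotangent.of_linearIsometryEquiv (sharpEquiv h) (sharp_mul h)

end Riesz

end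

end MMS

namespace MMS

noncomputable section

/-! ## Gradients on infinitesimally Hilbertian spaces -/

section Gradient

variable {M : Type*} [MetricSpace M] [SecondCountableTopology M] [MeasurableSpace M]
  [BorelSpace M] {m : Measure M}

open LinftyPremodule

/-- Cauchy-Schwarz shows that |η| is an upper bound. It is the least one because the admissible
forms η / max(|η|, 1/(n+1)) nearly attain it. -/
lemma isPointwiseNorm_sharp (h : PointwiseParallelogram m) (η : Cotangent m) :
    IsPointwiseNorm (sharp h η) (cotangentNorm η) := by
  refine ⟨?_, fun u hu => ?_⟩
  · rintro _ ⟨ω, hω, rfl⟩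
    rw [← AEEqFun.coeFn_le]
    filter_upwards [AEEqFun.coeFn_abs (sharp h η ω : M →ₘ[m] ℝ), hω, ae_abs_ptInner_le ω η,
      ae_cotangentNorm_nonneg η] with x h1 h2 h3 h4
    rw [h1]
    exact h3.trans (mul_le_of_le_one_left h4 h2)
  · have hn : ∀ n : ℕ, ∀ᵐ x ∂m, (max (cotangentNorm η x) (1 / ((n : ℝ) + 1)))⁻¹ *
        cotangentNorm η x ^ 2 ≤ u x := fun n => by
      have hpos : (0 : ℝ) < 1 / ((n : ℝ) + 1) := by positivity
      obtain ⟨f, hf⟩ := exists_Linfty_eq_inv_max hpos (cotangentNorm η)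
      have h1 : ∀ᵐ x ∂m, cotangentNorm (mul f η) x ≤ 1 := by
        filter_upwards [ae_cotangentNorm_mul f η, hf, ae_cotangentNorm_nonneg η] with x h1 h2 h3
        have h4 : 0 < max (cotangentNorm η x) (1 / ((n : ℝ) + 1)) := lt_max_of_lt_right hpos
        rw [h1, h2, abs_of_nonneg (inv_nonneg.2 h4.le), inv_mul_le_one₀ h4]
        exact le_max_left _ _
      have h2 := hu ⟨mul f η, h1, rfl⟩
      rw [← AEEqFun.coeFn_le] at h2
      have e : sharp h η (mul f η) = (f • ptInner η η : Lp ℝ 1 m) := h.ptInner_mul_left f η η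
      filter_upwards [h2, AEEqFun.coeFn_abs (sharp h η (mul f η) : M →ₘ[m] ℝ), hf,
        ae_ptInner_self η, Lp.coeFn_lpSMul (r := 1) f (ptInner η η)] with x h2 h3 h4 h5 h6
      rw [h3] at h2
      refine (le_abs_self _).trans (le_trans (le_of_eq ?_) h2)
      rw [e]
      congr 1
      refine Eq.symm (Eq.trans h6 ?_)
      rw [Pi.smul_apply', h4, h5, smul_eq_mul]
    rw [← AEEqFun.coeFn_le]
    filter_upwards [ae_all_iff.2 hn, ae_cotangentNorm_nonneg η] with x h1 h2
    -- The elementary bound y²/max(y, δ) ≥ y - δ, with separate cases y ≥ δ and y ≤ δ.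
    have h3 : ∀ n : ℕ, cotangentNorm η x - 1 / ((n : ℝ) + 1) ≤ u x := fun n => by
      refine le_trans ?_ (h1 n)
      have hpos : (0 : ℝ) < 1 / ((n : ℝ) + 1) := by positivity
      set δ := 1 / ((n : ℝ) + 1)
      set y := cotangentNorm η x
      rcases le_total δ y with hy | hy
      · have : y ≠ 0 := by linarith
        rw [max_eq_left hy, sq, inv_mul_cancel_left₀ this]
        linarith
      · exact (sub_nonpos.2 hy).trans (by positivity)
    have h4 := (tendsto_one_div_add_atTop_nhds_zero_nat (𝕜 := ℝ)).const_sub (cotangentNorm η x)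
    rw [sub_zero] at h4
    exact le_of_tendsto' h4 h3

lemma isGradient_sharp (h : PointwiseParallelogram m) (f : sobolevClass m) :
    IsGradient f (sharp h (differential f)) :=
  ⟨_, isPointwiseNorm_sharp h _, (ae_ptInner_self (differential f)).mono fun _ hx => ⟨hx, rfl⟩⟩

/-- A gradient comes from a form η with ⟨df, η⟩ = |η|² = |df|². This is the equality case of
Cauchy-Schwarz: expanding, |df - η|² = 0 a.e. -/
lemma IsGradient.eq_sharp (h : PointwiseParallelogram m) {f : sobolevClass m} {X : Tangent m}
    (hX : IsGradient f X) : X = sharp h (differential f) := by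
  obtain ⟨η, rfl⟩ := sharp_surjective h X
  obtain ⟨g, hg, hx⟩ := hX
  have e : g = cotangentNorm η := Subtype.ext (hg.unique (isPointwiseNorm_sharp h η))
  rw [e] at hx
  have : differential f - η = 0 := by
    refine cotangentNorm_eq_zero ?_
    filter_upwards [hx, h.ae_cotangentNorm (differential f) η, coeFn_ptInner (differential f) η]
      with x h1 h2 h3
    rw [sharp_apply, h3] at h1
    have : cotangentNorm (differential f - η) x ^ 2 = 0 := by linarith [h1.1, h1.2]
    exact pow_eq_zero_iff two_ne_zero |>.1 this
  rw [sub_eq_zero.1 this]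

lemma PointwiseParallelogram.infinitesimallyStrictlyConvex (h : PointwiseParallelogram m) :
    InfinitesimallyStrictlyConvex m := fun f =>
  ⟨sharp h (differential f), isGradient_sharp h f, fun _ hX => hX.eq_sharp h⟩

lemma isGradient_gradient (h : InfinitesimallyStrictlyConvex m) (f : sobolevClass m) :
    IsGradient f (gradient h f) := (h f).choose_spec.1

lemma IsGradient.eq_gradient (h : InfinitesimallyStrictlyConvex m) {f : sobolevClass m}
    {X : Tangent m} (hX : IsGradient f X) : X = gradient h f := (h f).choose_spec.2 X hX

lemma gradient_eq_sharp (h : PointwiseParallelogram m) (h' : InfinitesimallyStrictlyConvex m)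
    (f : sobolevClass m) : gradient h' f = sharp h (differential f) :=
  (isGradient_gradient h' f).eq_sharp h

end Gradient

/-! ## The parallelogram identity from properties of gradients -/

section Converse

variable {M : Type*} [MetricSpace M] [SecondCountableTopology M] [MeasurableSpace M]
  [BorelSpace M] {m : Measure M}

open LinftyPremodule

/-- Multiplication by χ_A localizes: the parallelogram identity for χ_A df and χ_A dg is the
integral over A of the pointwise one, and A is arbitrary. -/
lemma PointwiseParallelogram.of_isHilbertSpace_cotangent (h : IsHilbertSpace (Cotangent m)) :
    PointwiseParallelogram m := by
  intro f g
  have hset : ∀ (f : sobolevClass m) {A : Set M} (hA : MeasurableSet A),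
      ‖mul (chi m hA) (differential f)‖ ^ 2 = ∫ x in A, weakGrad f x ^ 2 ∂m := fun f A hA => by
    rw [norm_sq_cotangent, ← integral_indicator hA]
    refine integral_congr_ae ?_
    filter_upwards [ae_cotangentNorm_chi hA (differential f)] with x hx
    rw [hx, cotangentNorm_differential]
    by_cases hxA : x ∈ A <;> simp [hxA]
  have hi := fun u : sobolevClass m => integrable_sq_coeFn (weakGrad u)
  refine Integrable.ae_eq_of_forall_setIntegral_eq _ _ ((hi (f + g)).add (hi (f - g)))
    (((hi f).const_mul 2).add ((hi g).const_mul 2)) fun A hA _ => ?_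
  have h1 := h.parallelogram (mul (chi m hA) (differential f)) (mul (chi m hA) (differential g))
  rw [← map_add, ← map_sub, ← differential_add, ← differential_sub, hset, hset, hset, hset] at h1
  rw [integral_add (hi _).integrableOn (hi _).integrableOn,
    integral_add ((hi _).const_mul 2).integrableOn ((hi _).const_mul 2).integrableOn,
    integral_const_mul, integral_const_mul]
  exact h1

lemma IsGradient.ae_apply_eq {f : sobolevClass m} {X : Tangent m} (h : IsGradient f X) :
    ∀ᵐ x ∂m, X (differential f) x = weakGrad f x ^ 2 := by
  obtain ⟨g, -, hg⟩ := h
  filter_upwards [hg] with x hx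
  rw [hx.1, hx.2, cotangentNorm_differential]

lemma Tangent.ae_add_apply (X Y : Tangent m) (ω : Cotangent m) :
    ∀ᵐ x ∂m, (X + Y) ω x = X ω x + Y ω x := Lp.coeFn_add (X ω) (Y ω)

lemma Tangent.ae_neg_apply (X : Tangent m) (ω : Cotangent m) :
    ∀ᵐ x ∂m, (-X) ω x = -X ω x := Lp.coeFn_neg (X ω)

lemma Tangent.ae_smul_apply (c : ℝ) (X : Tangent m) (ω : Cotangent m) :
    ∀ᵐ x ∂m, (c • X) ω x = c * X ω x := Lp.coeFn_smul c (X ω)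

lemma Tangent.ae_apply_add (X : Tangent m) (ω η : Cotangent m) :
    ∀ᵐ x ∂m, X (ω + η) x = X ω x + X η x := by
  rw [show X (ω + η) = X ω + X η from map_add X.1 ω η]
  exact Lp.coeFn_add (X ω) (X η)

lemma Tangent.ae_apply_sub (X : Tangent m) (ω η : Cotangent m) :
    ∀ᵐ x ∂m, X (ω - η) x = X ω x - X η x := by
  rw [show X (ω - η) = X ω - X η from map_sub X.1 ω η]
  exact Lp.coeFn_sub (X ω) (X η)

lemma Tangent.ae_apply_smul (X : Tangent m) (c : ℝ) (ω : Cotangent m) :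
    ∀ᵐ x ∂m, X (c • ω) x = c * X ω x := by
  rw [show X (c • ω) = c • X ω from map_smul X.1 c ω]
  exact Lp.coeFn_smul c (X ω)

/-- Symmetry moves the sum out of the gradient: |D(f+g)|² = df(∇(f+g)) + dg(∇(f+g)) = d(f+g)(∇f) +
d(f+g)(∇g), and similarly for f - g. Adding the two expansions cancels the mixed terms. -/
lemma PointwiseParallelogram.of_gradient_comm (h : InfinitesimallyStrictlyConvex m)
    (hs : ∀ f g : sobolevClass m, gradient h g (differential f) = gradient h f (differential g)) :
    PointwiseParallelogram m := by
  intro f g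
  have hp := (isGradient_gradient h (f + g)).ae_apply_eq
  have hm := (isGradient_gradient h (f - g)).ae_apply_eq
  have h1 := (gradient h (f + g)).ae_apply_add (differential f) (differential g)
  have h2 := (gradient h (f - g)).ae_apply_sub (differential f) (differential g)
  have h3 := (gradient h f).ae_apply_add (differential f) (differential g)
  have h4 := (gradient h g).ae_apply_add (differential f) (differential g)
  have h5 := (gradient h f).ae_apply_sub (differential f) (differential g)
  have h6 := (gradient h g).ae_apply_sub (differential f) (differential g)
  rw [← differential_add, hs f (f + g), hs g (f + g)] at h1
  rw [← differential_sub, hs f (f - g), hs g (f - g)] at h2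
  rw [← differential_add] at h3 h4
  rw [← differential_sub] at h5 h6
  filter_upwards [hp, hm, h1, h2, h3, h4, h5, h6, (isGradient_gradient h f).ae_apply_eq,
    (isGradient_gradient h g).ae_apply_eq] with x k1 k2 k3 k4 k5 k6 k7 k8 k9 k10
  linarith

/-- Additivity of the gradient is required only after pairing with d(f ± g). This weak form also
follows from the Leibniz rule by a limit, without any continuity of the gradient. -/
lemma ae_parallelogram_of_gradient (h : InfinitesimallyStrictlyConvex m) (f g : sobolevClass m)
    (hp : ∀ᵐ x ∂m, weakGrad (f + g) x ^ 2 = (gradient h f + gradient h g) (differential (f + g)) x)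
    (hm : ∀ᵐ x ∂m, weakGrad (f - g) x ^ 2 =
      (gradient h f + -gradient h g) (differential (f - g)) x) :
    ∀ᵐ x ∂m, weakGrad (f + g) x ^ 2 + weakGrad (f - g) x ^ 2 =
      2 * weakGrad f x ^ 2 + 2 * weakGrad g x ^ 2 := by
  rw [differential_add] at hp
  rw [differential_sub] at hm
  filter_upwards [hp, hm,
    Tangent.ae_add_apply (gradient h f) (gradient h g) (differential f + differential g),
    Tangent.ae_add_apply (gradient h f) (-gradient h g) (differential f - differential g),
    Tangent.ae_neg_apply (gradient h g) (differential f - differential g),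
    (gradient h f).ae_apply_add (differential f) (differential g),
    (gradient h g).ae_apply_add (differential f) (differential g),
    (gradient h f).ae_apply_sub (differential f) (differential g),
    (gradient h g).ae_apply_sub (differential f) (differential g),
    (isGradient_gradient h f).ae_apply_eq, (isGradient_gradient h g).ae_apply_eq]
    with x h1 h2 h3 h4 h5 h6 h7 h8 h9 h10 h11
  linarith

lemma PointwiseParallelogram.of_gradient_add (h : InfinitesimallyStrictlyConvex m)
    (hs : ∀ f g : sobolevClass m, gradient h (f + g) = gradient h f + gradient h g) :
    PointwiseParallelogram m := by
  have h0 : gradient h 0 = 0 := by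
    have := hs 0 0
    rwa [add_zero, left_eq_add] at this
  have hneg : ∀ g : sobolevClass m, gradient h (-g) = -gradient h g := fun g => by
    rw [eq_neg_iff_add_eq_zero, ← hs, neg_add_cancel, h0]
  intro f g
  refine ae_parallelogram_of_gradient h f g ?_ ?_
  · filter_upwards [(isGradient_gradient h (f + g)).ae_apply_eq] with x hx
    rw [← hx, hs]
  · filter_upwards [(isGradient_gradient h (f - g)).ae_apply_eq] with x hx
    rw [← hx, sub_eq_add_neg, hs, hneg]

lemma gradient_congr (h : InfinitesimallyStrictlyConvex m) {f g : sobolevClass m}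
    (hfg : differential f = differential g) : gradient h f = gradient h g := by
  refine IsGradient.eq_gradient h ?_
  have := isGradient_gradient h f
  rwa [IsGradient, hfg] at this

lemma isGradient_zero {f : sobolevClass m} (hf : differential f = 0) : IsGradient f 0 := by
  have h0 : |(0 : M →ₘ[m] ℝ)| = 0 := by rw [abs, neg_zero, sup_idem]
  refine ⟨0, ⟨?_, fun u hu => ?_⟩, ?_⟩
  · rintro _ ⟨ω, -, rfl⟩
    change |((0 : Lp ℝ 1 m) : M →ₘ[m] ℝ)| ≤ ((0 : Lp ℝ 2 m) : M →ₘ[m] ℝ)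
    rw [ZeroMemClass.coe_zero, ZeroMemClass.coe_zero, h0]
  · have := hu ⟨0, by
      rw [cotangentNorm_zero]
      filter_upwards [Lp.coeFn_zero ℝ 2 m] with x hx
      rw [hx]
      exact zero_le_one, rfl⟩
    change |((0 : Lp ℝ 1 m) : M →ₘ[m] ℝ)| ≤ u at this
    rwa [ZeroMemClass.coe_zero, h0] at this
  · rw [hf, cotangentNorm_zero]
    filter_upwards [Lp.coeFn_zero ℝ 1 m, Lp.coeFn_zero ℝ 2 m] with x h1 h2
    change (0 : Lp ℝ 1 m) x = _ ∧ _
    rw [h1, h2]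
    simp

lemma differential_sobolevConst (c : ℝ) : differential (sobolevConst m c) = 0 := by
  rw [← norm_eq_zero, ← norm_cotangentNorm, cotangentNorm_differential, weakGrad_sobolevConst,
    norm_zero]

lemma Linfty.isEssBounded (F : Lp ℝ ∞ m) : IsEssBounded (F : M →ₘ[m] ℝ) := ⟨‖F‖, Linfty.ae_abs_le F⟩

lemma IsEssBounded.exists_Linfty {f : M →ₘ[m] ℝ} (hf : IsEssBounded f) :
    ∃ F : Lp ℝ ∞ m, (F : M →ₘ[m] ℝ) = f := by
  obtain ⟨C, hC⟩ := hf
  exact ⟨⟨f, Lp.mem_Lp_iff_memLp.2 (memLp_top_of_bound f.aestronglyMeasurable C hC)⟩, rfl⟩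

lemma sobolevMul_eq (F G : Lp ℝ ∞ m) (hF : (F : M →ₘ[m] ℝ) ∈ sobolevClass m)
    (hG : (G : M →ₘ[m] ℝ) ∈ sobolevClass m) :
    sobolevMul ⟨(F : M →ₘ[m] ℝ), hF⟩ ⟨(G : M →ₘ[m] ℝ), hG⟩ (Linfty.isEssBounded F) (Linfty.isEssBounded G) =
      ⟨((F • G : Lp ℝ ∞ m) : M →ₘ[m] ℝ), sobolevClass_mul_mem F G hF hG⟩ := by
  refine Subtype.ext (AEEqFun.ext ?_)
  filter_upwards [coeFn_sobolevMul ⟨(F : M →ₘ[m] ℝ), hF⟩ ⟨(G : M →ₘ[m] ℝ), hG⟩ (Linfty.isEssBounded F)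
    (Linfty.isEssBounded G), Lp.coeFn_lpSMul (r := ∞) F G] with x h1 h2
  rw [h1]
  exact h2.symm

variable (m) in
/-- The Leibniz rule for gradients of essentially bounded Sobolev functions. -/
def GradientLeibniz (h : InfinitesimallyStrictlyConvex m) : Prop :=
  ∀ (F G : Lp ℝ ∞ m) (hF : (F : M →ₘ[m] ℝ) ∈ sobolevClass m)
    (hG : (G : M →ₘ[m] ℝ) ∈ sobolevClass m),
    gradient h ⟨((F • G : Lp ℝ ∞ m) : M →ₘ[m] ℝ), sobolevClass_mul_mem F G hF hG⟩ =
      mul F (gradient h ⟨(G : M →ₘ[m] ℝ), hG⟩) + mul G (gradient h ⟨(F : M →ₘ[m] ℝ), hF⟩)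

lemma GradientLeibniz.gradient_sobolevMul {h : InfinitesimallyStrictlyConvex m}
    (hs : GradientLeibniz m h) (f g : sobolevClass m) (hf : IsEssBounded (f : M →ₘ[m] ℝ))
    (hg : IsEssBounded (g : M →ₘ[m] ℝ)) (F G : Lp ℝ ∞ m) (hF : F =ᵐ[m] (f : M →ₘ[m] ℝ))
    (hG : G =ᵐ[m] (g : M →ₘ[m] ℝ)) :
    gradient h (sobolevMul f g hf hg) = mul F (gradient h g) + mul G (gradient h f) := by
  obtain ⟨f, hf'⟩ := f
  obtain ⟨g, hg'⟩ := g
  obtain rfl : (F : M →ₘ[m] ℝ) = f := AEEqFun.ext hF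
  obtain rfl : (G : M →ₘ[m] ℝ) = g := AEEqFun.ext hG
  rw [← hs, ← sobolevMul_eq]

lemma isEssBounded_sobolevConst (c : ℝ) : IsEssBounded (sobolevConst m c : M →ₘ[m] ℝ) :=
  ⟨|c|, (coeFn_sobolevConst c).mono fun x hx => by rw [hx]⟩

lemma isEssBounded_add {f g : sobolevClass m} (hf : IsEssBounded (f : M →ₘ[m] ℝ))
    (hg : IsEssBounded (g : M →ₘ[m] ℝ)) :
    IsEssBounded ((f + g : sobolevClass m) : M →ₘ[m] ℝ) := by
  obtain ⟨C, hC⟩ := hf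
  obtain ⟨D, hD⟩ := hg
  refine ⟨C + D, ?_⟩
  filter_upwards [hC, hD, coeFn_sobolev_add f g] with x h1 h2 h3
  rw [h3]
  exact (abs_add_le _ _).trans (add_le_add h1 h2)

lemma isEssBounded_smul (c : ℝ) {f : sobolevClass m} (hf : IsEssBounded (f : M →ₘ[m] ℝ)) :
    IsEssBounded ((c • f : sobolevClass m) : M →ₘ[m] ℝ) := by
  obtain ⟨C, hC⟩ := hf
  refine ⟨|c| * C, ?_⟩
  filter_upwards [hC, coeFn_sobolev_smul c f] with x h1 h2
  rw [h2, abs_mul]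
  exact mul_le_mul_of_nonneg_left h1 (abs_nonneg c)

lemma isEssBounded_sobolevMul (f g : sobolevClass m) (hf : IsEssBounded (f : M →ₘ[m] ℝ))
    (hg : IsEssBounded (g : M →ₘ[m] ℝ)) :
    IsEssBounded (sobolevMul f g hf hg : M →ₘ[m] ℝ) := by
  obtain ⟨C, hC⟩ := hf
  obtain ⟨D, hD⟩ := hg
  refine ⟨C * D, ?_⟩
  filter_upwards [hC, hD, coeFn_sobolevMul f g ⟨C, hC⟩ ⟨D, hD⟩] with x h1 h2 h3
  rw [h3, abs_mul]
  exact mul_le_mul h1 h2 (abs_nonneg _) ((abs_nonneg _).trans h1)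

lemma gradient_sobolevConst (h : InfinitesimallyStrictlyConvex m) (c : ℝ) :
    gradient h (sobolevConst m c) = 0 :=
  ((isGradient_zero (differential_sobolevConst c)).eq_gradient h).symm

/-- The Leibniz rule with one factor constant, whose gradient vanishes. The product with the
constant c and the multiple cf have the same differential, hence the same gradient. -/
lemma GradientLeibniz.gradient_smul {h : InfinitesimallyStrictlyConvex m}
    (hs : GradientLeibniz m h) (c : ℝ) {f : sobolevClass m} (hf : IsEssBounded (f : M →ₘ[m] ℝ)) :
    gradient h (c • f) = c • gradient h f := by
  obtain ⟨F, hF⟩ := hf.exists_Linfty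
  have hF' : F =ᵐ[m] (f : M →ₘ[m] ℝ) := by rw [hF]
  have hc : (c • chi m MeasurableSet.univ : Lp ℝ ∞ m) =ᵐ[m] (sobolevConst m c : M →ₘ[m] ℝ) :=
    (Linfty.coeFn_const_smul_chi_univ c).trans (coeFn_sobolevConst c).symm
  have e1 := hs.gradient_sobolevMul _ f (isEssBounded_sobolevConst c) hf _ F hc hF'
  have e2 := differential_sobolevMul _ f (isEssBounded_sobolevConst c) hf _ F hc hF'
  rw [gradient_sobolevConst, map_zero, add_zero, mul_const_smul_chi_univ] at e1
  rw [differential_sobolevConst, map_zero, add_zero, mul_const_smul_chi_univ,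
    ← differential_smul] at e2
  rw [← e1, gradient_congr h e2]

/-- The gradient of (1+εf)(1+εg) = 1 + ε(f+g+εfg) is computed in two ways. The Leibniz rule gives
ε(∇f + ∇g) + ε²(f∇g + g∇f), where the last bracket is ∇(fg); homogeneity allows division by ε. -/
lemma GradientLeibniz.gradient_add_add {h : InfinitesimallyStrictlyConvex m}
    (hs : GradientLeibniz m h) {f g : sobolevClass m} (hf : IsEssBounded (f : M →ₘ[m] ℝ))
    (hg : IsEssBounded (g : M →ₘ[m] ℝ)) {ε : ℝ} (hε : ε ≠ 0) :
    gradient h (f + g + ε • sobolevMul f g hf hg) =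
      gradient h f + gradient h g + ε • gradient h (sobolevMul f g hf hg) := by
  have key : ∀ {u : sobolevClass m} (_ : IsEssBounded (u : M →ₘ[m] ℝ)) (U : Lp ℝ ∞ m)
      (_ : U =ᵐ[m] (u : M →ₘ[m] ℝ)),
      IsEssBounded ((sobolevConst m 1 + ε • u : sobolevClass m) : M →ₘ[m] ℝ) ∧
      ((1 : ℝ) • chi m MeasurableSet.univ + ε • U : Lp ℝ ∞ m) =ᵐ[m]
        ((sobolevConst m 1 + ε • u : sobolevClass m) : M →ₘ[m] ℝ) ∧
      differential (sobolevConst m 1 + ε • u) = ε • differential u ∧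
      gradient h (sobolevConst m 1 + ε • u) = ε • gradient h u := fun {u} hu U hU => by
    have e : differential (sobolevConst m 1 + ε • u) = differential (ε • u) := by
      rw [differential_add, differential_sobolevConst, zero_add]
    refine ⟨isEssBounded_add (isEssBounded_sobolevConst 1) (isEssBounded_smul ε hu), ?_, ?_, ?_⟩
    · filter_upwards [coeFn_sobolev_add (sobolevConst m 1) (ε • u), coeFn_sobolev_smul ε u,
        coeFn_sobolevConst (m := m) 1, Linfty.coeFn_const_smul_chi_univ (m := m) 1,
        Lp.coeFn_add ((1 : ℝ) • chi m MeasurableSet.univ) (ε • U), Lp.coeFn_smul ε U, hU]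
        with x h1 h2 h3 h4 h5 h6 h7
      rw [h1, h2, h3, h5, Pi.add_apply, h4, h6, Pi.smul_apply, h7, smul_eq_mul]
    · rw [e, differential_smul]
    · rw [gradient_congr h e, hs.gradient_smul ε hu]
  obtain ⟨F, hF⟩ := hf.exists_Linfty
  obtain ⟨G, hG⟩ := hg.exists_Linfty
  have hF' : F =ᵐ[m] (f : M →ₘ[m] ℝ) := by rw [hF]
  have hG' : G =ᵐ[m] (g : M →ₘ[m] ℝ) := by rw [hG]
  obtain ⟨f1, f2, f3, f4⟩ := key hf F hF'
  obtain ⟨g1, g2, g3, g4⟩ := key hg G hG'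
  have e1 := hs.gradient_sobolevMul _ _ f1 g1 _ _ f2 g2
  have e2 := differential_sobolevMul _ _ f1 g1 _ _ f2 g2
  have e3 := hs.gradient_sobolevMul f g hf hg F G hF' hG'
  have e4 := differential_sobolevMul f g hf hg F G hF' hG'
  set q := sobolevMul f g hf hg
  simp only [f4, g4, map_add, LinearMap.add_apply, map_smul,
    LinearMap.smul_apply, one_smul, LinftyPremodule.one_mul] at e1
  simp only [f3, g3, map_add, LinearMap.add_apply, map_smul,
    LinearMap.smul_apply, one_smul, LinftyPremodule.one_mul] at e2
  have hd : differential (ε • (f + g + ε • q)) =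
      differential (sobolevMul (sobolevConst m 1 + ε • f) (sobolevConst m 1 + ε • g) f1 g1) := by
    rw [e2, differential_smul, differential_add, differential_add, differential_smul, e4]
    simp only [smul_add]
    abel
  have hq : IsEssBounded ((f + g + ε • q : sobolevClass m) : M →ₘ[m] ℝ) :=
    isEssBounded_add (isEssBounded_add hf hg)
      (isEssBounded_smul ε (isEssBounded_sobolevMul f g hf hg))
  have hfin : ε • gradient h (f + g + ε • q) =
      ε • (gradient h f + gradient h g + ε • gradient h q) := by
    rw [← hs.gradient_smul ε hq, gradient_congr h hd, e1, e3]
    simp only [smul_add]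
    abel
  exact smul_right_injective _ hε hfin

/-- Pairing the preceding identity with the differential of f+g+εfg gives |D(f+g+εfg)|² as a
polynomial in ε. The left side is continuous at ε = 0 because |D·| is a pointwise seminorm, so its
limit is the constant term. -/
lemma GradientLeibniz.ae_weakGrad_add_sq {h : InfinitesimallyStrictlyConvex m}
    (hs : GradientLeibniz m h) {f g : sobolevClass m} (hf : IsEssBounded (f : M →ₘ[m] ℝ))
    (hg : IsEssBounded (g : M →ₘ[m] ℝ)) :
    ∀ᵐ x ∂m, weakGrad (f + g) x ^ 2 =
      (gradient h f + gradient h g) (differential (f + g)) x := by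
  set q := sobolevMul f g hf hg
  set X := gradient h f + gradient h g with hX
  set Z := gradient h q
  have hn : ∀ᵐ x ∂m, ∀ n : ℕ, weakGrad (f + g + (1 / ((n : ℝ) + 1)) • q) x ^ 2 =
      X (differential (f + g)) x + 1 / ((n : ℝ) + 1) * X (differential q) x +
        1 / ((n : ℝ) + 1) * (Z (differential (f + g)) x +
          1 / ((n : ℝ) + 1) * Z (differential q) x) := by
    refine ae_all_iff.2 fun n => ?_
    have hε : (1 / ((n : ℝ) + 1)) ≠ 0 := by positivity
    set ε := 1 / ((n : ℝ) + 1)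
    have e := (isGradient_gradient h (f + g + ε • q)).ae_apply_eq
    rw [hs.gradient_add_add hf hg hε, differential_add (f + g), differential_smul] at e
    filter_upwards [e, X.ae_add_apply (ε • Z) (differential (f + g) + ε • differential q),
      Z.ae_smul_apply ε (differential (f + g) + ε • differential q),
      X.ae_apply_add (differential (f + g)) (ε • differential q),
      Z.ae_apply_add (differential (f + g)) (ε • differential q),
      X.ae_apply_smul ε (differential q), Z.ae_apply_smul ε (differential q)]
      with x h1 h2 h3 h4 h5 h6 h7
    rw [← h1, h2, h3, h4, h5, h6, h7]
  have hd : ∀ᵐ x ∂m, ∀ n : ℕ,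
      |weakGrad (f + g + (1 / ((n : ℝ) + 1)) • q) x - weakGrad (f + g) x| ≤
        1 / ((n : ℝ) + 1) * weakGrad q x := by
    refine ae_all_iff.2 fun n => ?_
    have h1 := ae_abs_weakGrad_sub_le (f + g + (1 / ((n : ℝ) + 1)) • q) (f + g)
    rw [add_sub_cancel_left] at h1
    filter_upwards [h1, ae_weakGrad_smul' (1 / ((n : ℝ) + 1)) q] with x h1 h2
    rwa [h2, abs_of_nonneg (show (0 : ℝ) ≤ 1 / ((n : ℝ) + 1) by positivity)] at h1
  filter_upwards [hn, hd] with x h1 h2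
  have h0 := tendsto_one_div_add_atTop_nhds_zero_nat (𝕜 := ℝ)
  have h3 : Tendsto (fun n : ℕ => weakGrad (f + g + (1 / ((n : ℝ) + 1)) • q) x) atTop
      (𝓝 (weakGrad (f + g) x)) := by
    rw [tendsto_iff_norm_sub_tendsto_zero]
    refine squeeze_zero (fun n => norm_nonneg _) h2 ?_
    simpa using h0.mul_const (weakGrad q x)
  have h4 := ((h0.mul_const (X (differential q) x)).const_add (X (differential (f + g)) x)).add
    (h0.mul ((h0.mul_const (Z (differential q) x)).const_add (Z (differential (f + g)) x)))
  have h5 := tendsto_nhds_unique ((h3.pow 2).congr h1) h4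
  rw [h5]
  ring

/-- The Leibniz rule concerns bounded functions, to which the parallelogram law reduces by
truncation; the identity for f - g is the one for f + (-g). -/
lemma GradientLeibniz.pointwiseParallelogram {h : InfinitesimallyStrictlyConvex m}
    (hs : GradientLeibniz m h) : PointwiseParallelogram m := by
  refine PointwiseParallelogram.of_bounded_le fun f g hf hg => ?_
  have hng : IsEssBounded ((-g : sobolevClass m) : M →ₘ[m] ℝ) := by
    have := isEssBounded_smul (-1) hg
    rwa [show (-1 : ℝ) • g = -g from neg_one_smul ℝ g] at this
  have hm := hs.ae_weakGrad_add_sq hf hng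
  have e : gradient h (-g) = -gradient h g := by
    have := hs.gradient_smul (-1) hg
    rwa [show (-1 : ℝ) • g = -g from neg_one_smul ℝ g, neg_one_smul] at this
  rw [← sub_eq_add_neg, e] at hm
  filter_upwards [ae_parallelogram_of_gradient h f g (hs.ae_weakGrad_add_sq hf hg) hm] with x hx
  exact hx.le

lemma PointwiseParallelogram.gradientLeibniz (hP : PointwiseParallelogram m)
    (h : InfinitesimallyStrictlyConvex m) : GradientLeibniz m h := fun F G hF hG => by
  rw [gradient_eq_sharp hP, gradient_eq_sharp hP, gradient_eq_sharp hP, ← sobolevMul_eq,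
    differential_sobolevMul _ _ _ _ F G (EventuallyEq.refl _ _) (EventuallyEq.refl _ _), sharp_add,
    sharp_mul, sharp_mul]

end Converse

end

end MMS

theorem mainTheorem11 {M : Type*} [MetricSpace M] [CompleteSpace M] [SecondCountableTopology M]
    [MeasurableSpace M] [BorelSpace M] (m : Measure M) [IsLocallyFiniteMeasure m] :
    List.TFAE [
      MMS.InfinitesimallyHilbertian m,
      ∃ h : MMS.InfinitesimallyStrictlyConvex m, ∀ f g : MMS.sobolevClass m,
        (MMS.gradient h g) (MMS.differential f) = (MMS.gradient h f) (MMS.differential g),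
      MMS.IsHilbertModule m (MMS.Cotangent m) ∧ MMS.IsHilbertModule m (MMS.Tangent m),
      ∃ h : MMS.InfinitesimallyStrictlyConvex m, ∀ f g : MMS.sobolevClass m,
        MMS.gradient h (f + g) = MMS.gradient h f + MMS.gradient h g,
      ∃ h : MMS.InfinitesimallyStrictlyConvex m, ∀ (f g : Lp ℝ ∞ m)
        (hf : (f : M →ₘ[m] ℝ) ∈ MMS.sobolevClass m) (hg : (g : M →ₘ[m] ℝ) ∈ MMS.sobolevClass m),
        MMS.gradient h
            ⟨((f • g : Lp ℝ ∞ m) : M →ₘ[m] ℝ), MMS.sobolevClass_mul_mem f g hf hg⟩ =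
          MMS.LinftyPremodule.mul f (MMS.gradient h ⟨(g : M →ₘ[m] ℝ), hg⟩) +
            MMS.LinftyPremodule.mul g (MMS.gradient h ⟨(f : M →ₘ[m] ℝ), hf⟩)] := by
  -- Each condition is compared with the first one, in both directions by way of the pointwise
  -- parallelogram law.
  tfae_have 1 → 3 := fun h =>
    ⟨h.pointwiseParallelogram.isHilbertModule_cotangent,
      h.pointwiseParallelogram.isHilbertModule_tangent⟩
  tfae_have 3 → 1 := fun h =>
    (MMS.PointwiseParallelogram.of_isHilbertSpace_cotangent h.1.2).infinitesimallyHilbertian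
  tfae_have 1 → 2 := fun h => by
    have hP := h.pointwiseParallelogram
    refine ⟨hP.infinitesimallyStrictlyConvex, fun f g => ?_⟩
    rw [MMS.gradient_eq_sharp hP, MMS.gradient_eq_sharp hP]
    exact MMS.ptInner_comm _ _
  tfae_have 2 → 1 := fun ⟨h, hs⟩ =>
    (MMS.PointwiseParallelogram.of_gradient_comm h hs).infinitesimallyHilbertian
  tfae_have 1 → 4 := fun h => by
    have hP := h.pointwiseParallelogram
    refine ⟨hP.infinitesimallyStrictlyConvex, fun f g => ?_⟩
    rw [MMS.gradient_eq_sharp hP, MMS.gradient_eq_sharp hP, MMS.gradient_eq_sharp hP,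
      MMS.differential_add, MMS.sharp_add]
  tfae_have 4 → 1 := fun ⟨h, hs⟩ =>
    (MMS.PointwiseParallelogram.of_gradient_add h hs).infinitesimallyHilbertian
  tfae_have 1 → 5 := fun h =>
    have hP := h.pointwiseParallelogram
    ⟨hP.infinitesimallyStrictlyConvex, hP.gradientLeibniz _⟩
  tfae_have 5 → 1 := fun ⟨h, hs⟩ =>
    (MMS.GradientLeibniz.pointwiseParallelogram (h := h) hs).infinitesimallyHilbertian
  tfae_finish
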